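/- Let $\mu=N(0,1)$ be the standard Gaussian measure on $\mathbb R$, and let $H_m$, $m\ge 0$, be the Hermite polynomials normalized to be an orthonormal basis of $L^2(\mu)$. Let $f\in L^2(\mu)$ be real-valued and symmetric ($f(-x)=f(x)$ for $\mu$-almost every $x$), put $a_{2m}=\int f\,H_{2m}\,d\mu$, assume that $a_{2m}\neq 0$ for some $m\ge 1$, and let $$k_0=\min\{m\ge 1: a_{2m}\ne 0\}.$$ Let $0<r\le 2-\frac1{2k_0}$, and let $G=\{G(x),x\in\mathbb R\}$ be a mean zero (measurable) Gaussian process with stationary increments such that $E(G(x)-G(y))^2=\sigma^2(|x-y|)$ for all $x,y\in\mathbb R$, where $\sigma^2(h)=h^r$ for $h\ge 0$ and $\sigma(h)\ge 0$. Let $-\infty<a<b<\infty$ and, for $h>0$, let $$I_G(f,h;a,b)=\int_a^b f\left(\frac{G(x+h)-G(x)}{\sigma(h)}\right)dx .$$ Then for every $h>0$ this integral converges absolutely almost surely and defines a square-integrable random variable with $\operatorname{Var} I_G(f,h;a,b)>0$, and as $h\downarrow 0$ $$\frac{I_G(f,h;a,b)-(b-a)\int f\,d\mu}{\sqrt{\operatorname{Var}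 I_G(f,h;a,b)}}\ \longrightarrow\ N(0,1)\quad\text{in law.}$$ -/

import Mathlib

open MeasureTheory ProbabilityTheory Filter Topology

noncomputable section

/-- The Hermite polynomials `H_m`, normalized to be an orthonormal basis of `L²(μ)`, where `μ` is
the standard Gaussian measure: the probabilists' Hermite polynomial divided by `√(m!)`. -/
def hermiteH (m : ℕ) (x : ℝ) : ℝ :=
  Polynomial.aeval x (Polynomial.hermite m) / √(m.factorial : ℝ)

/-- The `m`-th Hermite coefficient `a_m = ∫ f(x) H_m(x) dμ(x)`. -/
def hermiteCoeff (f : ℝ → ℝ) (m : ℕ) : ℝ :=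
  ∫ x, f x * hermiteH m x ∂(gaussianReal 0 1)

/-- `G = {G(x), x ∈ ℝ}` is a mean zero Gaussian process under `P` whose increments variance is
`σ2`, that is `E (G(x) - G(y))² = σ2 (x - y)` for all `x, y`. (For a mean zero Gaussian process
this says exactly that the increments are stationary, with variance function `σ2`; it forces `σ2`
to be even.)

Joint measurability in `(x, ω)`, up to a null set, is what gives a meaning to integrals of the
process over `x`. -/
structure IsCenteredGaussianWithIncrVar {Ω : Type*} [MeasurableSpace Ω]
    (G : ℝ → Ω → ℝ) (P : Measure Ω) (σ2 : ℝ → ℝ) : Prop where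
  isGaussianProcess : IsGaussianProcess G P
  integral_eq_zero : ∀ x, ∫ ω, G x ω ∂P = 0
  integral_sq_incr : ∀ x y, ∫ ω, (G x ω - G y ω) ^ 2 ∂P = σ2 (x - y)
  aemeasurable_uncurry : AEMeasurable (fun p : ℝ × Ω => G p.1 p.2) (volume.prod P)

/-- The normalized increment `(G(x + h) - G(x)) / σ(h)`, with `σ(h) = √(σ2 h)`. -/
def normIncr {Ω : Type*} (G : ℝ → Ω → ℝ) (σ2 : ℝ → ℝ) (h x : ℝ) (ω : Ω) : ℝ :=
  (G (x + h) ω - G x ω) / √(σ2 h)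

/-- The functional `I_G(f, h; a, b) = ∫_a^b f ((G(x + h) - G(x)) / σ(h)) dx`. -/
def incrFunctional {Ω : Type*} (G : ℝ → Ω → ℝ) (σ2 : ℝ → ℝ) (f : ℝ → ℝ) (a b h : ℝ) (ω : Ω) : ℝ :=
  ∫ x in a..b, f (normIncr G σ2 h x ω)

end

/-! Put `d = 2 * k₀`. The normalized increments form a stationary Gaussian process of unit variance
with correlation `ρ (t / h)`, where `ρ = fracKernel r`. Symmetry of `f` and minimality of `k₀` leave
only Hermite degrees `m ≥ d` in `f - ∫ f dμ`, and the coefficient of degree `d` is nonzero.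
Different degrees contribute orthogonally to the functional, and degree `m` contributes variance
`a_m² ∫∫ ρ((x - y) / h)^m`. As `|ρ| ≤ 1` and `d` is even, that double integral is largest at `m =
d`. Hence the standardized functional is approximated in `L²`, uniformly in `h`, by functionals of
finite Hermite sums (`norm_integralLp_le`, `abs_repr_mul_sqrt_le_norm_integralLp`).

For a finite sum `Z` of variance `V`, Gaussian integration by parts yields a Stein kernel `T` with
`E[Z f(Z)] = E[T f'(Z)]` and `E T = V`. Taking exponentials for `f` gives a differential equation
for the characteristic function, and its distance to the Gaussian one is at most `s² E|T - V|`
(`norm_integral_exp_sub_le`). The variance of `T` is a sum over quadruples of points of Feynman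
diagrams with four vertices that connect two pairs (`exists_hermiteFourMoment_sub_eq`). Such a sum
is at most a constant times `L R_d ∑ R_p R_{d-p}`, where `R_p = 2 ∫_0^L |ρ(t / h)|^p` and `0 < p <
d` (`KernelBounds.sum_quadruple_le`). These estimates are made for Riemann sums, that is for finite
Gaussian vectors, with constants that depend neither on the grid nor on `h`; then the grid is
refined.

With `F_p(Λ) = ∫_0^Λ |ρ|^p` and `Λ = L / h`, the normalized error is governed by the ratios `F_p
F_{d-p} / (Λ F_d)`. Hölder's inequality alone bounds them by `1`. The condition on `r` makes
`|ρ(t)|^d = O(1 / t)`, so `F_d` gains only a bounded amount between `ε Λ` and `Λ`. Relative to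
`F_d(Λ)` this is negligible, whether `F_d` converges or diverges, so the mass of `|ρ|^d` sits in
`[0, ε Λ]` and the ratios tend to `0` (`tendsto_integral_pow_mul_integral_pow`). All this is
assembled in `eventually_norm_integral_exp_normalize_sub_le`. -/

/-! ### Stein's identity in one dimension -/

section Stein

variable {E : Type*} [NormedAddCommGroup E] [NormedSpace ℝ E]

theorem integrable_gaussianReal_iff (F : ℝ → E) :
    Integrable F (gaussianReal 0 1) ↔
      Integrable (fun x => gaussianPDFReal 0 1 x • F x) := by
  rw [gaussianReal_of_var_ne_zero 0 one_ne_zero,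
    integrable_withDensity_iff_integrable_smul' (measurable_gaussianPDF 0 1)
      (ae_of_all _ fun _ => gaussianPDF_lt_top)]
  simp only [toReal_gaussianPDF]

theorem hasDerivAt_gaussianPDFReal (x : ℝ) :
    HasDerivAt (gaussianPDFReal 0 1) (-x * gaussianPDFReal 0 1 x) x := by
  have h : HasDerivAt (fun x : ℝ => -(x - 0) ^ 2 / (2 * ((1 : NNReal) : ℝ))) (-x) x := by
    have := ((hasDerivAt_pow 2 x).fun_neg.div_const 2).congr_deriv
      (show -(((2 : ℕ) : ℝ) * x ^ (2 - 1)) / 2 = -x by norm_num; ring)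
    simpa using this
  have := (h.exp).const_mul ((√(2 * Real.pi * ((1 : NNReal) : ℝ)))⁻¹)
  refine this.congr_deriv ?_
  rw [gaussianPDFReal_def]
  ring

/-- **Stein's identity** for the standard Gaussian measure. -/
theorem integral_smul_gaussianReal_eq_integral_deriv {F F' : ℝ → E}
    (hF : ∀ x, HasDerivAt F (F' x) x)
    (h0 : Integrable F (gaussianReal 0 1)) (h1 : Integrable F' (gaussianReal 0 1))
    (h2 : Integrable (fun x => x • F x) (gaussianReal 0 1)) :
    ∫ x, x • F x ∂(gaussianReal 0 1) = ∫ x, F' x ∂(gaussianReal 0 1) := by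
  rw [integrable_gaussianReal_iff] at h0 h1 h2
  rw [integral_gaussianReal_eq_integral_smul one_ne_zero,
    integral_gaussianReal_eq_integral_smul one_ne_zero, eq_comm, ← sub_eq_zero,
    ← integral_sub h1 h2]
  refine integral_eq_zero_of_hasDerivAt_of_integrable
    (f := fun x => gaussianPDFReal 0 1 x • F x) (fun x => ?_) (h1.sub h2) h0
  refine ((hasDerivAt_gaussianPDFReal x).smul (hF x)).congr_deriv ?_
  simp [smul_smul, mul_comm, sub_eq_add_neg]

end Stein

/-! ### Gaussian vectors and integration by parts -/

section GaussianVector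

variable {Ω : Type*} [MeasurableSpace Ω] {P : Measure Ω} {ι : Type*}

/-- `Y` is a centered Gaussian vector with covariance matrix `C`. -/
structure IsGaussianVector (Y : ι → Ω → ℝ) (C : ι → ι → ℝ) (P : Measure Ω) : Prop where
  hasGaussianLaw : HasGaussianLaw (fun ω i => Y i ω) P
  integral_eq_zero : ∀ i, ∫ ω, Y i ω ∂P = 0
  integral_mul : ∀ i j, ∫ ω, Y i ω * Y j ω ∂P = C i j

namespace IsGaussianVector

variable {Y : ι → Ω → ℝ} {C : ι → ι → ℝ}

theorem isProbabilityMeasure (hY : IsGaussianVector Y C P) : IsProbabilityMeasure P :=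
  hY.hasGaussianLaw.isProbabilityMeasure

theorem aemeasurable (hY : IsGaussianVector Y C P) (i : ι) : AEMeasurable (Y i) P :=
  (hY.hasGaussianLaw.eval i).aemeasurable

theorem map_eq (hY : IsGaussianVector Y C P) {i : ι} (hi : C i i = 1) :
    P.map (Y i) = gaussianReal 0 1 := by
  have := hY.isProbabilityMeasure
  rw [(hY.hasGaussianLaw.eval i).map_eq_gaussianReal, hY.integral_eq_zero,
    variance_of_integral_eq_zero (hY.aemeasurable i) (hY.integral_eq_zero i)]
  have : ∫ ω, Y i ω ^ 2 ∂P = 1 := by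
    rw [← hi, ← hY.integral_mul]; simp only [sq]
  simp [this]

variable [Fintype ι] {E : Type*} [NormedAddCommGroup E] [NormedSpace ℝ E]

/-- The residual of the regression of a Gaussian vector on one coordinate of unit variance is
independent of that coordinate. -/
theorem indepFun_residual (hY : IsGaussianVector Y C P) {i : ι} (hi : C i i = 1) :
    IndepFun (Y i) (fun ω j => Y j ω - Y i ω * C i j) P := by
  have := hY.isProbabilityMeasure
  have hg := hY.hasGaussianLaw
  let Lm : (ι → ℝ) →L[ℝ] (Unit → ℝ) × (ι → ℝ) :=
    (ContinuousLinearMap.pi fun _ => ContinuousLinearMap.proj i).prod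
      (ContinuousLinearMap.pi fun j =>
        ContinuousLinearMap.proj j - (C i j) • ContinuousLinearMap.proj i)
  have h1 : HasGaussianLaw (fun ω => ((fun _ : Unit => Y i ω),
      (fun j => Y j ω - Y i ω * C i j))) P := by
    have hLm : (fun ω => Lm (fun j => Y j ω)) = fun ω => ((fun _ : Unit => Y i ω),
        (fun j => Y j ω - Y i ω * C i j)) := by
      ext ω j
      · rfl
      · simp [Lm, mul_comm]
    exact hLm ▸ hg.map_fun Lm
  have h2 := h1.indepFun_of_covariance_eval (X := fun _ : Unit => Y i)
    (Y := fun j ω => Y j ω - Y i ω * C i j) (fun _ j => ?_)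
  · exact h2.comp (φ := fun f : Unit → ℝ => f ()) (ψ := id) (by fun_prop) measurable_id
  · have hLp : ∀ j, MemLp (Y j) 2 P := fun j => (hg.eval j).memLp_two
    rw [covariance_fun_sub_right (hLp i) (hLp j) ((hLp i).mul_const _), covariance_mul_const_right,
      covariance_eq_sub (hLp i) (hLp j), covariance_eq_sub (hLp i) (hLp i)]
    simp only [Pi.mul_apply, hY.integral_eq_zero, hY.integral_mul, hi]
    ring

/-- **Gaussian integration by parts**: `F'` is the derivative of `F` in the direction of the
`i`-th row of the covariance matrix. -/
theorem integral_smul_eq (hY : IsGaussianVector Y C P) {i : ι} (hi : C i i = 1)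
    {F F' : (ι → ℝ) → E} (hFc : StronglyMeasurable F) (hFc' : StronglyMeasurable F')
    (hF : ∀ y, HasDerivAt (fun x : ℝ => F (y + x • C i)) (F' y) 0)
    (h0 : Integrable (fun ω => F (fun j => Y j ω)) P)
    (h1 : Integrable (fun ω => F' (fun j => Y j ω)) P)
    (h2 : Integrable (fun ω => Y i ω • F (fun j => Y j ω)) P) :
    ∫ ω, Y i ω • F (fun j => Y j ω) ∂P = ∫ ω, F' (fun j => Y j ω) ∂P := by
  have := hY.isProbabilityMeasure
  have hm := hY.aemeasurable
  set R : Ω → ι → ℝ := fun ω j => Y j ω - Y i ω * C i j with hR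
  have hRm : AEMeasurable R P := aemeasurable_pi_lambda _ fun j => (hm j).sub ((hm i).mul_const _)
  have hind := hY.indepFun_residual hi
  have hlaw := (indepFun_iff_map_prod_eq_prod_map_map (hm i) hRm).1 hind
  rw [hY.map_eq hi] at hlaw
  have hprob : IsProbabilityMeasure (P.map R) := Measure.isProbabilityMeasure_map hRm
  have hYR : ∀ ω, (fun j => Y j ω) = R ω + Y i ω • C i := by
    intro ω; ext j; simp [hR]
  have hpm : AEMeasurable (fun ω => (Y i ω, R ω)) P := (hm i).prodMk hRm
  have hmeas : Measurable (fun p : ℝ × (ι → ℝ) => p.2 + p.1 • C i) := by fun_prop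
  have hg0 : StronglyMeasurable (fun p : ℝ × (ι → ℝ) => F (p.2 + p.1 • C i)) :=
    hFc.comp_measurable hmeas
  have hg1 : StronglyMeasurable (fun p : ℝ × (ι → ℝ) => F' (p.2 + p.1 • C i)) :=
    hFc'.comp_measurable hmeas
  have hg2 : StronglyMeasurable (fun p : ℝ × (ι → ℝ) => p.1 • F (p.2 + p.1 • C i)) :=
    measurable_fst.stronglyMeasurable.smul hg0
  simp only [hYR] at h0 h1 h2 ⊢
  have i0 := (integrable_map_measure hg0.aestronglyMeasurable hpm).2 h0
  have i1 := (integrable_map_measure hg1.aestronglyMeasurable hpm).2 h1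
  have i2 := (integrable_map_measure hg2.aestronglyMeasurable hpm).2 h2
  rw [← integral_map hpm hg2.aestronglyMeasurable (f := fun p => p.1 • F (p.2 + p.1 • C i)),
    ← integral_map hpm hg1.aestronglyMeasurable (f := fun p => F' (p.2 + p.1 • C i))]
  rw [hlaw] at i0 i1 i2 ⊢
  rw [integral_prod_symm _ i2, integral_prod_symm _ i1]
  refine integral_congr_ae ?_
  -- Given the residual `y`, the vector runs along the line `y + x • C i` with `x` standard
  -- Gaussian, so the one-dimensional identity applies on almost every such line. The covariance
  -- matrix may be singular.
  filter_upwards [i0.prod_left_ae, i1.prod_left_ae, i2.prod_left_ae] with y j0 j1 j2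
  refine integral_smul_gaussianReal_eq_integral_deriv (fun x => ?_) j0 j1 j2
  have := hF (y + x • C i)
  have h3 := HasDerivAt.comp_sub_const x x (f := fun t => F (y + x • C i + t • C i))
    (by simpa using this)
  convert h3 using 2 with t
  congr 1
  simp only [add_assoc, ← add_smul]
  simp

end IsGaussianVector
end GaussianVector

/-! ### Random variables with all moments -/

section Moments

variable {Ω : Type*} [MeasurableSpace Ω] {P : Measure Ω}

/-- A real random variable all of whose moments are finite. -/
def HasAllMoments (X : Ω → ℝ) (P : Measure Ω) : Prop :=
  ∀ p : ENNReal, p ≠ ⊤ → MemLp X p P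

namespace HasAllMoments

variable {X Y : Ω → ℝ}

theorem const [IsFiniteMeasure P] (c : ℝ) : HasAllMoments (fun _ => c) P :=
  fun _ _ => memLp_const c

theorem mul (hX : HasAllMoments X P) (hY : HasAllMoments Y P) :
    HasAllMoments (fun ω => X ω * Y ω) P := fun p hp => by
  have : ENNReal.HolderTriple (2 * p) (2 * p) p := ⟨by
    rw [ENNReal.mul_inv (by simp) (by simp), ← add_mul, ENNReal.inv_two_add_inv_two, one_mul]⟩
  have h2 : 2 * p ≠ ⊤ := ENNReal.mul_ne_top (by simp) hp
  exact (hY _ h2).mul' (hX _ h2)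

theorem const_mul [IsFiniteMeasure P] (c : ℝ) (hX : HasAllMoments X P) :
    HasAllMoments (fun ω => c * X ω) P :=
  (const c).mul hX

theorem sum [IsFiniteMeasure P] {κ : Type*} (s : Finset κ) {X : κ → Ω → ℝ}
    (hX : ∀ k ∈ s, HasAllMoments (X k) P) : HasAllMoments (fun ω => ∑ k ∈ s, X k ω) P :=
  fun p hp => memLp_finsetSum s fun k hk => hX k hk p hp

theorem pow [IsFiniteMeasure P] (hX : HasAllMoments X P) (n : ℕ) :
    HasAllMoments (fun ω => X ω ^ n) P := by
  induction n with
  | zero => simpa using const 1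
  | succ n ih => simpa [pow_succ] using ih.mul hX

theorem eval [IsFiniteMeasure P] (hX : HasAllMoments X P) (q : Polynomial ℝ) :
    HasAllMoments (fun ω => q.eval (X ω)) P := by
  simp only [Polynomial.eval_eq_sum, Polynomial.sum]
  exact sum _ fun k _ => (hX.pow k).const_mul _

theorem integrable (hX : HasAllMoments X P) : Integrable X P :=
  memLp_one_iff_integrable.1 (hX 1 (by simp))

theorem memLp_two (hX : HasAllMoments X P) : MemLp X 2 P := hX 2 (by simp)

end HasAllMoments

theorem IsGaussianVector.hasAllMoments {ι : Type*} {Y : ι → Ω → ℝ} {C : ι → ι → ℝ}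
    (hY : IsGaussianVector Y C P) (i : ι) : HasAllMoments (Y i) P :=
  fun _ hp => (hY.hasGaussianLaw.eval i).memLp hp

end Moments

/-! ### Hermite polynomials over the reals -/

section Hermite

open Polynomial

/-- The probabilists' Hermite polynomials with real coefficients. -/
noncomputable def hermiteR (m : ℕ) : ℝ[X] := (hermite m).map (Int.castRingHom ℝ)

theorem aeval_hermite (m : ℕ) (x : ℝ) : aeval x (hermite m) = (hermiteR m).eval x := by
  rw [hermiteR, eval_map, aeval_def]
  rfl

@[simp] theorem hermiteR_zero : hermiteR 0 = 1 := by simp [hermiteR]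

theorem hermiteR_succ (m : ℕ) : hermiteR (m + 1) = X * hermiteR m - derivative (hermiteR m) := by
  simp [hermiteR, hermite_succ, derivative_map]

theorem derivative_hermiteR_succ (m : ℕ) :
    derivative (hermiteR (m + 1)) = C ((m : ℝ) + 1) * hermiteR m := by
  induction m with
  | zero => simp [hermiteR_succ]
  | succ m ih =>
    rw [hermiteR_succ (m + 1), derivative_sub, derivative_mul, ih, derivative_C_mul,
      hermiteR_succ m]
    simp
    ring

theorem derivative_hermiteR (m : ℕ) :
    derivative (hermiteR m) = C (m : ℝ) * hermiteR (m - 1) := by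
  cases m with
  | zero => simp
  | succ m => rw [derivative_hermiteR_succ]; simp

theorem natDegree_hermiteR (m : ℕ) : (hermiteR m).natDegree = m := by
  rw [hermiteR, (hermite_monic m).natDegree_map, natDegree_hermite]

theorem monic_hermiteR (m : ℕ) : (hermiteR m).Monic := (hermite_monic m).map _

end Hermite

/-! ### Hermite polynomials of Gaussian vectors -/

section HermiteGaussian

open Polynomial

variable {Ω : Type*} [MeasurableSpace Ω] {P : Measure Ω} {ι : Type*}
  {Y : ι → Ω → ℝ} {C : ι → ι → ℝ} {E : Type*} [NormedAddCommGroup E] [NormedSpace ℝ E]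

theorem hasDerivAt_eval_line (q : ℝ[X]) (y c : ι → ℝ) (j : ι) :
    HasDerivAt (fun x : ℝ => q.eval ((y + x • c) j)) (c j * (derivative q).eval (y j)) 0 := by
  have hline : HasDerivAt (fun x : ℝ => (y + x • c) j) (c j) 0 := by
    have := ((hasDerivAt_id (0 : ℝ)).mul_const (c j)).const_add (y j)
    simpa using this
  have := (q.hasDerivAt ((y + (0 : ℝ) • c) j)).comp (0 : ℝ) hline
  simpa [Function.comp_def, mul_comm] using this

variable [Fintype ι]

/-- Gaussian integration by parts against a Hermite polynomial. -/
theorem IsGaussianVector.integral_hermiteR_succ_smul (hY : IsGaussianVector Y C P) {i : ι}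
    (hi : C i i = 1) {F F' : (ι → ℝ) → E} (hFc : StronglyMeasurable F)
    (hFc' : StronglyMeasurable F')
    (hF : ∀ y, HasDerivAt (fun x : ℝ => F (y + x • C i)) (F' y) 0)
    (h0 : ∀ q : ℝ[X], Integrable (fun ω => q.eval (Y i ω) • F (fun j => Y j ω)) P)
    (h1 : ∀ q : ℝ[X], Integrable (fun ω => q.eval (Y i ω) • F' (fun j => Y j ω)) P) (l : ℕ) :
    ∫ ω, (hermiteR (l + 1)).eval (Y i ω) • F (fun j => Y j ω) ∂P =
      ∫ ω, (hermiteR l).eval (Y i ω) • F' (fun j => Y j ω) ∂P := by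
  have hpm : ∀ q : ℝ[X], StronglyMeasurable (fun y : ι → ℝ => q.eval (y i)) := fun q =>
    (q.continuous.measurable.comp (measurable_pi_apply i)).stronglyMeasurable
  -- The product rule adds the term `H_l' F`, the coordinate `y i` having derivative `C i i = 1` in
  -- the direction `C i`. The recursion `H_{l+1} = X H_l - H_l'` absorbs it.
  have key := hY.integral_smul_eq hi (F := fun y => (hermiteR l).eval (y i) • F y)
    (F' := fun y => (hermiteR l).eval (y i) • F' y + (derivative (hermiteR l)).eval (y i) • F y)
    ((hpm _).smul hFc) (((hpm _).smul hFc').add ((hpm _).smul hFc)) (fun y => ?_) (h0 _)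
    ((h1 _).add (h0 _)) ?_
  · rw [integral_add (h1 _) (h0 _)] at key
    rw [← sub_eq_iff_eq_add, ← integral_sub ?_ (h0 _)] at key
    · rw [← key]
      congr 1 with ω
      rw [hermiteR_succ]
      simp [sub_smul, mul_smul]
    · exact (h0 (X * hermiteR l)).congr (ae_of_all _ fun ω => by simp [mul_smul])
  · have hline : HasDerivAt (fun x : ℝ => (y + x • C i) i) 1 0 := by
      have := ((hasDerivAt_id (0 : ℝ)).const_add (y i))
      simpa [hi] using this
    have h3 : HasDerivAt (fun x : ℝ => (hermiteR l).eval ((y + x • C i) i))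
        ((derivative (hermiteR l)).eval (y i)) 0 := by
      have := ((hermiteR l).hasDerivAt ((y + (0 : ℝ) • C i) i)).comp (0 : ℝ) hline
      simpa [Function.comp_def] using this
    exact (h3.smul (hF y)).congr_deriv (by simp)
  · exact (h0 (X * hermiteR l)).congr (ae_of_all _ fun ω => by simp [mul_smul])

/-- Integration by parts of a Hermite polynomial against a product of three polynomials. -/
theorem IsGaussianVector.integral_hermiteR_succ_mul (hY : IsGaussianVector Y C P) {i : ι}
    (hi : C i i = 1) (j k m : ι) (A B D : ℝ[X]) (l : ℕ) :
    ∫ ω, (hermiteR (l + 1)).eval (Y i ω) * (A.eval (Y j ω) * B.eval (Y k ω) * D.eval (Y m ω)) ∂P =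
      C i j * ∫ ω, (hermiteR l).eval (Y i ω) *
        ((derivative A).eval (Y j ω) * B.eval (Y k ω) * D.eval (Y m ω)) ∂P +
      C i k * ∫ ω, (hermiteR l).eval (Y i ω) *
        (A.eval (Y j ω) * (derivative B).eval (Y k ω) * D.eval (Y m ω)) ∂P +
      C i m * ∫ ω, (hermiteR l).eval (Y i ω) *
        (A.eval (Y j ω) * B.eval (Y k ω) * (derivative D).eval (Y m ω)) ∂P := by
  have := hY.isProbabilityMeasure
  have hpm : ∀ (q : ℝ[X]) j, Measurable (fun y : ι → ℝ => q.eval (y j)) := fun q j =>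
    (q.continuous.measurable.comp (measurable_pi_apply j))
  have hmom : ∀ (q : ℝ[X]) j, HasAllMoments (fun ω => q.eval (Y j ω)) P :=
    fun q j => (hY.hasAllMoments j).eval q
  have h3 : ∀ q A B D : ℝ[X], Integrable (fun ω => q.eval (Y i ω) *
      (A.eval (Y j ω) * B.eval (Y k ω) * D.eval (Y m ω))) P := fun q A B D =>
    ((hmom q i).mul (((hmom A j).mul (hmom B k)).mul (hmom D m))).integrable
  have key := hY.integral_hermiteR_succ_smul hi
    (F := fun y => A.eval (y j) * B.eval (y k) * D.eval (y m))
    (F' := fun y => C i j * ((derivative A).eval (y j) * B.eval (y k) * D.eval (y m)) +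
      C i k * (A.eval (y j) * (derivative B).eval (y k) * D.eval (y m)) +
      C i m * (A.eval (y j) * B.eval (y k) * (derivative D).eval (y m)))
    (((hpm A j).mul (hpm B k)).mul (hpm D m)).stronglyMeasurable
    (((((((hpm _ j).mul (hpm _ k)).mul (hpm _ m)).const_mul _).add
      ((((hpm _ j).mul (hpm _ k)).mul (hpm _ m)).const_mul _)).add
      ((((hpm _ j).mul (hpm _ k)).mul (hpm _ m)).const_mul _)).stronglyMeasurable)
    (fun y => ?_) (fun q => h3 q A B D) (fun q => ?_) l
  · simp only [smul_eq_mul] at key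
    rw [key, ← integral_const_mul, ← integral_const_mul, ← integral_const_mul, ← integral_add,
      ← integral_add]
    · congr 1 with ω
      ring
    · exact ((h3 _ _ _ _).const_mul _).add ((h3 _ _ _ _).const_mul _)
    · exact (h3 _ _ _ _).const_mul _
    · exact (h3 _ _ _ _).const_mul _
    · exact (h3 _ _ _ _).const_mul _
  · have := ((hasDerivAt_eval_line A y (C i) j).mul (hasDerivAt_eval_line B y (C i) k)).mul
      (hasDerivAt_eval_line D y (C i) m)
    refine this.congr_deriv ?_
    simp
    ring
  · refine ((((h3 q (derivative A) B D).const_mul (C i j)).add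
      ((h3 q A (derivative B) D).const_mul (C i k))).add
      ((h3 q A B (derivative D)).const_mul (C i m))).congr (ae_of_all _ fun ω => ?_)
    simp
    ring

/-- One step of Wick pairing: a leg at vertex `i` is joined to one of the legs at `j`, `k` or `m`.
Where the subtraction in `b - 1`, `c - 1` or `e - 1` is truncated, the factor in front vanishes. -/
theorem IsGaussianVector.integral_hermiteR_succ_mul_hermiteR (hY : IsGaussianVector Y C P) {i : ι}
    (hi : C i i = 1) (j k m : ι) (b c e l : ℕ) :
    ∫ ω, (hermiteR (l + 1)).eval (Y i ω) * ((hermiteR b).eval (Y j ω) * (hermiteR c).eval (Y k ω) *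
        (hermiteR e).eval (Y m ω)) ∂P =
      b * C i j * ∫ ω, (hermiteR l).eval (Y i ω) * ((hermiteR (b - 1)).eval (Y j ω) *
        (hermiteR c).eval (Y k ω) * (hermiteR e).eval (Y m ω)) ∂P +
      c * C i k * ∫ ω, (hermiteR l).eval (Y i ω) * ((hermiteR b).eval (Y j ω) *
        (hermiteR (c - 1)).eval (Y k ω) * (hermiteR e).eval (Y m ω)) ∂P +
      e * C i m * ∫ ω, (hermiteR l).eval (Y i ω) * ((hermiteR b).eval (Y j ω) *
        (hermiteR c).eval (Y k ω) * (hermiteR (e - 1)).eval (Y m ω)) ∂P := by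
  rw [hY.integral_hermiteR_succ_mul hi]
  simp only [derivative_hermiteR, eval_mul, eval_C]
  have e1 : ∀ (x a b c d : ℝ), x * (a * b * c * d) = a * (x * (b * c * d)) := by intros; ring
  have e2 : ∀ (x a b c d : ℝ), x * (b * (a * c) * d) = a * (x * (b * c * d)) := by intros; ring
  have e3 : ∀ (x a b c d : ℝ), x * (b * c * (a * d)) = a * (x * (b * c * d)) := by intros; ring
  simp only [e1, e2, e3, integral_const_mul]
  ring

/-- The two-point formula for Hermite polynomials. -/
theorem IsGaussianVector.integral_hermiteR_mul_hermiteR (hY : IsGaussianVector Y C P) {i : ι}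
    (hi : C i i = 1) {j : ι} (hj : C j j = 1) (a b : ℕ) :
    ∫ ω, (hermiteR a).eval (Y i ω) * (hermiteR b).eval (Y j ω) ∂P =
      if a = b then a.factorial * C i j ^ a else 0 := by
  have := hY.isProbabilityMeasure
  have hz : ∀ k, C k k = 1 → ∀ n, ∫ ω, (hermiteR (n + 1)).eval (Y k ω) ∂P = 0 := by
    intro k hk n
    have := hY.integral_hermiteR_succ_mul_hermiteR hk k k k 0 0 0 n
    simpa using this
  induction a generalizing b with
  | zero =>
    cases b with
    | zero => simp
    | succ b => simpa using hz j hj b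
  | succ a ih =>
    have := hY.integral_hermiteR_succ_mul_hermiteR hi j j j b 0 0 a
    simp only [hermiteR_zero, eval_one, mul_one, CharP.cast_eq_zero, zero_mul, add_zero] at this
    rw [this]
    cases b with
    | zero => simp
    | succ b =>
      rw [Nat.add_sub_cancel, ih b]
      by_cases h : a = b
      · subst h
        simp [Nat.factorial_succ, pow_succ]
        ring
      · simp [h]

end HermiteGaussian

/-! ### Feynman diagrams on four vertices -/

section Diagrams

/-- A monomial in the six covariances between four variables. -/
def diagramMonomial (k01 k02 k03 k12 k13 k23 : ℕ) (C : Fin 4 → Fin 4 → ℝ) : ℝ :=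
  C 0 1 ^ k01 * C 0 2 ^ k02 * C 0 3 ^ k03 * C 1 2 ^ k12 * C 1 3 ^ k13 * C 2 3 ^ k23

/-- The monomials of the Feynman diagrams on four vertices of degrees `a`, `b`, `c`, `e`. -/
def diagrams (a b c e : ℕ) : Set ((Fin 4 → Fin 4 → ℝ) → ℝ) :=
  {φ | ∃ k01 k02 k03 k12 k13 k23, k01 + k02 + k03 = a ∧ k01 + k12 + k13 = b ∧
    k02 + k12 + k23 = c ∧ k03 + k13 + k23 = e ∧ φ = diagramMonomial k01 k02 k03 k12 k13 k23}

/-- The monomials of those diagrams in which some edge joins `{0, 1}` and `{2, 3}`. -/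
def crossDiagrams (a b c e : ℕ) : Set ((Fin 4 → Fin 4 → ℝ) → ℝ) :=
  {φ | ∃ k01 k02 k03 k12 k13 k23, k01 + k02 + k03 = a ∧ k01 + k12 + k13 = b ∧
    k02 + k12 + k23 = c ∧ k03 + k13 + k23 = e ∧ 1 ≤ k02 + k03 + k12 + k13 ∧
    φ = diagramMonomial k01 k02 k03 k12 k13 k23}

theorem mul_mem_span_of_forall {α : Type*} {S T : Set (α → ℝ)} (g : α → ℝ)
    (h : ∀ φ ∈ S, g * φ ∈ T) {φ : α → ℝ} (hφ : φ ∈ Submodule.span ℝ S) :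
    g * φ ∈ Submodule.span ℝ T := by
  induction hφ using Submodule.span_induction with
  | mem x hx => exact Submodule.subset_span (h x hx)
  | zero => simp
  | add x y _ _ hx hy => rw [mul_add]; exact add_mem hx hy
  | smul c x _ hx => rw [mul_smul_comm]; exact Submodule.smul_mem _ _ hx

variable {a b c e : ℕ} {φ : (Fin 4 → Fin 4 → ℝ) → ℝ}

/-- A new edge raises the degrees of its two ends by one. The six tuples list the possible edges
with the resulting degrees. -/
theorem mul_mem_span_diagrams (i j : Fin 4) (a' b' c' e' : ℕ)
    (h : (i, j, a', b', c', e') ∈ ({(0, 1, a + 1, b + 1, c, e), (0, 2, a + 1, b, c + 1, e),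
      (0, 3, a + 1, b, c, e + 1), (1, 2, a, b + 1, c + 1, e), (1, 3, a, b + 1, c, e + 1),
      (2, 3, a, b, c + 1, e + 1)} : Set _))
    (hφ : φ ∈ Submodule.span ℝ (diagrams a b c e)) :
    (fun C => C i j) * φ ∈ Submodule.span ℝ (diagrams a' b' c' e') := by
  refine mul_mem_span_of_forall _ ?_ hφ
  rintro φ ⟨k01, k02, k03, k12, k13, k23, h1, h2, h3, h4, rfl⟩
  simp only [Set.mem_insert_iff, Set.mem_singleton_iff, Prod.mk.injEq] at h
  rcases h with ⟨rfl, rfl, rfl, rfl, rfl, rfl⟩ | ⟨rfl, rfl, rfl, rfl, rfl, rfl⟩ |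
    ⟨rfl, rfl, rfl, rfl, rfl, rfl⟩ | ⟨rfl, rfl, rfl, rfl, rfl, rfl⟩ |
    ⟨rfl, rfl, rfl, rfl, rfl, rfl⟩ | ⟨rfl, rfl, rfl, rfl, rfl, rfl⟩
  · refine ⟨k01 + 1, k02, k03, k12, k13, k23, by lia, by lia, by lia, by lia, ?_⟩
    ext C; simp [diagramMonomial, pow_succ]; ring
  · refine ⟨k01, k02 + 1, k03, k12, k13, k23, by lia, by lia, by lia, by lia, ?_⟩
    ext C; simp [diagramMonomial, pow_succ]; ring
  · refine ⟨k01, k02, k03 + 1, k12, k13, k23, by lia, by lia, by lia, by lia, ?_⟩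
    ext C; simp [diagramMonomial, pow_succ]; ring
  · refine ⟨k01, k02, k03, k12 + 1, k13, k23, by lia, by lia, by lia, by lia, ?_⟩
    ext C; simp [diagramMonomial, pow_succ]; ring
  · refine ⟨k01, k02, k03, k12, k13 + 1, k23, by lia, by lia, by lia, by lia, ?_⟩
    ext C; simp [diagramMonomial, pow_succ]; ring
  · refine ⟨k01, k02, k03, k12, k13, k23 + 1, by lia, by lia, by lia, by lia, ?_⟩
    ext C; simp [diagramMonomial, pow_succ]; ring

/-- The added edge itself joins the two pairs, so nothing is required of the diagrams in `φ`. -/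
theorem mul_mem_span_crossDiagrams (i j : Fin 4) (a' b' c' e' : ℕ)
    (h : (i, j, a', b', c', e') ∈ ({(0, 2, a + 1, b, c + 1, e),
      (0, 3, a + 1, b, c, e + 1), (1, 2, a, b + 1, c + 1, e), (1, 3, a, b + 1, c, e + 1)} : Set _))
    (hφ : φ ∈ Submodule.span ℝ (diagrams a b c e)) :
    (fun C => C i j) * φ ∈ Submodule.span ℝ (crossDiagrams a' b' c' e') := by
  refine mul_mem_span_of_forall _ ?_ hφ
  rintro φ ⟨k01, k02, k03, k12, k13, k23, h1, h2, h3, h4, rfl⟩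
  simp only [Set.mem_insert_iff, Set.mem_singleton_iff, Prod.mk.injEq] at h
  rcases h with ⟨rfl, rfl, rfl, rfl, rfl, rfl⟩ | ⟨rfl, rfl, rfl, rfl, rfl, rfl⟩ |
    ⟨rfl, rfl, rfl, rfl, rfl, rfl⟩ | ⟨rfl, rfl, rfl, rfl, rfl, rfl⟩
  · refine ⟨k01, k02 + 1, k03, k12, k13, k23, by lia, by lia, by lia, by lia, by lia, ?_⟩
    ext C; simp [diagramMonomial, pow_succ]; ring
  · refine ⟨k01, k02, k03 + 1, k12, k13, k23, by lia, by lia, by lia, by lia, by lia, ?_⟩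
    ext C; simp [diagramMonomial, pow_succ]; ring
  · refine ⟨k01, k02, k03, k12 + 1, k13, k23, by lia, by lia, by lia, by lia, by lia, ?_⟩
    ext C; simp [diagramMonomial, pow_succ]; ring
  · refine ⟨k01, k02, k03, k12, k13 + 1, k23, by lia, by lia, by lia, by lia, by lia, ?_⟩
    ext C; simp [diagramMonomial, pow_succ]; ring

/-- The edge from `0` to `1` stays within a pair, so here the crossing edge has to be present
already. -/
theorem mul_zero_one_mem_span_crossDiagrams
    (hφ : φ ∈ Submodule.span ℝ (crossDiagrams a b c e)) :
    (fun C => C 0 1) * φ ∈ Submodule.span ℝ (crossDiagrams (a + 1) (b + 1) c e) := by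
  refine mul_mem_span_of_forall _ ?_ hφ
  rintro φ ⟨k01, k02, k03, k12, k13, k23, h1, h2, h3, h4, h5, rfl⟩
  refine ⟨k01 + 1, k02, k03, k12, k13, k23, by lia, by lia, by lia, by lia, by lia, ?_⟩
  ext C; simp [diagramMonomial, pow_succ]; ring

end Diagrams

/-! ### Fourth moments of Hermite polynomials and their connected part -/

section FourMoment

variable {Ω : Type*} [MeasurableSpace Ω]

/-- The expectation of a product of four Hermite polynomials in the coordinates of `Y`. -/
noncomputable def hermiteFourMoment (P : Measure Ω) (Y : Fin 4 → Ω → ℝ) (a b c e : ℕ) : ℝ :=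
  ∫ ω, (hermiteR a).eval (Y 0 ω) * ((hermiteR b).eval (Y 1 ω) * (hermiteR c).eval (Y 2 ω) *
    (hermiteR e).eval (Y 3 ω)) ∂P

variable {P : Measure Ω} {Y : Fin 4 → Ω → ℝ} {C : Fin 4 → Fin 4 → ℝ}

theorem hermiteFourMoment_succ (hY : IsGaussianVector Y C P) (hC : ∀ i, C i i = 1)
    (a b c e : ℕ) : hermiteFourMoment P Y (a + 1) b c e =
      b * C 0 1 * hermiteFourMoment P Y a (b - 1) c e +
      c * C 0 2 * hermiteFourMoment P Y a b (c - 1) e +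
      e * C 0 3 * hermiteFourMoment P Y a b c (e - 1) :=
  hY.integral_hermiteR_succ_mul_hermiteR (hC 0) 1 2 3 b c e a

theorem hermiteFourMoment_zero_succ (hY : IsGaussianVector Y C P) (hC : ∀ i, C i i = 1)
    (b c e : ℕ) : hermiteFourMoment P Y 0 (b + 1) c e =
      c * C 1 2 * hermiteFourMoment P Y 0 b (c - 1) e +
      e * C 1 3 * hermiteFourMoment P Y 0 b c (e - 1) := by
  have := hY.integral_hermiteR_succ_mul_hermiteR (hC 1) 0 2 3 0 c e b
  simpa [hermiteFourMoment, mul_assoc] using this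

theorem hermiteFourMoment_zero_zero (hY : IsGaussianVector Y C P) (hC : ∀ i, C i i = 1)
    (c e : ℕ) : hermiteFourMoment P Y 0 0 c e = if c = e then c.factorial * C 2 3 ^ c else 0 := by
  simpa [hermiteFourMoment] using hY.integral_hermiteR_mul_hermiteR (hC 2) (hC 3) c e

/-- If `M (n - 1)` is a function in a span, then so is `n * g * M (n - 1)`, where it is enough to
consider `n ≠ 0`. -/
theorem exists_mem_span_mul_pred {α β : Type*} (v : α → β) {T : Set (β → ℝ)} (M : ℕ → α → ℝ)
    (g : β → ℝ) (n : ℕ)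
    (h : ∀ m, n = m + 1 → ∃ φ : β → ℝ, g * φ ∈ Submodule.span ℝ T ∧ ∀ x, M m x = φ (v x)) :
    ∃ φ ∈ Submodule.span ℝ T, ∀ x, n * g (v x) * M (n - 1) x = φ (v x) := by
  cases n with
  | zero => exact ⟨0, zero_mem _, by simp⟩
  | succ m =>
    obtain ⟨φ, hφ, h⟩ := h m rfl
    exact ⟨_, Submodule.smul_mem _ ((m + 1 : ℕ) : ℝ) hφ, fun x => by simp [h, mul_assoc]⟩

variable (P) in
/-- The family of all unit variance Gaussian vectors of length four. -/
def UnitGaussianFour : Type _ :=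
  {p : (Fin 4 → Ω → ℝ) × (Fin 4 → Fin 4 → ℝ) // IsGaussianVector p.1 p.2 P ∧ ∀ i, p.2 i i = 1}

/-- Wick pairing is iterated, exhausting the legs of vertex `0` and then those of vertex `1`. The
combination `φ` is fixed before the vector: its coefficients depend on the degrees alone, which is
what later makes the constants uniform over grids and processes. -/
theorem exists_hermiteFourMoment_eq (a b c e : ℕ) :
    ∃ φ ∈ Submodule.span ℝ (diagrams a b c e), ∀ p : UnitGaussianFour P,
      hermiteFourMoment P p.1.1 a b c e = φ p.1.2 := by
  induction a generalizing b c e with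
  | zero =>
    induction b generalizing c e with
    | zero =>
      by_cases h : c = e
      · subst h
        refine ⟨(c.factorial : ℝ) • diagramMonomial 0 0 0 0 0 c, Submodule.smul_mem _ _
          (Submodule.subset_span ⟨0, 0, 0, 0, 0, c, by simp⟩), fun p => ?_⟩
        rw [hermiteFourMoment_zero_zero p.2.1 p.2.2]
        simp [diagramMonomial]
      · refine ⟨0, zero_mem _, fun p => ?_⟩
        rw [hermiteFourMoment_zero_zero p.2.1 p.2.2]
        simp [h]
    | succ b ih =>
      obtain ⟨φ₁, h₁, e₁⟩ := exists_mem_span_mul_pred (fun p : UnitGaussianFour P => p.1.2)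
        (T := diagrams 0 (b + 1) c e) (fun c p => hermiteFourMoment P p.1.1 0 b c e)
        (fun C => C 1 2) c (fun m hm => by
          obtain ⟨φ, h, e⟩ := ih m e
          exact ⟨φ, mul_mem_span_diagrams 1 2 _ _ _ _ (by simp [hm]) h, e⟩)
      obtain ⟨φ₂, h₂, e₂⟩ := exists_mem_span_mul_pred (fun p : UnitGaussianFour P => p.1.2)
        (T := diagrams 0 (b + 1) c e) (fun e p => hermiteFourMoment P p.1.1 0 b c e)
        (fun C => C 1 3) e (fun m hm => by
          obtain ⟨φ, h, e⟩ := ih c m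
          exact ⟨φ, mul_mem_span_diagrams 1 3 _ _ _ _ (by simp [hm]) h, e⟩)
      refine ⟨φ₁ + φ₂, add_mem h₁ h₂, fun p => ?_⟩
      rw [hermiteFourMoment_zero_succ p.2.1 p.2.2, Pi.add_apply, ← e₁, ← e₂]
  | succ a ih =>
    obtain ⟨φ₀, h₀, e₀⟩ := exists_mem_span_mul_pred (fun p : UnitGaussianFour P => p.1.2)
      (T := diagrams (a + 1) b c e) (fun b p => hermiteFourMoment P p.1.1 a b c e)
      (fun C => C 0 1) b (fun m hm => by
        obtain ⟨φ, h, e⟩ := ih m c e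
        exact ⟨φ, mul_mem_span_diagrams 0 1 _ _ _ _ (by simp [hm]) h, e⟩)
    obtain ⟨φ₁, h₁, e₁⟩ := exists_mem_span_mul_pred (fun p : UnitGaussianFour P => p.1.2)
      (T := diagrams (a + 1) b c e) (fun c p => hermiteFourMoment P p.1.1 a b c e)
      (fun C => C 0 2) c (fun m hm => by
        obtain ⟨φ, h, e⟩ := ih b m e
        exact ⟨φ, mul_mem_span_diagrams 0 2 _ _ _ _ (by simp [hm]) h, e⟩)
    obtain ⟨φ₂, h₂, e₂⟩ := exists_mem_span_mul_pred (fun p : UnitGaussianFour P => p.1.2)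
      (T := diagrams (a + 1) b c e) (fun e p => hermiteFourMoment P p.1.1 a b c e)
      (fun C => C 0 3) e (fun m hm => by
        obtain ⟨φ, h, e⟩ := ih b c m
        exact ⟨φ, mul_mem_span_diagrams 0 3 _ _ _ _ (by simp [hm]) h, e⟩)
    refine ⟨φ₀ + φ₁ + φ₂, add_mem (add_mem h₀ h₁) h₂, fun p => ?_⟩
    rw [hermiteFourMoment_succ p.2.1 p.2.2, Pi.add_apply, Pi.add_apply, ← e₀, ← e₁, ← e₂]

/-- The product of the two-point moments of the pairs `{0, 1}` and `{2, 3}`. -/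
noncomputable def hermitePairMoment (C : Fin 4 → Fin 4 → ℝ) (a b c e : ℕ) : ℝ :=
  (if a = b then a.factorial * C 0 1 ^ a else 0) * (if c = e then c.factorial * C 2 3 ^ c else 0)

/-- The same recursion as the first term of `hermiteFourMoment_succ`. In the difference of the two
moments a pairing of `0` with `1` therefore reproduces a difference, while pairings with `2` or `3`
create a crossing edge. -/
theorem hermitePairMoment_succ (C : Fin 4 → Fin 4 → ℝ) (a b c e : ℕ) :
    hermitePairMoment C (a + 1) b c e = b * C 0 1 * hermitePairMoment C a (b - 1) c e := by
  cases b with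
  | zero => simp [hermitePairMoment]
  | succ b =>
    by_cases h : a = b
    · subst h
      simp [hermitePairMoment, Nat.factorial_succ, pow_succ]
      ring_nf
    · simp [hermitePairMoment, h]

/-- The covariance of `H_a(Y₀) H_b(Y₁)` and `H_c(Y₂) H_e(Y₃)` is a combination of the monomials
of the diagrams that connect the two pairs. -/
theorem exists_hermiteFourMoment_sub_eq (a b c e : ℕ) :
    ∃ φ ∈ Submodule.span ℝ (crossDiagrams a b c e), ∀ p : UnitGaussianFour P,
      hermiteFourMoment P p.1.1 a b c e - hermitePairMoment p.1.2 a b c e = φ p.1.2 := by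
  induction a generalizing b c e with
  | zero =>
    cases b with
    | zero =>
      refine ⟨0, zero_mem _, fun p => ?_⟩
      rw [hermiteFourMoment_zero_zero p.2.1 p.2.2]
      simp [hermitePairMoment]
    | succ b =>
      obtain ⟨φ₁, h₁, e₁⟩ := exists_mem_span_mul_pred (fun p : UnitGaussianFour P => p.1.2)
        (T := crossDiagrams 0 (b + 1) c e) (fun c p => hermiteFourMoment P p.1.1 0 b c e)
        (fun C => C 1 2) c (fun m hm => by
          obtain ⟨φ, h, e⟩ := exists_hermiteFourMoment_eq (P := P) 0 b m e
          exact ⟨φ, mul_mem_span_crossDiagrams 1 2 _ _ _ _ (by simp [hm]) h, e⟩)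
      obtain ⟨φ₂, h₂, e₂⟩ := exists_mem_span_mul_pred (fun p : UnitGaussianFour P => p.1.2)
        (T := crossDiagrams 0 (b + 1) c e) (fun e p => hermiteFourMoment P p.1.1 0 b c e)
        (fun C => C 1 3) e (fun m hm => by
          obtain ⟨φ, h, e⟩ := exists_hermiteFourMoment_eq (P := P) 0 b c m
          exact ⟨φ, mul_mem_span_crossDiagrams 1 3 _ _ _ _ (by simp [hm]) h, e⟩)
      refine ⟨φ₁ + φ₂, add_mem h₁ h₂, fun p => ?_⟩
      rw [hermiteFourMoment_zero_succ p.2.1 p.2.2, Pi.add_apply, ← e₁, ← e₂]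
      simp [hermitePairMoment]
  | succ a ih =>
    obtain ⟨φ₀, h₀, e₀⟩ := exists_mem_span_mul_pred (fun p : UnitGaussianFour P => p.1.2)
      (T := crossDiagrams (a + 1) b c e) (fun b p => hermiteFourMoment P p.1.1 a b c e -
        hermitePairMoment p.1.2 a b c e)
      (fun C => C 0 1) b (fun m hm => by
        obtain ⟨φ, h, e⟩ := ih m c e
        exact ⟨φ, hm ▸ mul_zero_one_mem_span_crossDiagrams h, e⟩)
    obtain ⟨φ₁, h₁, e₁⟩ := exists_mem_span_mul_pred (fun p : UnitGaussianFour P => p.1.2)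
      (T := crossDiagrams (a + 1) b c e) (fun c p => hermiteFourMoment P p.1.1 a b c e)
      (fun C => C 0 2) c (fun m hm => by
        obtain ⟨φ, h, e⟩ := exists_hermiteFourMoment_eq (P := P) a b m e
        exact ⟨φ, mul_mem_span_crossDiagrams 0 2 _ _ _ _ (by simp [hm]) h, e⟩)
    obtain ⟨φ₂, h₂, e₂⟩ := exists_mem_span_mul_pred (fun p : UnitGaussianFour P => p.1.2)
      (T := crossDiagrams (a + 1) b c e) (fun e p => hermiteFourMoment P p.1.1 a b c e)
      (fun C => C 0 3) e (fun m hm => by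
        obtain ⟨φ, h, e⟩ := exists_hermiteFourMoment_eq (P := P) a b c m
        exact ⟨φ, mul_mem_span_crossDiagrams 0 3 _ _ _ _ (by simp [hm]) h, e⟩)
    refine ⟨φ₀ + φ₁ + φ₂, add_mem (add_mem h₀ h₁) h₂, fun p => ?_⟩
    rw [hermiteFourMoment_succ p.2.1 p.2.2, hermitePairMoment_succ, Pi.add_apply, Pi.add_apply,
      ← e₀, ← e₁, ← e₂]
    ring

end FourMoment

/-! ### Bounds for sums of connected diagrams -/

section DiagramSums

/-- The product is at most the corresponding power of the largest of the three numbers. Surplus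
exponents can be dropped because the numbers are at most `1`. -/
theorem pow_mul_pow_mul_pow_le {x y z : ℝ} (hx : 0 ≤ x) (hy : 0 ≤ y) (hz : 0 ≤ z) (hx1 : x ≤ 1)
    (hy1 : y ≤ 1) (hz1 : z ≤ 1) {a b c d : ℕ} (h : d ≤ a + b + c) :
    x ^ a * y ^ b * z ^ c ≤ x ^ d + y ^ d + z ^ d := by
  set M := max x (max y z) with hM
  have hxM : x ≤ M := le_max_left _ _
  have hyM : y ≤ M := (le_max_left _ _).trans (le_max_right _ _)
  have hzM : z ≤ M := (le_max_right _ _).trans (le_max_right _ _)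
  have hM0 : 0 ≤ M := hx.trans hxM
  have hM1 : M ≤ 1 := max_le hx1 (max_le hy1 hz1)
  calc x ^ a * y ^ b * z ^ c ≤ M ^ a * M ^ b * M ^ c := by gcongr
    _ = M ^ (a + b + c) := by rw [pow_add, pow_add]
    _ ≤ M ^ d := pow_le_pow_of_le_one hM0 hM1 h
    _ ≤ x ^ d + y ^ d + z ^ d := by
      have := pow_nonneg hx d
      have := pow_nonneg hy d
      have := pow_nonneg hz d
      have hcases : M = x ∨ M = y ∨ M = z := by
        rcases max_choice x (max y z) with h | h
        · exact Or.inl h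
        · rcases max_choice y z with h' | h'
          · exact Or.inr (Or.inl (h.trans h'))
          · exact Or.inr (Or.inr (h.trans h'))
      rcases hcases with h | h | h <;> rw [h] <;> linarith

variable {ι : Type*} [Fintype ι]

/-- A symmetric kernel with values in `[0, 1]` on a finite weighted set, the row sums of whose
powers are bounded by `R`, in such a way that `R p * R (d - p) ≤ Q` for `1 ≤ p < d`. -/
structure KernelBounds (w : ι → ℝ) (K : ι → ι → ℝ) (d : ℕ) (R : ℕ → ℝ) (Q : ℝ) : Prop where
  weight_nonneg : ∀ i, 0 ≤ w i
  nonneg : ∀ i j, 0 ≤ K i j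
  le_one : ∀ i j, K i j ≤ 1
  symm : ∀ i j, K i j = K j i
  sum_le : ∀ p i, ∑ j, w j * K i j ^ p ≤ R p
  mul_le : ∀ p, 1 ≤ p → p < d → R p * R (d - p) ≤ Q

namespace KernelBounds

variable {w : ι → ℝ} {K : ι → ι → ℝ} {d : ℕ} {R : ℕ → ℝ} {Q : ℝ}

/-- For a fixed centre `i` the sums over `j` and `k` factor into two row sums. -/
theorem sum_star_le (h : KernelBounds w K d R Q) {p : ℕ} (hp : 1 ≤ p) (hpd : p < d) :
    ∑ i, ∑ j, ∑ k, w i * w j * w k * (K i j ^ p * K i k ^ (d - p)) ≤ (∑ i, w i) * Q := by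
  rw [Finset.sum_mul]
  refine Finset.sum_le_sum fun i _ => ?_
  have hnn : ∀ p, 0 ≤ ∑ j, w j * K i j ^ p := fun p =>
    Finset.sum_nonneg fun j _ => mul_nonneg (h.weight_nonneg j) (pow_nonneg (h.nonneg i j) p)
  calc ∑ j, ∑ k, w i * w j * w k * (K i j ^ p * K i k ^ (d - p))
      = w i * ((∑ j, w j * K i j ^ p) * ∑ k, w k * K i k ^ (d - p)) := by
        rw [Finset.sum_mul_sum, Finset.mul_sum]
        refine Finset.sum_congr rfl fun j _ => ?_
        rw [Finset.mul_sum]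
        refine Finset.sum_congr rfl fun k _ => ?_
        ring
    _ ≤ w i * Q := by
        refine mul_le_mul_of_nonneg_left ?_ (h.weight_nonneg i)
        exact (mul_le_mul (h.sum_le p i) (h.sum_le _ i) (hnn _)
          ((hnn p).trans (h.sum_le p i))).trans
          (h.mul_le p hp hpd)

/-- A triangle is dominated by two stars: the factors at `k` are replaced by the larger of `K i k`
and `K j k`, and the star is centred at `i` or `j` accordingly. -/
theorem sum_triangle_le (h : KernelBounds w K d R Q) {a b c : ℕ} (hd : 2 ≤ d) (ha : 1 ≤ a)
    (hbc : 1 ≤ b + c) (habc : d ≤ a + b + c) :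
    ∑ i, ∑ j, ∑ k, w i * w j * w k * (K i j ^ a * K i k ^ b * K j k ^ c) ≤
      2 * ((∑ i, w i) * Q) := by
  -- The cap at `d - 1` keeps the other exponent `d - p` at least `1`. It is at most `b + c`, by `1
  -- ≤ b + c` if the cap is active and by `d ≤ a + b + c` if not.
  set p := min a (d - 1) with hp
  have hp1 : 1 ≤ p := by lia
  have hpd : p < d := by lia
  have hpt : ∀ i j k, K i j ^ a * K i k ^ b * K j k ^ c ≤
      K i j ^ p * K i k ^ (d - p) + K j i ^ p * K j k ^ (d - p) := by
    intro i j k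
    rw [h.symm j i, ← mul_add, mul_assoc]
    have h1 : K i j ^ a ≤ K i j ^ p := pow_le_pow_of_le_one (h.nonneg _ _) (h.le_one _ _) (by lia)
    have h2 := pow_mul_pow_mul_pow_le le_rfl (h.nonneg i k) (h.nonneg j k) zero_le_one
      (h.le_one i k) (h.le_one j k) (a := 0) (b := b) (c := c) (d := d - p) (by lia)
    rw [pow_zero, one_mul, zero_pow (by lia), zero_add] at h2
    exact mul_le_mul h1 h2 (mul_nonneg (pow_nonneg (h.nonneg _ _) _) (pow_nonneg (h.nonneg _ _) _))
      (pow_nonneg (h.nonneg _ _) _)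
  have hw : ∀ i j k, 0 ≤ w i * w j * w k := fun i j k =>
    mul_nonneg (mul_nonneg (h.weight_nonneg i) (h.weight_nonneg j)) (h.weight_nonneg k)
  calc ∑ i, ∑ j, ∑ k, w i * w j * w k * (K i j ^ a * K i k ^ b * K j k ^ c)
      ≤ ∑ i, ∑ j, ∑ k, (w i * w j * w k * (K i j ^ p * K i k ^ (d - p)) +
          w j * w i * w k * (K j i ^ p * K j k ^ (d - p))) := by
        refine Finset.sum_le_sum fun i _ => Finset.sum_le_sum fun j _ =>
          Finset.sum_le_sum fun k _ => ?_
        rw [mul_comm (w j), ← mul_add]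
        exact mul_le_mul_of_nonneg_left (hpt i j k) (hw i j k)
    _ = ∑ i, ∑ j, ∑ k, w i * w j * w k * (K i j ^ p * K i k ^ (d - p)) +
        ∑ i, ∑ j, ∑ k, w i * w j * w k * (K i j ^ p * K i k ^ (d - p)) := by
        simp only [Finset.sum_add_distrib]
        congr 1
        exact Finset.sum_comm
    _ ≤ 2 * ((∑ i, w i) * Q) := by
        rw [two_mul]
        exact add_le_add (h.sum_star_le hp1 hpd) (h.sum_star_le hp1 hpd)

/-- The vertex `l` has degree at least `d`, so summing over it first costs at most `3 * R d`. What
remains is a triangle on `i`, `j`, `k`, and `hc` says that `k` is attached to the edge `i j`. -/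
theorem sum_quadruple_le_of_left (h : KernelBounds w K d R Q) (hd : 2 ≤ d)
    {k01 k02 k03 k12 k13 k23 : ℕ} (h01 : 1 ≤ k01) (hc : 1 ≤ k02 + k12)
    (ht : d ≤ k01 + k02 + k12) (h3 : d ≤ k03 + k13 + k23) :
    ∑ i, ∑ j, ∑ k, ∑ l, w i * w j * w k * w l * (K i j ^ k01 * K i k ^ k02 * K i l ^ k03 *
      K j k ^ k12 * K j l ^ k13 * K k l ^ k23) ≤ 6 * ((∑ i, w i) * R d * Q) := by
  have hw : ∀ i j k, 0 ≤ w i * w j * w k := fun i j k =>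
    mul_nonneg (mul_nonneg (h.weight_nonneg i) (h.weight_nonneg j)) (h.weight_nonneg k)
  have htri : ∀ i j k, 0 ≤ K i j ^ k01 * K i k ^ k02 * K j k ^ k12 := fun i j k =>
    mul_nonneg (mul_nonneg (pow_nonneg (h.nonneg _ _) _) (pow_nonneg (h.nonneg _ _) _))
      (pow_nonneg (h.nonneg _ _) _)
  have hstar : ∀ i j k, ∑ l, w l * (K i l ^ k03 * K j l ^ k13 * K k l ^ k23) ≤ 3 * R d := by
    intro i j k
    calc _ ≤ ∑ l, (w l * K i l ^ d + w l * K j l ^ d + w l * K k l ^ d) := by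
          refine Finset.sum_le_sum fun l _ => ?_
          rw [← mul_add, ← mul_add]
          exact mul_le_mul_of_nonneg_left (pow_mul_pow_mul_pow_le (h.nonneg _ _) (h.nonneg _ _)
            (h.nonneg _ _) (h.le_one _ _) (h.le_one _ _) (h.le_one _ _) h3) (h.weight_nonneg l)
      _ ≤ 3 * R d := by
          simp only [Finset.sum_add_distrib]
          linarith [h.sum_le d i, h.sum_le d j, h.sum_le d k]
  calc _ = ∑ i, ∑ j, ∑ k, w i * w j * w k * (K i j ^ k01 * K i k ^ k02 * K j k ^ k12) *
        ∑ l, w l * (K i l ^ k03 * K j l ^ k13 * K k l ^ k23) := by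
        refine Finset.sum_congr rfl fun i _ => Finset.sum_congr rfl fun j _ =>
          Finset.sum_congr rfl fun k _ => ?_
        rw [Finset.mul_sum]
        refine Finset.sum_congr rfl fun l _ => ?_
        ring
    _ ≤ ∑ i, ∑ j, ∑ k, w i * w j * w k * (K i j ^ k01 * K i k ^ k02 * K j k ^ k12) * (3 * R d) :=
        Finset.sum_le_sum fun i _ => Finset.sum_le_sum fun j _ => Finset.sum_le_sum fun k _ =>
          mul_le_mul_of_nonneg_left (hstar i j k) (mul_nonneg (hw i j k) (htri i j k))
    _ = (∑ i, ∑ j, ∑ k, w i * w j * w k * (K i j ^ k01 * K i k ^ k02 * K j k ^ k12)) *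
        (3 * R d) := by simp only [Finset.sum_mul]
    _ ≤ 2 * ((∑ i, w i) * Q) * (3 * R d) := by
        rcases isEmpty_or_nonempty ι with he | ⟨⟨i⟩⟩
        · simp
        · refine mul_le_mul_of_nonneg_right (h.sum_triangle_le hd h01 hc ht) ?_
          exact (Finset.sum_nonneg fun l _ => mul_nonneg (h.weight_nonneg l) (mul_nonneg (mul_nonneg
            (pow_nonneg (h.nonneg _ _) _) (pow_nonneg (h.nonneg _ _) _))
            (pow_nonneg (h.nonneg _ _) _))).trans (hstar i i i)
    _ = _ := by ring

/-- A crossing edge reaches at least one of the vertices `2` and `3`. If it does not reach `2`, the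
roles of these two vertices are exchanged. -/
theorem sum_quadruple_le (h : KernelBounds w K d R Q) (hd : 2 ≤ d)
    {k01 k02 k03 k12 k13 k23 : ℕ} (h01 : 1 ≤ k01) (hc : 1 ≤ k02 + k03 + k12 + k13)
    (ht2 : d ≤ k01 + k02 + k12) (ht3 : d ≤ k01 + k03 + k13)
    (h2 : d ≤ k02 + k12 + k23) (h3 : d ≤ k03 + k13 + k23) :
    ∑ i, ∑ j, ∑ k, ∑ l, w i * w j * w k * w l * (K i j ^ k01 * K i k ^ k02 * K i l ^ k03 *
      K j k ^ k12 * K j l ^ k13 * K k l ^ k23) ≤ 6 * ((∑ i, w i) * R d * Q) := by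
  rcases Nat.eq_zero_or_pos (k02 + k12) with h0 | hpos
  · have := h.sum_quadruple_le_of_left hd (k01 := k01) (k02 := k03) (k03 := k02) (k12 := k13)
      (k13 := k12) (k23 := k23) h01 (by lia) ht3 h2
    refine le_trans (le_of_eq ?_) this
    refine Finset.sum_congr rfl fun i _ => Finset.sum_congr rfl fun j _ => ?_
    rw [Finset.sum_comm]
    refine Finset.sum_congr rfl fun k _ => Finset.sum_congr rfl fun l _ => ?_
    rw [h.symm l k]
    ring
  · exact h.sum_quadruple_le_of_left hd h01 hpos ht2 h3

end KernelBounds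

/-- The sum over all quadruples of `C i j * C k l` times a combination of connected diagrams with
degrees `m - 1`, `l - 1`, `m - 1`, `l - 1`. -/
theorem exists_sum_crossDiagrams_le {d m n : ℕ} (hd : 2 ≤ d) (hm : d ≤ m + 1) (hn : d ≤ n + 1)
    {φ : (Fin 4 → Fin 4 → ℝ) → ℝ} (hφ : φ ∈ Submodule.span ℝ (crossDiagrams m n m n)) :
    ∃ A : ℝ, 0 ≤ A ∧ ∀ (ι : Type) [Fintype ι] (w : ι → ℝ) (C : ι → ι → ℝ) (R : ℕ → ℝ) (Q : ℝ),
      KernelBounds w (fun i j => |C i j|) d R Q →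
      |∑ i, ∑ j, ∑ k, ∑ l, w i * w j * w k * w l * (C i j * C k l *
        φ (fun s t => C (![i, j, k, l] s) (![i, j, k, l] t)))| ≤ A * ((∑ i, w i) * R d * Q) := by
  induction hφ using Submodule.span_induction with
  | mem φ hφ =>
    obtain ⟨k01, k02, k03, k12, k13, k23, h0, h1, h2, h3, hc, rfl⟩ := hφ
    refine ⟨6, by norm_num, fun ι _ w C R Q h => ?_⟩
    -- The factor `C i j * C k l` adds one edge inside each pair. The degree equations force `k01 +
    -- k02 + k12 = m` and `k01 + k03 + k13 = n`, so with the extra edge both triangles have at least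
    -- `d` edges.
    refine le_trans ?_ (h.sum_quadruple_le hd (k01 := k01 + 1) (k02 := k02) (k03 := k03)
      (k12 := k12) (k13 := k13) (k23 := k23 + 1) (by lia) (by lia) (by lia) (by lia) (by lia)
      (by lia))
    refine (Finset.abs_sum_le_sum_abs _ _).trans (Finset.sum_le_sum fun i _ => ?_)
    refine (Finset.abs_sum_le_sum_abs _ _).trans (Finset.sum_le_sum fun j _ => ?_)
    refine (Finset.abs_sum_le_sum_abs _ _).trans (Finset.sum_le_sum fun k _ => ?_)
    refine (Finset.abs_sum_le_sum_abs _ _).trans (Finset.sum_le_sum fun l _ => le_of_eq ?_)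
    have e0 : ![i, j, k, l] 0 = i := rfl
    have e1 : ![i, j, k, l] 1 = j := rfl
    have e2 : ![i, j, k, l] 2 = k := rfl
    have e3 : ![i, j, k, l] 3 = l := rfl
    simp only [diagramMonomial, abs_mul, abs_pow, abs_of_nonneg (h.weight_nonneg _), pow_succ,
      e0, e1, e2, e3]
    ring
  | zero => exact ⟨0, le_rfl, by simp⟩
  | add φ ψ _ _ ih₁ ih₂ =>
    obtain ⟨A, hA, h₁⟩ := ih₁
    obtain ⟨B, hB, h₂⟩ := ih₂
    refine ⟨A + B, by positivity, fun ι _ w C R Q h => ?_⟩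
    simp only [Pi.add_apply, mul_add, Finset.sum_add_distrib, add_mul]
    exact (abs_add_le _ _).trans (add_le_add (h₁ ι w C R Q h) (h₂ ι w C R Q h))
  | smul c φ _ ih =>
    obtain ⟨A, hA, h₁⟩ := ih
    refine ⟨|c| * A, by positivity, fun ι _ w C R Q h => ?_⟩
    have : ∀ x y z : ℝ, x * (y * (c * z)) = c * (x * (y * z)) := by intros; ring
    simp only [Pi.smul_apply, smul_eq_mul, this]
    simp only [← Finset.mul_sum _ _ c]
    rw [abs_mul, mul_assoc]
    exact mul_le_mul_of_nonneg_left (h₁ ι w C R Q h) (abs_nonneg c)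

end DiagramSums

/-! ### Stein kernels and characteristic functions of Hermite sums -/

section HermiteSum

open Polynomial

variable {ι : Type*} [Fintype ι]

/-- The polynomial `∑ c_n H_{n + 1}`, with unnormalized Hermite polynomials. -/
noncomputable def hermiteSum (S : Finset ℕ) (c : ℕ → ℝ) : ℝ[X] :=
  ∑ n ∈ S, Polynomial.C (c n) * hermiteR (n + 1)

theorem derivative_hermiteSum (S : Finset ℕ) (c : ℕ → ℝ) : derivative (hermiteSum S c) =
    ∑ n ∈ S, Polynomial.C (c n * (n + 1)) * hermiteR n := by
  simp only [hermiteSum, derivative_sum, derivative_C_mul, derivative_hermiteR_succ, ← mul_assoc,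
    ← Polynomial.C_mul]

/-- The functional `∑ w_i p (y_i)`. -/
noncomputable def weightedSum (w : ι → ℝ) (p : ℝ[X]) (y : ι → ℝ) : ℝ := ∑ i, w i * p.eval (y i)

/-- The Stein kernel of `weightedSum w (hermiteSum S c)` for a Gaussian vector of covariance `C`. -/
noncomputable def steinKernel (w : ι → ℝ) (C : ι → ι → ℝ) (S : Finset ℕ) (c : ℕ → ℝ) (y : ι → ℝ) :
    ℝ :=
  ∑ i, w i * ∑ n ∈ S, c n * ((hermiteR n).eval (y i) *
    ∑ j, w j * (C i j * (derivative (hermiteSum S c)).eval (y j)))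

theorem measurable_weightedSum (w : ι → ℝ) (p : ℝ[X]) : Measurable (weightedSum w p) :=
  Finset.measurable_sum _ fun i _ =>
    (p.continuous.measurable.comp (measurable_pi_apply i)).const_mul _

theorem hasDerivAt_weightedSum (w : ι → ℝ) (p : ℝ[X]) (y v : ι → ℝ) :
    HasDerivAt (fun x : ℝ => weightedSum w p (y + x • v))
      (∑ j, w j * (v j * (derivative p).eval (y j))) 0 :=
  HasDerivAt.fun_sum fun j _ => (hasDerivAt_eval_line p y v j).const_mul (w j)

variable {Ω : Type*} [MeasurableSpace Ω] {P : Measure Ω} {Y : ι → Ω → ℝ} {C : ι → ι → ℝ}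

namespace IsGaussianVector

theorem hasAllMoments_weightedSum (hY : IsGaussianVector Y C P) (w : ι → ℝ) (p : ℝ[X]) :
    HasAllMoments (fun ω => weightedSum w p (fun j => Y j ω)) P :=
  have := hY.isProbabilityMeasure
  HasAllMoments.sum _ fun i _ => ((hY.hasAllMoments i).eval p).const_mul _

theorem hasAllMoments_steinKernel (hY : IsGaussianVector Y C P) (w : ι → ℝ) (S : Finset ℕ)
    (c : ℕ → ℝ) : HasAllMoments (fun ω => steinKernel w C S c (fun j => Y j ω)) P :=
  have := hY.isProbabilityMeasure
  HasAllMoments.sum _ fun i _ => (HasAllMoments.sum _ fun n _ => (((hY.hasAllMoments i).eval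
    (hermiteR n)).mul (HasAllMoments.sum _ fun j _ => (((hY.hasAllMoments j).eval _).const_mul
      _).const_mul _)).const_mul _).const_mul _

variable {E : Type*} [NormedAddCommGroup E] [NormedSpace ℝ E]

/-- The Stein equation satisfied by a Hermite sum over a Gaussian vector. -/
theorem integral_weightedSum_smul (hY : IsGaussianVector Y C P) (hC : ∀ i, C i i = 1)
    (w : ι → ℝ) (S : Finset ℕ) (c : ℕ → ℝ) {f f' : ℝ → E} (hf : ∀ z, HasDerivAt f (f' z) z)
    (hfm : StronglyMeasurable f) (hfm' : StronglyMeasurable f')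
    (h0 : ∀ X : Ω → ℝ, HasAllMoments X P →
      Integrable (fun ω => X ω • f (weightedSum w (hermiteSum S c) (fun j => Y j ω))) P)
    (h1 : ∀ X : Ω → ℝ, HasAllMoments X P →
      Integrable (fun ω => X ω • f' (weightedSum w (hermiteSum S c) (fun j => Y j ω))) P) :
    ∫ ω, weightedSum w (hermiteSum S c) (fun j => Y j ω) •
        f (weightedSum w (hermiteSum S c) (fun j => Y j ω)) ∂P =
      ∫ ω, steinKernel w C S c (fun j => Y j ω) •
        f' (weightedSum w (hermiteSum S c) (fun j => Y j ω)) ∂P := by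
  have := hY.isProbabilityMeasure
  set Z : (ι → ℝ) → ℝ := weightedSum w (hermiteSum S c) with hZ
  set D : ι → (ι → ℝ) → ℝ := fun i y =>
    ∑ j, w j * (C i j * (derivative (hermiteSum S c)).eval (y j)) with hD
  have hZm : Measurable Z := measurable_weightedSum _ _
  have hpm : ∀ (q : ℝ[X]) j, Measurable (fun y : ι → ℝ => q.eval (y j)) := fun q j =>
    (q.continuous.measurable.comp (measurable_pi_apply j))
  have hDm : ∀ i, Measurable (D i) := fun i => Finset.measurable_sum _ fun j _ =>
    ((hpm _ j).const_mul _).const_mul _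
  have hDmom : ∀ i, HasAllMoments (fun ω => D i (fun j => Y j ω)) P := fun i =>
    HasAllMoments.sum _ fun j _ => (((hY.hasAllMoments j).eval _).const_mul _).const_mul _
  have hev : ∀ i (q : ℝ[X]), HasAllMoments (fun ω => q.eval (Y i ω)) P :=
    fun i q => (hY.hasAllMoments i).eval q
  have key : ∀ i n, ∫ ω, (hermiteR (n + 1)).eval (Y i ω) • f (Z (fun j => Y j ω)) ∂P =
      ∫ ω, (hermiteR n).eval (Y i ω) • (D i (fun j => Y j ω) • f' (Z (fun j => Y j ω))) ∂P := by
    intro i n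
    refine hY.integral_hermiteR_succ_smul (hC i) (F := fun y => f (Z y))
      (F' := fun y => D i y • f' (Z y)) (hfm.comp_measurable hZm)
      ((hDm i).stronglyMeasurable.smul (hfm'.comp_measurable hZm)) (fun y => ?_)
      (fun q => h0 _ (hev i q)) (fun q => ?_) n
    · have h2 := hasDerivAt_weightedSum w (hermiteSum S c) y (C i)
      have h3 := hf (Z (y + (0 : ℝ) • C i))
      have := h3.scomp (0 : ℝ) h2
      simpa [Function.comp_def] using this
    · simpa [smul_smul] using h1 _ ((hev i q).mul (hDmom i))
  have hL : ∀ ω (v : E), Z (fun j => Y j ω) • v =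
      ∑ i, ∑ n ∈ S, (w i * c n) • ((hermiteR (n + 1)).eval (Y i ω) • v) := by
    intro ω v
    simp only [hZ, weightedSum, hermiteSum, eval_finsetSum, eval_mul, eval_C, Finset.sum_smul,
      Finset.mul_sum, smul_smul, mul_assoc]
  have hR : ∀ ω, steinKernel w C S c (fun j => Y j ω) • f' (Z (fun j => Y j ω)) =
      ∑ i, ∑ n ∈ S, (w i * c n) • ((hermiteR n).eval (Y i ω) •
        (D i (fun j => Y j ω) • f' (Z (fun j => Y j ω)))) := by
    intro ω
    rw [steinKernel, Finset.sum_smul]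
    refine Finset.sum_congr rfl fun i _ => ?_
    rw [Finset.mul_sum, Finset.sum_smul]
    refine Finset.sum_congr rfl fun n _ => ?_
    simp only [smul_smul, mul_assoc, hD]
  simp only [hL, hR]
  rw [integral_finsetSum, integral_finsetSum]
  · refine Finset.sum_congr rfl fun i _ => ?_
    rw [integral_finsetSum, integral_finsetSum]
    · refine Finset.sum_congr rfl fun n _ => ?_
      rw [integral_smul, integral_smul, key]
    · intro n _
      refine Integrable.smul (w i * c n) ?_
      simpa [smul_smul] using h1 _ ((hev i _).mul (hDmom i))
    · intro n _
      exact Integrable.smul (w i * c n) (h0 _ (hev i _))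
  · intro i _
    refine integrable_finsetSum _ fun n _ => Integrable.smul (w i * c n) ?_
    simpa [smul_smul] using h1 _ ((hev i _).mul (hDmom i))
  · intro i _
    exact integrable_finsetSum _ fun n _ => Integrable.smul (w i * c n) (h0 _ (hev i _))

/-- The Stein equation for the identity function: the mean of the Stein kernel is the variance. -/
theorem integral_weightedSum_sq (hY : IsGaussianVector Y C P) (hC : ∀ i, C i i = 1)
    (w : ι → ℝ) (S : Finset ℕ) (c : ℕ → ℝ) :
    ∫ ω, weightedSum w (hermiteSum S c) (fun j => Y j ω) ^ 2 ∂P =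
      ∫ ω, steinKernel w C S c (fun j => Y j ω) ∂P := by
  have := hY.isProbabilityMeasure
  have := hY.integral_weightedSum_smul hC w S c (f := fun z => z) (f' := fun _ => (1 : ℝ))
    (fun z => hasDerivAt_id z) stronglyMeasurable_id stronglyMeasurable_const
    (fun X hX => (hX.mul (hY.hasAllMoments_weightedSum w _)).integrable)
    (fun X hX => by simpa using hX.integrable)
  simpa [sq] using this

/-- The characteristic function of a Hermite sum is close to a Gaussian one if the Stein kernel is
close to its mean in `L¹`. -/
theorem norm_integral_exp_sub_le (hY : IsGaussianVector Y C P) (hC : ∀ i, C i i = 1)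
    (w : ι → ℝ) (S : Finset ℕ) (c : ℕ → ℝ) (s : ℝ) :
    ‖∫ ω, Complex.exp (s * weightedSum w (hermiteSum S c) (fun j => Y j ω) * Complex.I) ∂P -
        Complex.exp (-(s ^ 2 * ∫ ω, weightedSum w (hermiteSum S c) (fun j => Y j ω) ^ 2 ∂P : ℝ)
          / 2)‖ ≤
      s ^ 2 * ∫ ω, |steinKernel w C S c (fun j => Y j ω) -
        ∫ ω, steinKernel w C S c (fun j => Y j ω) ∂P| ∂P := by
  have := hY.isProbabilityMeasure
  have hZmom := hY.hasAllMoments_weightedSum w (hermiteSum S c)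
  have hTmom := hY.hasAllMoments_steinKernel w S c
  set V := ∫ ω, weightedSum w (hermiteSum S c) (fun j => Y j ω) ^ 2 ∂P with hV
  have hV0 : 0 ≤ V := integral_nonneg fun ω => sq_nonneg _
  have hVT : V = ∫ ω, steinKernel w C S c (fun j => Y j ω) ∂P :=
    hY.integral_weightedSum_sq hC w S c
  rw [← hVT]
  set Z : Ω → ℝ := fun ω => weightedSum w (hermiteSum S c) (fun j => Y j ω) with hZ
  set T : Ω → ℝ := fun ω => steinKernel w C S c (fun j => Y j ω) with hT
  set η := ∫ ω, |T ω - V| ∂P with hη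
  set e : ℝ → Ω → ℂ := fun s ω => Complex.exp (s * Z ω * Complex.I) with he
  have hnorm : ∀ s ω, ‖e s ω‖ = 1 := fun s ω => by
    rw [he]; dsimp only; rw [← Complex.ofReal_mul, Complex.norm_exp_ofReal_mul_I]
  have hem : ∀ s, AEStronglyMeasurable (e s) P := fun s => by
    have h1 : AEMeasurable Z P := (hZmom.integrable).aemeasurable
    exact (Complex.continuous_exp.measurable.comp_aemeasurable
      (((Complex.measurable_ofReal.comp_aemeasurable h1).const_mul _).mul_const
        _)).aestronglyMeasurable
  have hint : ∀ s (X : Ω → ℝ), Integrable X P → Integrable (fun ω => X ω • e s ω) P := by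
    intro s X hX
    refine hX.mono (hX.aestronglyMeasurable.smul (hem s)) (ae_of_all _ fun ω => ?_)
    simp [hnorm]
  have hderiv : ∀ s, HasDerivAt (fun s => ∫ ω, e s ω ∂P)
      (∫ ω, (Z ω * Complex.I) * e s ω ∂P) s := by
    intro s
    refine (hasDerivAt_integral_of_dominated_loc_of_deriv_le (F := e)
      (F' := fun s ω => (Z ω * Complex.I) * e s ω)
      (bound := fun ω => |Z ω|) (s := Set.univ) Filter.univ_mem (.of_forall hem) ?_ ?_ ?_ ?_ ?_).2
    · simpa using hint s _ (integrable_const (1 : ℝ))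
    · refine AEStronglyMeasurable.mul ?_ (hem s)
      exact ((Complex.measurable_ofReal.comp_aemeasurable
        hZmom.integrable.aemeasurable).mul_const _).aestronglyMeasurable
    · exact ae_of_all _ fun ω x _ => by simp [hnorm]
    · exact hZmom.integrable.abs
    · refine ae_of_all _ fun ω x _ => ?_
      have h1 : HasDerivAt (fun x : ℝ => (x * Z ω * Complex.I : ℂ)) (Z ω * Complex.I) x := by
        have := (((hasDerivAt_id x).ofReal_comp).mul_const (Z ω : ℂ)).mul_const Complex.I
        simpa using this
      exact h1.cexp.congr_deriv (by simp only [he]; ring)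
  have hstein : ∀ s : ℝ, ∫ ω, (Z ω * Complex.I) * e s ω ∂P =
      -s * ∫ ω, T ω * e s ω ∂P := by
    intro s
    have h1 := hY.integral_weightedSum_smul hC w S c
      (f := fun z : ℝ => Complex.exp (s * z * Complex.I))
      (f' := fun z : ℝ => (s * Complex.I) * Complex.exp (s * z * Complex.I)) (fun z => ?_)
      (by fun_prop : Continuous fun z : ℝ => Complex.exp (s * z * Complex.I)).stronglyMeasurable
      (by fun_prop : Continuous fun z : ℝ =>
        (s * Complex.I) * Complex.exp (s * z * Complex.I)).stronglyMeasurable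
      (fun X hX => hint s X hX.integrable) (fun X hX => ?_)
    · calc ∫ ω, (Z ω * Complex.I) * e s ω ∂P = Complex.I * ∫ ω, Z ω • e s ω ∂P := by
            rw [← integral_const_mul]
            congr 1 with ω
            simp; ring
        _ = Complex.I * ∫ ω, T ω • ((s * Complex.I) * e s ω) ∂P := by rw [h1]
        _ = -s * ∫ ω, T ω * e s ω ∂P := by
            rw [← integral_const_mul, ← integral_const_mul]
            congr 1 with ω
            simp only [Complex.real_smul]
            linear_combination (s * T ω * e s ω) * Complex.I_mul_I
    · have h1 : HasDerivAt (fun z : ℝ => (s * z * Complex.I : ℂ)) (s * Complex.I) z := by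
        have := (((hasDerivAt_id z).ofReal_comp).const_mul (s : ℂ)).mul_const Complex.I
        simpa using this
      exact h1.cexp.congr_deriv (by ring)
    · refine ((hint s X hX.integrable).const_mul (s * Complex.I)).congr (ae_of_all _ fun ω => ?_)
      simp only [Complex.real_smul, he, hZ]; ring
  -- The Gaussian factor cancels the main term of the equation `φ'(s) = -s E[T e^{isZ}]`. Only `T -
  -- V` is left in `g'`, and the mean value inequality compares `g s` with `g 0 = 1`.
  set g : ℝ → ℂ := fun s => (∫ ω, e s ω ∂P) * Complex.exp ((s ^ 2 * V / 2 : ℝ)) with hg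
  set g' : ℝ → ℂ := fun s => -s * (∫ ω, ((T ω - V : ℝ) : ℂ) * e s ω ∂P) *
    Complex.exp ((s ^ 2 * V / 2 : ℝ)) with hg'
  have hgd : ∀ s, HasDerivAt g (g' s) s := by
    intro s
    have h1 : HasDerivAt (fun s : ℝ => Complex.exp ((s ^ 2 * V / 2 : ℝ)))
        ((s * V : ℝ) * Complex.exp ((s ^ 2 * V / 2 : ℝ))) s := by
      have h2 : HasDerivAt (fun s : ℝ => s ^ 2 * V / 2) (s * V) s :=
        (((hasDerivAt_pow 2 s).mul_const V).div_const 2).congr_deriv (by norm_num; ring)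
      exact (h2.ofReal_comp.cexp).congr_deriv (by ring)
    refine ((hderiv s).mul h1).congr_deriv ?_
    have h3 : ∫ ω, ((T ω - V : ℝ) : ℂ) * e s ω ∂P =
        ∫ ω, T ω * e s ω ∂P - V * ∫ ω, e s ω ∂P := by
      rw [← integral_const_mul, ← integral_sub]
      · congr 1 with ω
        push_cast; ring
      · exact hint s T hTmom.integrable
      · simpa using (hint s _ (integrable_const (1 : ℝ))).const_mul (V : ℂ)
    rw [hstein, hg']
    simp only [h3]
    push_cast
    ring
  have hbound : ∀ x ∈ Set.uIcc 0 s, ‖g' x‖ ≤ |s| * η * Real.exp (s ^ 2 * V / 2) := by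
    intro x hx
    have hxs : |x| ≤ |s| := by
      have := Set.abs_sub_left_of_mem_uIcc hx
      simpa using this
    have h1 : ‖∫ ω, ((T ω - V : ℝ) : ℂ) * e x ω ∂P‖ ≤ η := by
      refine (norm_integral_le_integral_norm _).trans (le_of_eq ?_)
      congr 1 with ω
      rw [norm_mul, hnorm, mul_one, Complex.norm_real, Real.norm_eq_abs]
    have h2 : x ^ 2 ≤ s ^ 2 := sq_le_sq.2 hxs
    simp only [hg', norm_mul, norm_neg, Complex.norm_real, Real.norm_eq_abs,
      Complex.norm_exp_ofReal]
    gcongr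
  have hmv := (convex_uIcc 0 s).norm_image_sub_le_of_norm_hasDerivWithin_le
    (fun x _ => (hgd x).hasDerivWithinAt) hbound Set.left_mem_uIcc Set.right_mem_uIcc
  have hg0 : g 0 = 1 := by simp [hg, he]
  rw [hg0, sub_zero, Real.norm_eq_abs] at hmv
  have hexp : Complex.exp ((-(s ^ 2 * V) : ℝ) / 2) * Complex.exp ((s ^ 2 * V / 2 : ℝ)) = 1 := by
    rw [← Complex.exp_add]
    push_cast
    ring_nf
    simp
  have hfac : (∫ ω, e s ω ∂P) - Complex.exp ((-(s ^ 2 * V) : ℝ) / 2) =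
      (g s - 1) * Complex.exp ((-(s ^ 2 * V) : ℝ) / 2) := by
    simp only [hg]
    linear_combination (-(∫ ω, e s ω ∂P)) * hexp
  have hfin : ‖(g s - 1) * Complex.exp ((-(s ^ 2 * V) : ℝ) / 2)‖ ≤ s ^ 2 * η := by
    have h1 : Complex.exp ((-(s ^ 2 * V) : ℝ) / 2) = Complex.exp ((-(s ^ 2 * V / 2) : ℝ)) := by
      push_cast; ring_nf
    rw [norm_mul, h1, Complex.norm_exp_ofReal, Real.exp_neg]
    rw [mul_inv_le_iff₀ (Real.exp_pos _)]
    refine hmv.trans (le_of_eq ?_)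
    rw [← sq_abs s]
    ring
  rw [← hfac] at hfin
  convert hfin using 5
  push_cast
  ring

end IsGaussianVector
end HermiteSum

/-! ### The variance of the Stein kernel -/

section SteinKernelBound

open Polynomial

variable {Ω : Type*} [MeasurableSpace Ω] {P : Measure Ω} {ι : Type*} [Fintype ι]
  {Y : ι → Ω → ℝ} {C : ι → ι → ℝ}

theorem IsGaussianVector.comp {κ : Type*} [Fintype κ] (hY : IsGaussianVector Y C P) (v : κ → ι) :
    IsGaussianVector (fun k => Y (v k)) (fun k l => C (v k) (v l)) P where
  hasGaussianLaw := by
    let L : (ι → ℝ) →L[ℝ] (κ → ℝ) := ContinuousLinearMap.pi fun k => ContinuousLinearMap.proj (v k)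
    exact hY.hasGaussianLaw.map_fun L
  integral_eq_zero k := hY.integral_eq_zero (v k)
  integral_mul k l := hY.integral_mul (v k) (v l)

/-- The term of the Stein kernel that comes from two fixed Hermite polynomials. -/
noncomputable def steinTerm (w : ι → ℝ) (C : ι → ι → ℝ) (m n : ℕ) (y : ι → ℝ) : ℝ :=
  ∑ i, ∑ j, w i * w j * (C i j * ((hermiteR m).eval (y i) * (hermiteR n).eval (y j)))

theorem steinKernel_eq_sum (w : ι → ℝ) (C : ι → ι → ℝ) (S : Finset ℕ) (c : ℕ → ℝ) (y : ι → ℝ) :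
    steinKernel w C S c y = ∑ m ∈ S, ∑ n ∈ S, c m * (c n * (n + 1)) * steinTerm w C m n y := by
  simp only [steinKernel, steinTerm, derivative_hermiteSum, eval_finsetSum, eval_mul, eval_C,
    Finset.mul_sum]
  rw [Finset.sum_comm]
  refine Finset.sum_congr rfl fun m _ => ?_
  rw [Finset.sum_comm (s := S)]
  refine Finset.sum_congr rfl fun i _ => ?_
  rw [Finset.sum_comm]
  refine Finset.sum_congr rfl fun n _ => Finset.sum_congr rfl fun j _ => ?_
  ring

theorem IsGaussianVector.hasAllMoments_steinTerm (hY : IsGaussianVector Y C P) (w : ι → ℝ)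
    (m n : ℕ) : HasAllMoments (fun ω => steinTerm w C m n (fun j => Y j ω)) P :=
  have := hY.isProbabilityMeasure
  HasAllMoments.sum _ fun i _ => HasAllMoments.sum _ fun j _ => ((((hY.hasAllMoments i).eval
    (hermiteR m)).mul ((hY.hasAllMoments j).eval (hermiteR n))).const_mul _).const_mul _

/-- The variance of `steinTerm` as a sum over quadruples. -/
theorem IsGaussianVector.variance_steinTerm (hY : IsGaussianVector Y C P) (hC : ∀ i, C i i = 1)
    (w : ι → ℝ) (m n : ℕ) :
    Var[fun ω => steinTerm w C m n (fun j => Y j ω); P] =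
      ∑ i, ∑ j, ∑ k, ∑ l, w i * w j * w k * w l * (C i j * C k l *
        (hermiteFourMoment P (fun s => Y (![i, j, k, l] s)) m n m n -
          hermitePairMoment (fun s t => C (![i, j, k, l] s) (![i, j, k, l] t)) m n m n)) := by
  have := hY.isProbabilityMeasure
  have hev : ∀ i n, HasAllMoments (fun ω => (hermiteR n).eval (Y i ω)) P :=
    fun i q => (hY.hasAllMoments i).eval _
  have hmean : ∫ ω, steinTerm w C m n (fun j => Y j ω) ∂P =
      ∑ i, ∑ j, w i * w j * (C i j * if m = n then m.factorial * C i j ^ m else 0) := by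
    simp only [steinTerm]
    rw [integral_finsetSum]
    · refine Finset.sum_congr rfl fun i _ => ?_
      rw [integral_finsetSum]
      · refine Finset.sum_congr rfl fun j _ => ?_
        rw [integral_const_mul, integral_const_mul,
          hY.integral_hermiteR_mul_hermiteR (hC i) (hC j)]
      · exact fun j _ => ((((hev i m).mul (hev j n)).const_mul _).const_mul _).integrable
    · exact fun i _ => (HasAllMoments.sum _ fun j _ =>
        (((hev i m).mul (hev j n)).const_mul _).const_mul _).integrable
  have hsq : ∫ ω, steinTerm w C m n (fun j => Y j ω) ^ 2 ∂P =
      ∑ i, ∑ j, ∑ k, ∑ l, w i * w j * w k * w l * (C i j * C k l *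
        hermiteFourMoment P (fun s => Y (![i, j, k, l] s)) m n m n) := by
    have h1 : ∀ ω, steinTerm w C m n (fun j => Y j ω) ^ 2 =
        ∑ i, ∑ j, ∑ k, ∑ l, w i * w j * w k * w l * (C i j * C k l *
          ((hermiteR m).eval (Y i ω) * ((hermiteR n).eval (Y j ω) * (hermiteR m).eval (Y k ω) *
            (hermiteR n).eval (Y l ω)))) := by
      intro ω
      rw [sq, steinTerm, Finset.sum_mul]
      refine Finset.sum_congr rfl fun i _ => ?_
      rw [Finset.sum_mul]
      refine Finset.sum_congr rfl fun j _ => ?_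
      rw [Finset.mul_sum]
      refine Finset.sum_congr rfl fun k _ => ?_
      rw [Finset.mul_sum]
      refine Finset.sum_congr rfl fun l _ => ?_
      ring
    have hmom : ∀ i j k l, HasAllMoments (fun ω => w i * w j * w k * w l * (C i j * C k l *
          ((hermiteR m).eval (Y i ω) * ((hermiteR n).eval (Y j ω) * (hermiteR m).eval (Y k ω) *
            (hermiteR n).eval (Y l ω))))) P := fun i j k l =>
      (((hev i m).mul (((hev j n).mul (hev k m)).mul (hev l n))).const_mul _).const_mul _
    simp only [h1]
    rw [integral_finsetSum _ fun i _ => (HasAllMoments.sum _ fun j _ => HasAllMoments.sum _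
      fun k _ => HasAllMoments.sum _ fun l _ => hmom i j k l).integrable]
    refine Finset.sum_congr rfl fun i _ => ?_
    rw [integral_finsetSum _ fun j _ => (HasAllMoments.sum _
      fun k _ => HasAllMoments.sum _ fun l _ => hmom i j k l).integrable]
    refine Finset.sum_congr rfl fun j _ => ?_
    rw [integral_finsetSum _ fun k _ => (HasAllMoments.sum _ fun l _ => hmom i j k l).integrable]
    refine Finset.sum_congr rfl fun k _ => ?_
    rw [integral_finsetSum _ fun l _ => (hmom i j k l).integrable]
    refine Finset.sum_congr rfl fun l _ => ?_
    rw [integral_const_mul, integral_const_mul]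
    rfl
  have hmom := hY.hasAllMoments_steinTerm w m n
  rw [variance_eq_sub hmom.memLp_two]
  simp only [Pi.pow_apply, hsq, hmean, mul_sub, Finset.sum_sub_distrib]
  congr 1
  rw [sq, Finset.sum_mul]
  refine Finset.sum_congr rfl fun i _ => ?_
  rw [Finset.sum_mul]
  refine Finset.sum_congr rfl fun j _ => ?_
  rw [Finset.mul_sum]
  refine Finset.sum_congr rfl fun k _ => ?_
  rw [Finset.mul_sum]
  refine Finset.sum_congr rfl fun l _ => ?_
  have e0 : ![i, j, k, l] 0 = i := rfl
  have e1 : ![i, j, k, l] 1 = j := rfl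
  have e2 : ![i, j, k, l] 2 = k := rfl
  have e3 : ![i, j, k, l] 3 = l := rfl
  simp only [hermitePairMoment, e0, e1, e2, e3]
  ring

/-- This is nonnegativity of the variance of `|X - E X|`. -/
theorem integral_abs_sub_le_sqrt_variance [IsProbabilityMeasure P] {X : Ω → ℝ} (hX : MemLp X 2 P) :
    ∫ ω, |X ω - ∫ ω, X ω ∂P| ∂P ≤ √(Var[X; P]) := by
  have h1 : MemLp (fun ω => |X ω - ∫ ω, X ω ∂P|) 2 P := (hX.sub (memLp_const _)).abs
  have h2 := variance_nonneg (fun ω => |X ω - ∫ ω, X ω ∂P|) P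
  rw [variance_eq_sub h1] at h2
  refine Real.le_sqrt_of_sq_le ?_
  rw [variance_eq_integral hX.aestronglyMeasurable.aemeasurable]
  simp only [Pi.pow_apply, sq_abs] at h2
  linarith

/-- Quantitative central limit theorem for a sum of Hermite polynomials of degree at least `d` over
a Gaussian vector. -/
theorem exists_norm_integral_exp_sub_le [IsProbabilityMeasure P] {d : ℕ} (hd : 2 ≤ d)
    (S : Finset ℕ) (hS : ∀ n ∈ S, d ≤ n + 1) (c : ℕ → ℝ) :
    ∃ A : ℝ, 0 ≤ A ∧ ∀ (ι : Type) [Fintype ι] (Y : ι → Ω → ℝ) (C : ι → ι → ℝ) (w : ι → ℝ)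
      (R : ℕ → ℝ) (Q : ℝ), IsGaussianVector Y C P → (∀ i, C i i = 1) →
      KernelBounds w (fun i j => |C i j|) d R Q → ∀ s : ℝ,
      ‖∫ ω, Complex.exp (s * weightedSum w (hermiteSum S c) (fun j => Y j ω) * Complex.I) ∂P -
        Complex.exp (-(s ^ 2 * ∫ ω, weightedSum w (hermiteSum S c) (fun j => Y j ω) ^ 2 ∂P : ℝ)
          / 2)‖ ≤ s ^ 2 * (A * √((∑ i, w i) * R d * Q)) := by
  have hAll : ∀ m n : ℕ, ∃ A : ℝ, 0 ≤ A ∧ (m ∈ S → n ∈ S → ∀ (ι : Type) [Fintype ι]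
      (Y : ι → Ω → ℝ) (C : ι → ι → ℝ) (w : ι → ℝ)
      (R : ℕ → ℝ) (Q : ℝ), IsGaussianVector Y C P → (∀ i, C i i = 1) →
      KernelBounds w (fun i j => |C i j|) d R Q →
      ∫ ω, |steinTerm w C m n (fun j => Y j ω) -
        ∫ ω, steinTerm w C m n (fun j => Y j ω) ∂P| ∂P ≤ A * √((∑ i, w i) * R d * Q)) := by
    intro m n
    by_cases hmn : m ∈ S ∧ n ∈ S
    · obtain ⟨φ, hφ, hφe⟩ := exists_hermiteFourMoment_sub_eq (P := P) m n m n
      obtain ⟨A, hA, hsum⟩ := exists_sum_crossDiagrams_le hd (hS m hmn.1) (hS n hmn.2) hφ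
      refine ⟨√A, Real.sqrt_nonneg _, fun _ _ ι _ Y C w R Q hY hC hK => ?_⟩
      refine (integral_abs_sub_le_sqrt_variance (hY.hasAllMoments_steinTerm w m n).memLp_two).trans
        ?_
      rw [← Real.sqrt_mul hA]
      refine Real.sqrt_le_sqrt ((le_of_eq ?_).trans ((le_abs_self _).trans (hsum ι w C R Q hK)))
      rw [hY.variance_steinTerm hC]
      refine Finset.sum_congr rfl fun i _ => Finset.sum_congr rfl fun j _ =>
        Finset.sum_congr rfl fun k _ => Finset.sum_congr rfl fun l _ => ?_
      rw [← hφe ⟨(_, _), hY.comp ![i, j, k, l], fun s => hC _⟩]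
    -- A default constant outside `S`, so that `choose` gives a function of all pairs of degrees.
    · exact ⟨0, le_rfl, fun h1 h2 => absurd ⟨h1, h2⟩ hmn⟩
  choose A hA0 hA using hAll
  refine ⟨∑ m ∈ S, ∑ n ∈ S, |c m * (c n * (n + 1))| * A m n,
    Finset.sum_nonneg fun m _ => Finset.sum_nonneg fun n _ => mul_nonneg (abs_nonneg _) (hA0 m n),
    fun ι _ Y C w R Q hY hC hK s => ?_⟩
  refine (hY.norm_integral_exp_sub_le hC w S c s).trans
    (mul_le_mul_of_nonneg_left ?_ (sq_nonneg s))
  have hint : ∀ m n, Integrable (fun ω => steinTerm w C m n (fun j => Y j ω)) P :=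
    fun m n => (hY.hasAllMoments_steinTerm w m n).integrable
  have hmean : ∫ ω, steinKernel w C S c (fun j => Y j ω) ∂P = ∑ m ∈ S, ∑ n ∈ S,
      c m * (c n * (n + 1)) * ∫ ω, steinTerm w C m n (fun j => Y j ω) ∂P := by
    simp only [steinKernel_eq_sum]
    rw [integral_finsetSum _ fun m _ => integrable_finsetSum _ fun n _ => (hint m n).const_mul _]
    refine Finset.sum_congr rfl fun m _ => ?_
    rw [integral_finsetSum _ fun n _ => (hint m n).const_mul _]
    simp only [integral_const_mul]
  have hint2 : ∀ m n, Integrable (fun ω => |c m * (c n * (n + 1))| *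
      |steinTerm w C m n (fun j => Y j ω) - ∫ ω, steinTerm w C m n (fun j => Y j ω) ∂P|) P :=
    fun m n => (((hint m n).sub (integrable_const _)).abs).const_mul _
  calc ∫ ω, |steinKernel w C S c (fun j => Y j ω) -
        ∫ ω, steinKernel w C S c (fun j => Y j ω) ∂P| ∂P
      ≤ ∫ ω, ∑ m ∈ S, ∑ n ∈ S, |c m * (c n * (n + 1))| *
        |steinTerm w C m n (fun j => Y j ω) - ∫ ω, steinTerm w C m n (fun j => Y j ω) ∂P| ∂P := by
        refine integral_mono ((hY.hasAllMoments_steinKernel w S c).integrable.sub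
          (integrable_const _)).abs (integrable_finsetSum _ fun m _ =>
          integrable_finsetSum _ fun n _ => hint2 m n) fun ω => ?_
        dsimp only
        rw [hmean, steinKernel_eq_sum, ← Finset.sum_sub_distrib]
        refine (Finset.abs_sum_le_sum_abs _ _).trans (Finset.sum_le_sum fun m _ => ?_)
        rw [← Finset.sum_sub_distrib]
        refine (Finset.abs_sum_le_sum_abs _ _).trans (Finset.sum_le_sum fun n _ => le_of_eq ?_)
        rw [← mul_sub, abs_mul]
    _ = ∑ m ∈ S, ∑ n ∈ S, |c m * (c n * (n + 1))| * ∫ ω,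
        |steinTerm w C m n (fun j => Y j ω) - ∫ ω, steinTerm w C m n (fun j => Y j ω) ∂P| ∂P := by
        rw [integral_finsetSum _ fun m _ => integrable_finsetSum _ fun n _ => hint2 m n]
        refine Finset.sum_congr rfl fun m _ => ?_
        rw [integral_finsetSum _ fun n _ => hint2 m n]
        simp only [integral_const_mul]
    _ ≤ _ := by
        rw [Finset.sum_mul]
        refine Finset.sum_le_sum fun m hm => ?_
        rw [Finset.sum_mul]
        refine Finset.sum_le_sum fun n hn => ?_
        rw [mul_assoc]
        exact mul_le_mul_of_nonneg_left (hA m n hm hn ι Y C w R Q hY hC hK) (abs_nonneg _)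

end SteinKernelBound

/-! ### Correlation of fractional increments and its decay -/

section FractionalKernel

/-- The correlation function of the increments of length one of a process with stationary
increments and variance function `|h| ^ r`. -/
noncomputable def fracKernel (r t : ℝ) : ℝ := (|t + 1| ^ r + |t - 1| ^ r - 2 * |t| ^ r) / 2

theorem continuous_fracKernel {r : ℝ} (hr : 0 < r) : Continuous (fracKernel r) := by
  have h : ∀ c : ℝ, Continuous fun t : ℝ => |t + c| ^ r := fun c =>
    (continuous_abs.comp (continuous_add_const c)).rpow_const fun _ => Or.inr hr.le
  have h1 := h 1
  have h2 := h (-1)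
  have h3 := h 0
  simp only [add_zero, ← sub_eq_add_neg] at h1 h2 h3
  exact ((h1.add h2).sub (h3.const_mul 2)).div_const 2

theorem fracKernel_zero {r : ℝ} (hr : 0 < r) : fracKernel r 0 = 1 := by
  simp [fracKernel, Real.zero_rpow hr.ne']

/-- The kernel is half a second difference of `t ^ r`, hence of the size of the second derivative.
The mean value inequality is used twice: for `s ↦ (t + s) ^ r + (t - s) ^ r` on `[0, 1]`, and for `x
↦ x ^ (r - 1)`. The factor `(1 / 2) ^ (r - 2)` comes from `z ≥ t - 1 ≥ t / 2` and `r - 2 ≤ 0`. -/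
theorem abs_fracKernel_le {r : ℝ} (hr : 0 < r) (hr2 : r ≤ 2) :
    ∃ c : ℝ, 0 ≤ c ∧ ∀ t, 2 ≤ t → |fracKernel r t| ≤ c * t ^ (r - 2) := by
  refine ⟨r * |r - 1| * (1 / 2) ^ (r - 2), by positivity, fun t ht => ?_⟩
  set B := |r - 1| * ((1 / 2) ^ (r - 2) * t ^ (r - 2)) with hB
  have hB0 : 0 ≤ B := by positivity
  have hpow : ∀ x ∈ Set.Icc (t - 1) (t + 1), ∀ y ∈ Set.Icc (t - 1) (t + 1),
      |y ^ (r - 1) - x ^ (r - 1)| ≤ B * |y - x| := by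
    intro x hx y hy
    refine (convex_Icc (t - 1) (t + 1)).norm_image_sub_le_of_norm_hasDerivWithin_le
      (f := fun x : ℝ => x ^ (r - 1)) (f' := fun x => (r - 1) * x ^ (r - 1 - 1)) (fun z hz => ?_)
      (fun z hz => ?_) hx hy
    · exact (Real.hasDerivAt_rpow_const (Or.inl (by linarith [hz.1]))).hasDerivWithinAt
    · have hz1 : 0 < 1 / 2 * t := by linarith
      have hz2 : 1 / 2 * t ≤ z := by linarith [hz.1]
      have hz0 : 0 < z := hz1.trans_le hz2
      rw [Real.norm_eq_abs, abs_mul, abs_of_pos (Real.rpow_pos_of_pos hz0 _), hB,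
        ← Real.mul_rpow (by norm_num) (by linarith), show r - 1 - 1 = r - 2 by ring]
      exact mul_le_mul_of_nonneg_left
        (Real.rpow_le_rpow_of_nonpos hz1 hz2 (by linarith)) (abs_nonneg _)
  have hg : ∀ s ∈ Set.Icc (0 : ℝ) 1, HasDerivWithinAt (fun s => (t + s) ^ r + (t - s) ^ r)
      (r * ((t + s) ^ (r - 1) - (t - s) ^ (r - 1))) (Set.Icc 0 1) s := by
    intro s hs
    have h1 : HasDerivAt (fun s : ℝ => (t + s) ^ r) (1 * r * (t + s) ^ (r - 1)) s :=
      ((hasDerivAt_id s).const_add t).rpow_const (Or.inl (by simp; linarith [hs.1]))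
    have h2 : HasDerivAt (fun s : ℝ => (t - s) ^ r) (-1 * r * (t - s) ^ (r - 1)) s :=
      ((hasDerivAt_id s).const_sub t).rpow_const (Or.inl (by simp; linarith [hs.2]))
    exact ((h1.add h2).congr_deriv (by ring)).hasDerivWithinAt
  have hmv := (convex_Icc (0 : ℝ) 1).norm_image_sub_le_of_norm_hasDerivWithin_le hg
    (C := r * (B * 2)) (fun s hs => ?_) (Set.left_mem_Icc.2 zero_le_one)
    (Set.right_mem_Icc.2 zero_le_one)
  · have e1 : |t + 1| = t + 1 := abs_of_pos (by linarith)
    have e2 : |t - 1| = t - 1 := abs_of_pos (by linarith)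
    have e3 : |t| = t := abs_of_pos (by linarith)
    rw [fracKernel, e1, e2, e3, abs_div, abs_two, div_le_iff₀ two_pos]
    simp only [add_zero, sub_zero, norm_one, mul_one, Real.norm_eq_abs] at hmv
    rw [two_mul (t ^ r)]
    refine hmv.trans (le_of_eq ?_)
    rw [hB]
    ring
  · rw [Real.norm_eq_abs, abs_mul, abs_of_pos hr]
    refine mul_le_mul_of_nonneg_left ?_ hr.le
    refine (hpow (t - s) ⟨by linarith [hs.2], by linarith [hs.1]⟩ (t + s)
      ⟨by linarith [hs.1], by linarith [hs.2]⟩).trans (mul_le_mul_of_nonneg_left ?_ hB0)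
    rw [abs_le]
    constructor <;> linarith [hs.1, hs.2]

/-- The bound on `r` says exactly that `(r - 2) * d ≤ -1`. -/
theorem abs_fracKernel_pow_le {r : ℝ} (hr : 0 < r) {d : ℕ} (hd : 0 < d)
    (hrd : r ≤ 2 - 1 / (d : ℝ)) :
    ∃ c : ℝ, 0 ≤ c ∧ ∀ t, 2 ≤ t → |fracKernel r t| ^ d ≤ c * t⁻¹ := by
  have hd' : (0 : ℝ) < d := Nat.cast_pos.2 hd
  obtain ⟨c, hc, h⟩ := abs_fracKernel_le hr (hrd.trans (by linarith [one_div_pos.2 hd']))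
  refine ⟨c ^ d, pow_nonneg hc d, fun t ht => ?_⟩
  refine (pow_le_pow_left₀ (abs_nonneg _) (h t ht) d).trans ?_
  have ht0 : 0 ≤ t := by linarith
  rw [mul_pow, ← Real.rpow_mul_natCast ht0, ← Real.rpow_neg_one]
  refine mul_le_mul_of_nonneg_left (Real.rpow_le_rpow_of_exponent_le (by linarith) ?_)
    (pow_nonneg hc d)
  have h1 : r - 2 ≤ -(1 / (d : ℝ)) := by linarith
  calc (r - 2) * d ≤ -(1 / (d : ℝ)) * d := by gcongr
    _ = -1 := by field_simp

end FractionalKernel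

/-! ### Integrals of powers of a kernel with critical decay -/

section IntegratedPowers

/-- A weighted Young inequality, by cases: if `y ≤ δ x` at least one factor `δ` is gained since `q ≥
1`, and otherwise `x ≤ y / δ`. -/
theorem pow_mul_pow_le_add {x y δ : ℝ} (hx : 0 ≤ x) (hy : 0 ≤ y) (hδ : 0 < δ) (hδ1 : δ ≤ 1)
    {p q : ℕ} (hq : 1 ≤ q) :
    x ^ p * y ^ q ≤ δ * x ^ (p + q) + (δ ^ (p + q))⁻¹ * y ^ (p + q) := by
  have h1 : 0 ≤ δ * x ^ (p + q) := by positivity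
  have h2 : 0 ≤ (δ ^ (p + q))⁻¹ * y ^ (p + q) := by positivity
  rcases le_total y (δ * x) with h | h
  · have : x ^ p * y ^ q ≤ δ * x ^ (p + q) :=
      calc x ^ p * y ^ q ≤ x ^ p * (δ * x) ^ q := by gcongr
        _ = δ ^ q * x ^ (p + q) := by rw [mul_pow, pow_add]; ring
        _ ≤ δ ^ 1 * x ^ (p + q) := mul_le_mul_of_nonneg_right
            (pow_le_pow_of_le_one hδ.le hδ1 hq) (by positivity)
        _ = δ * x ^ (p + q) := by rw [pow_one]
    linarith
  · have : x ^ p * y ^ q ≤ (δ ^ (p + q))⁻¹ * y ^ (p + q) := by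
      have hxy : x ≤ δ⁻¹ * y := by rwa [le_inv_mul_iff₀ hδ]
      calc x ^ p * y ^ q ≤ (δ⁻¹ * y) ^ p * y ^ q := by gcongr
        _ = (δ⁻¹) ^ p * y ^ (p + q) := by rw [mul_pow, pow_add]; ring
        _ ≤ (δ⁻¹) ^ (p + q) * y ^ (p + q) := mul_le_mul_of_nonneg_right
            (pow_le_pow_right₀ ((one_le_inv₀ hδ).2 hδ1) (by lia)) (by positivity)
        _ = _ := by rw [inv_pow]
    linarith

variable {k : ℝ → ℝ}

/-- The Young inequality integrated over a rectangle. Each term carries the length of the side that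
does not enter its integrand, so a short first side compensates the large factor `(δ ^ (p + q))⁻¹`.
-/
theorem integral_pow_mul_integral_pow_le (hk : Continuous k) (hk0 : ∀ t, 0 ≤ k t) {δ : ℝ}
    (hδ : 0 < δ) (hδ1 : δ ≤ 1) {p q : ℕ} (hq : 1 ≤ q) {a₁ b₁ a₂ b₂ : ℝ} (h₁ : a₁ ≤ b₁)
    (h₂ : a₂ ≤ b₂) :
    (∫ u in a₁..b₁, k u ^ p) * (∫ v in a₂..b₂, k v ^ q) ≤
      δ * (b₂ - a₂) * (∫ u in a₁..b₁, k u ^ (p + q)) +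
        (δ ^ (p + q))⁻¹ * (b₁ - a₁) * ∫ v in a₂..b₂, k v ^ (p + q) := by
  have hi : ∀ (n : ℕ) (a b : ℝ), IntervalIntegrable (fun u => k u ^ n) volume a b :=
    fun n a b => (hk.pow n).intervalIntegrable a b
  have inner : ∀ u, k u ^ p * (∫ v in a₂..b₂, k v ^ q) ≤
      δ * (b₂ - a₂) * k u ^ (p + q) + (δ ^ (p + q))⁻¹ * ∫ v in a₂..b₂, k v ^ (p + q) := by
    intro u
    rw [← intervalIntegral.integral_const_mul]
    calc ∫ v in a₂..b₂, k u ^ p * k v ^ q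
        ≤ ∫ v in a₂..b₂, (δ * k u ^ (p + q) + (δ ^ (p + q))⁻¹ * k v ^ (p + q)) :=
          intervalIntegral.integral_mono_on h₂ ((hi q _ _).const_mul _)
            (intervalIntegrable_const.add ((hi _ _ _).const_mul _))
            fun v _ => pow_mul_pow_le_add (hk0 u) (hk0 v) hδ hδ1 hq
      _ = _ := by
          rw [intervalIntegral.integral_add intervalIntegrable_const ((hi _ _ _).const_mul _),
            intervalIntegral.integral_const, intervalIntegral.integral_const_mul, smul_eq_mul]
          ring
  rw [← intervalIntegral.integral_mul_const]
  calc ∫ u in a₁..b₁, k u ^ p * (∫ v in a₂..b₂, k v ^ q)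
      ≤ ∫ u in a₁..b₁, (δ * (b₂ - a₂) * k u ^ (p + q) +
          (δ ^ (p + q))⁻¹ * ∫ v in a₂..b₂, k v ^ (p + q)) :=
        intervalIntegral.integral_mono_on h₁ ((hi p _ _).mul_const _)
          (((hi _ _ _).const_mul _).add intervalIntegrable_const) fun u _ => inner u
    _ = _ := by
        rw [intervalIntegral.integral_add ((hi _ _ _).const_mul _) intervalIntegrable_const,
          intervalIntegral.integral_const, intervalIntegral.integral_const_mul, smul_eq_mul]
        ring

theorem monotone_integral_pow (hk : Continuous k) (hk0 : ∀ t, 0 ≤ k t) (n : ℕ) :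
    Monotone fun Λ => ∫ u in (0 : ℝ)..Λ, k u ^ n := by
  intro a b hab
  have hi : ∀ (a b : ℝ), IntervalIntegrable (fun u => k u ^ n) volume a b :=
    fun a b => (hk.pow n).intervalIntegrable a b
  have := intervalIntegral.integral_add_adjacent_intervals (hi 0 a) (hi a b)
  have h2 := intervalIntegral.integral_nonneg (μ := volume) hab fun u _ => pow_nonneg (hk0 u) n
  dsimp only
  linarith

theorem integral_pow_pos (hk : Continuous k) (hk0 : ∀ t, 0 ≤ k t) (hk1 : k 0 = 1) (n : ℕ) {Λ : ℝ}
    (hΛ : 0 < Λ) : 0 < ∫ u in (0 : ℝ)..Λ, k u ^ n :=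
  intervalIntegral.integral_pos hΛ (hk.pow n).continuousOn (fun u _ => pow_nonneg (hk0 u) n)
    ⟨0, ⟨le_rfl, hΛ.le⟩, by simp [hk1]⟩

/-- If `k ^ d` decays at least like `1 / t`, its integral over `[ε Λ, Λ]` is negligible compared to
its integral over `[0, Λ]`. -/
theorem tendsto_integral_pow_tail (hk : Continuous k) (hk0 : ∀ t, 0 ≤ k t) (hk1 : k 0 = 1) {d : ℕ}
    {c : ℝ} (hc : ∀ t, 2 ≤ t → k t ^ d ≤ c * t⁻¹) {ε : ℝ} (hε : 0 < ε) (hε1 : ε ≤ 1) :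
    Tendsto (fun Λ => (∫ u in (ε * Λ)..Λ, k u ^ d) / ∫ u in (0 : ℝ)..Λ, k u ^ d) atTop (𝓝 0) := by
  have hi : ∀ (a b : ℝ), IntervalIntegrable (fun u => k u ^ d) volume a b :=
    fun a b => (hk.pow d).intervalIntegrable a b
  have hmono := monotone_integral_pow hk hk0 d
  have hsub : ∀ Λ, ∫ u in (ε * Λ)..Λ, k u ^ d =
      (∫ u in (0 : ℝ)..Λ, k u ^ d) - ∫ u in (0 : ℝ)..(ε * Λ), k u ^ d := fun Λ => by
    rw [intervalIntegral.integral_interval_sub_left (hi _ _) (hi _ _)]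
  have hεt : Tendsto (fun Λ : ℝ => ε * Λ) atTop atTop := tendsto_id.const_mul_atTop hε
  -- If the full integral diverges, the tail stays below `c * log (1 / ε)`. If it converges to a
  -- positive limit, the tail is a difference of two quantities with the same limit.
  rcases tendsto_atTop_of_monotone hmono with h | ⟨l, h⟩
  · have hbd : ∀ᶠ Λ in atTop, ‖∫ u in (ε * Λ)..Λ, k u ^ d‖ ≤ c * Real.log (1 / ε) := by
      filter_upwards [hεt.eventually_ge_atTop 2, eventually_gt_atTop 0] with Λ h2 h0
      have hle : ε * Λ ≤ Λ := by nlinarith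
      have hpos : 0 < ε * Λ := by linarith
      rw [Real.norm_eq_abs, abs_of_nonneg (intervalIntegral.integral_nonneg hle fun u _ =>
        pow_nonneg (hk0 u) d)]
      calc ∫ u in (ε * Λ)..Λ, k u ^ d ≤ ∫ u in (ε * Λ)..Λ, c * u⁻¹ := by
            refine intervalIntegral.integral_mono_on hle (hi _ _) ?_
              fun u hu => hc u (h2.trans hu.1)
            refine IntervalIntegrable.const_mul ?_ c
            refine intervalIntegral.intervalIntegrable_inv (fun u hu => ?_) continuousOn_id
            rw [Set.uIcc_of_le hle] at hu
            exact (hpos.trans_le hu.1).ne'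
        _ = c * Real.log (1 / ε) := by
            rw [intervalIntegral.integral_const_mul, integral_inv_of_pos hpos h0]
            congr 2
            field_simp
    have hO : (fun Λ => ∫ u in (ε * Λ)..Λ, k u ^ d) =O[atTop] fun _ => (1 : ℝ) :=
      Asymptotics.IsBigO.of_bound (c * Real.log (1 / ε)) (hbd.mono fun Λ h => by
        rwa [norm_one, mul_one])
    exact (hO.trans_isLittleO (Asymptotics.isLittleO_const_left.2 (Or.inr
      (tendsto_norm_atTop_atTop.comp h)))).tendsto_div_nhds_zero
  · have hl : 0 < l := (integral_pow_pos hk hk0 hk1 d one_pos).trans_le (hmono.ge_of_tendsto h 1)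
    have := (h.sub (h.comp hεt)).div h hl.ne'
    rw [sub_self, zero_div] at this
    exact this.congr fun Λ => by rw [hsub]; rfl

/-- Hölder's inequality only bounds this ratio by `1`. Decay comes from `k ^ (p + q)` having nearly
all its mass on the small fraction `[0, ε Λ]` of the interval, while equality in Hölder would
require a constant `k`. -/
theorem tendsto_integral_pow_mul_integral_pow (hk : Continuous k) (hk0 : ∀ t, 0 ≤ k t)
    (hk1 : k 0 = 1) {p q : ℕ} (hp : 1 ≤ p) (hq : 1 ≤ q) {c : ℝ}
    (hc : ∀ t, 2 ≤ t → k t ^ (p + q) ≤ c * t⁻¹) :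
    Tendsto (fun Λ => (∫ u in (0 : ℝ)..Λ, k u ^ p) * (∫ u in (0 : ℝ)..Λ, k u ^ q) /
      (Λ * ∫ u in (0 : ℝ)..Λ, k u ^ (p + q))) atTop (𝓝 0) := by
  have hi : ∀ (n : ℕ) (a b : ℝ), IntervalIntegrable (fun u => k u ^ n) volume a b :=
    fun n a b => (hk.pow n).intervalIntegrable a b
  have hnn : ∀ (n : ℕ) {a b : ℝ}, a ≤ b → 0 ≤ ∫ u in a..b, k u ^ n := fun n a b hab =>
    intervalIntegral.integral_nonneg hab fun u _ => pow_nonneg (hk0 u) n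
  have main : ∀ Λ : ℝ, 0 < Λ → ∀ δ : ℝ, 0 < δ → δ ≤ 1 →
      (∫ u in (0 : ℝ)..Λ, k u ^ p) * (∫ u in (0 : ℝ)..Λ, k u ^ q) ≤
        4 * δ * (Λ * ∫ u in (0 : ℝ)..Λ, k u ^ (p + q)) +
          2 * (Λ * ∫ u in (δ ^ (p + q + 1) * Λ)..Λ, k u ^ (p + q)) := by
    intro Λ hΛ δ hδ hδ1
    -- Chosen so that the Young constant `(δ ^ (p + q))⁻¹` times the short length `ε Λ` is `δ Λ`.
    set ε := δ ^ (p + q + 1) with hε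
    have hε0 : 0 < ε := pow_pos hδ _
    have hε1 : ε ≤ 1 := pow_le_one₀ hδ.le hδ1
    have hεδ : (δ ^ (p + q))⁻¹ * ε = δ := by rw [hε, pow_succ]; field_simp
    have h0 : 0 ≤ ε * Λ := by positivity
    have hle : ε * Λ ≤ Λ := by nlinarith
    have hsplit : ∀ n, ∫ u in (0 : ℝ)..Λ, k u ^ n =
        (∫ u in (0 : ℝ)..(ε * Λ), k u ^ n) + ∫ u in (ε * Λ)..Λ, k u ^ n := fun n =>
      (intervalIntegral.integral_add_adjacent_intervals (hi n _ _) (hi n _ _)).symm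
    -- The square `[0, Λ]²` is cut into two rectangles with a short side, where the Young inequality
    -- gains `δ`, and the square `[ε Λ, Λ]²`, where parameter `1` suffices because only the tail
    -- integral appears.
    have t1 := integral_pow_mul_integral_pow_le hk hk0 hδ hδ1 (p := p) hq h0 hΛ.le
    have t2 := integral_pow_mul_integral_pow_le hk hk0 hδ hδ1 (p := q) hp h0 hle
    have t3 := integral_pow_mul_integral_pow_le hk hk0 one_pos le_rfl (p := p) hq hle hle
    rw [add_comm q p] at t2
    simp only [sub_zero, one_pow, inv_one, one_mul] at t1 t2 t3
    set F := ∫ u in (0 : ℝ)..Λ, k u ^ (p + q) with hF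
    set F₁ := ∫ u in (0 : ℝ)..(ε * Λ), k u ^ (p + q) with hF₁
    set F₂ := ∫ u in (ε * Λ)..Λ, k u ^ (p + q) with hF₂
    have hFs : F = F₁ + F₂ := hsplit _
    have hF1 : 0 ≤ F₁ := hnn _ h0
    have hF2 : 0 ≤ F₂ := hnn _ hle
    have e1 : (δ ^ (p + q))⁻¹ * (ε * Λ) = δ * Λ := by rw [← mul_assoc, hεδ]
    rw [e1] at t1 t2
    have b1 : δ * Λ * F₁ ≤ δ * Λ * F := by gcongr; linarith
    have b2 : δ * (Λ - ε * Λ) * F₁ ≤ δ * Λ * F := by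
      gcongr
      · linarith
      · linarith
    have b3 : δ * Λ * F₂ ≤ δ * Λ * F := by gcongr; linarith
    have b4 : (Λ - ε * Λ) * F₂ ≤ Λ * F₂ := by gcongr; linarith
    calc (∫ u in (0 : ℝ)..Λ, k u ^ p) * (∫ u in (0 : ℝ)..Λ, k u ^ q)
        = (∫ u in (0 : ℝ)..(ε * Λ), k u ^ p) * (∫ u in (0 : ℝ)..Λ, k u ^ q) +
          (∫ u in (0 : ℝ)..(ε * Λ), k u ^ q) * (∫ u in (ε * Λ)..Λ, k u ^ p) +
          (∫ u in (ε * Λ)..Λ, k u ^ p) * (∫ u in (ε * Λ)..Λ, k u ^ q) := by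
          rw [hsplit p, hsplit q]; ring
      _ ≤ _ := by linarith
  rw [Metric.tendsto_atTop']
  intro η hη
  set δ := min 1 (η / 8) with hδ
  have hδ0 : 0 < δ := lt_min one_pos (by linarith)
  have hδ1 : δ ≤ 1 := min_le_left _ _
  have hδη : 4 * δ ≤ η / 2 := by linarith [min_le_right 1 (η / 8)]
  have htail := tendsto_integral_pow_tail hk hk0 hk1 hc (pow_pos hδ0 (p + q + 1))
    (pow_le_one₀ hδ0.le hδ1)
  have hev := (htail.eventually (gt_mem_nhds (show (0 : ℝ) < η / 4 by linarith))).and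
    (eventually_gt_atTop 0)
  obtain ⟨N, hN⟩ := (eventually_atTop.1 hev)
  refine ⟨N, fun Λ hΛ => ?_⟩
  obtain ⟨h1, h2⟩ := hN Λ hΛ.le
  have hF : 0 < ∫ u in (0 : ℝ)..Λ, k u ^ (p + q) := integral_pow_pos hk hk0 hk1 _ h2
  rw [div_lt_iff₀ hF] at h1
  have h3 := main Λ h2 δ hδ0 hδ1
  rw [Real.dist_eq, sub_zero, abs_of_nonneg (div_nonneg (mul_nonneg (hnn _ h2.le) (hnn _ h2.le))
    (mul_pos h2 hF).le), div_lt_iff₀ (mul_pos h2 hF)]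
  refine h3.trans_lt ?_
  nlinarith [mul_lt_mul_of_pos_left h1 h2, mul_le_mul_of_nonneg_right hδη (mul_pos h2 hF).le]

end IntegratedPowers

/-! ### The Hermite basis of `L²` of the Gaussian measure -/

section HermiteBasis

open Polynomial
open scoped InnerProductSpace

theorem isGaussianVector_id :
    IsGaussianVector (fun (_ : Unit) (x : ℝ) => x) (fun _ _ => 1) (gaussianReal 0 1) where
  hasGaussianLaw := by
    have h := (IsGaussian.hasGaussianLaw_id (μ := gaussianReal 0 1)).map_fun
      (ContinuousLinearMap.pi fun _ : Unit => ContinuousLinearMap.id ℝ ℝ)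
    exact h
  integral_eq_zero _ := integral_id_gaussianReal
  integral_mul _ _ := by
    have h := variance_eq_integral (μ := gaussianReal 0 1) (X := fun x : ℝ => x) aemeasurable_id
    rw [variance_fun_id_gaussianReal] at h
    simpa [integral_id_gaussianReal, sq] using h.symm

theorem hermiteH_eq (m : ℕ) (x : ℝ) :
    hermiteH m x = (hermiteR m).eval x / √(m.factorial : ℝ) := by
  rw [hermiteH, aeval_hermite]

theorem hasAllMoments_eval_gaussianReal (q : ℝ[X]) :
    HasAllMoments (fun x => q.eval x) (gaussianReal 0 1) :=
  (isGaussianVector_id.hasAllMoments ()).eval q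

theorem memLp_hermiteH (m : ℕ) : MemLp (hermiteH m) 2 (gaussianReal 0 1) := by
  have h := ((hasAllMoments_eval_gaussianReal (hermiteR m)).const_mul
    (√(m.factorial : ℝ))⁻¹).memLp_two
  refine h.ae_eq (ae_of_all _ fun x => ?_)
  rw [hermiteH_eq, div_eq_inv_mul]

/-- The normalized Hermite polynomials as elements of `L²`. -/
noncomputable def hermiteLp (m : ℕ) : Lp ℝ 2 (gaussianReal 0 1) := (memLp_hermiteH m).toLp

theorem sqrt_factorial_mul_self (m : ℕ) :
    √(m.factorial : ℝ) * √(m.factorial : ℝ) = m.factorial :=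
  Real.mul_self_sqrt (Nat.cast_nonneg _)

/-- The correlation of normalized Hermite polynomials in two coordinates of a Gaussian vector. -/
theorem IsGaussianVector.integral_hermiteH_mul_hermiteH {Ω : Type*} [MeasurableSpace Ω]
    {P : Measure Ω} {ι : Type*} [Fintype ι] {Y : ι → Ω → ℝ} {C : ι → ι → ℝ}
    (hY : IsGaussianVector Y C P) {i : ι} (hi : C i i = 1) {j : ι} (hj : C j j = 1) (a b : ℕ) :
    ∫ ω, hermiteH a (Y i ω) * hermiteH b (Y j ω) ∂P = if a = b then C i j ^ a else 0 := by
  have h1 : ∀ ω, hermiteH a (Y i ω) * hermiteH b (Y j ω) =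
      (√(a.factorial : ℝ) * √(b.factorial : ℝ))⁻¹ *
        ((hermiteR a).eval (Y i ω) * (hermiteR b).eval (Y j ω)) := fun ω => by
    rw [hermiteH_eq, hermiteH_eq, mul_inv]; ring
  simp only [h1, integral_const_mul, hY.integral_hermiteR_mul_hermiteR hi hj]
  split_ifs with h
  · subst h
    have : (a.factorial : ℝ) ≠ 0 := Nat.cast_ne_zero.2 a.factorial_ne_zero
    rw [sqrt_factorial_mul_self, inv_mul_cancel_left₀ this]
  · simp

theorem inner_toLp_toLp {α : Type*} [MeasurableSpace α] {μ : Measure α} {f g : α → ℝ}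
    (hf : MemLp f 2 μ) (hg : MemLp g 2 μ) : ⟪hf.toLp, hg.toLp⟫_ℝ = ∫ x, f x * g x ∂μ := by
  rw [L2.inner_def]
  refine integral_congr_ae ?_
  filter_upwards [hf.coeFn_toLp, hg.coeFn_toLp] with x h1 h2
  rw [h1, h2]
  simp [mul_comm]

theorem orthonormal_hermiteLp : Orthonormal ℝ hermiteLp := by
  rw [orthonormal_iff_ite]
  intro m n
  rw [hermiteLp, hermiteLp, inner_toLp_toLp]
  have := isGaussianVector_id.integral_hermiteH_mul_hermiteH (i := ()) rfl (j := ()) rfl m n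
  simpa using this

/-- The Hermite polynomials as a polynomial sequence. -/
noncomputable def hermiteSequence : Polynomial.Sequence ℝ where
  elems' := hermiteR
  degree_eq' m := by
    rw [degree_eq_natDegree (monic_hermiteR m).ne_zero, natDegree_hermiteR]

theorem span_range_hermiteR : Submodule.span ℝ (Set.range hermiteR) = ⊤ :=
  hermiteSequence.span fun i => by
    have : (hermiteSequence i).leadingCoeff = 1 := monic_hermiteR i
    rw [this]
    exact isUnit_one

theorem integrable_exp_mul_abs_sq_gaussianReal (t : ℝ) :
    MemLp (fun x => Real.exp |t * x|) 2 (gaussianReal 0 1) := by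
  rw [memLp_two_iff_integrable_sq (by fun_prop)]
  have h := (integrable_exp_mul_gaussianReal (μ := 0) (v := 1) (2 * t)).add
    (integrable_exp_mul_gaussianReal (μ := 0) (v := 1) (-(2 * t)))
  refine h.mono (by fun_prop) (ae_of_all _ fun x => ?_)
  rw [Real.norm_of_nonneg (sq_nonneg _), ← Real.exp_nat_mul, Pi.add_apply,
    Real.norm_of_nonneg (by positivity)]
  rcases abs_cases (t * x) with ⟨h, _⟩ | ⟨h, _⟩ <;> rw [h]
  · have : ((2 : ℕ) : ℝ) * (t * x) = 2 * t * x := by push_cast; ring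
    rw [this]
    linarith [Real.exp_pos (-(2 * t) * x)]
  · have : ((2 : ℕ) : ℝ) * -(t * x) = -(2 * t) * x := by push_cast; ring
    rw [this]
    linarith [Real.exp_pos (2 * t * x)]

/-- A square integrable function that is orthogonal to all polynomials vanishes. -/
theorem ae_eq_zero_of_forall_integral_pow_mul_eq_zero {f : ℝ → ℝ}
    (hf : MemLp f 2 (gaussianReal 0 1))
    (h : ∀ n : ℕ, ∫ x, x ^ n * f x ∂(gaussianReal 0 1) = 0) : f =ᵐ[gaussianReal 0 1] 0 := by
  set γ := gaussianReal 0 1 with hγ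
  have hfi : Integrable f γ := hf.integrable (by norm_num)
  -- The exponential is expanded in its power series and integrated term by term. The dominating
  -- function `|f x| * exp |t * x|` is a product of two elements of `L²`.
  have hchar : ∀ t : ℝ, ∫ x, (f x : ℂ) * Complex.exp (t * x * Complex.I) ∂γ = 0 := by
    intro t
    have hsum : HasSum (fun n : ℕ => ∫ x, (f x : ℂ) * ((t * x * Complex.I) ^ n / n.factorial) ∂γ)
        (∫ x, (f x : ℂ) * Complex.exp (t * x * Complex.I) ∂γ) := by
      refine hasSum_integral_of_dominated_convergence
        (fun n x => |f x| * (|t * x| ^ n / n.factorial)) (fun n => ?_)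
        (fun n => ae_of_all _ fun x => ?_) (ae_of_all _ fun x => ?_) ?_ (ae_of_all _ fun x => ?_)
      · refine AEStronglyMeasurable.mul ?_ (by fun_prop)
        exact (Complex.measurable_ofReal.comp_aemeasurable hfi.aemeasurable).aestronglyMeasurable
      · simp [abs_mul]
      · exact (Real.summable_pow_div_factorial _).mul_left _
      · have he : ∀ x, ∑' n : ℕ, |f x| * (|t * x| ^ n / n.factorial) =
            |f x| * Real.exp |t * x| := fun x => by
          rw [tsum_mul_left, Real.exp_eq_exp_ℝ, NormedSpace.exp_eq_tsum_div]
        simp only [he]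
        exact hf.abs.integrable_mul (integrable_exp_mul_abs_sq_gaussianReal t)
      · refine HasSum.mul_left _ ?_
        rw [Complex.exp_eq_exp_ℂ]
        exact NormedSpace.expSeries_div_hasSum_exp _
    have hz : ∀ n : ℕ, ∫ x, (f x : ℂ) * ((t * x * Complex.I) ^ n / n.factorial) ∂γ = 0 := by
      intro n
      have : ∀ x : ℝ, (f x : ℂ) * ((t * x * Complex.I) ^ n / n.factorial) =
          ((t * Complex.I) ^ n / n.factorial) * ((x ^ n * f x : ℝ) : ℂ) := fun x => by
        push_cast; ring
      simp only [this, integral_const_mul, integral_complex_ofReal, h n]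
      simp
    simp only [hz] at hsum
    exact hsum.unique hasSum_zero
  have hfm := hfi.aemeasurable
  have hfin : ∀ g : ℝ → ℝ, Integrable g γ → IsFiniteMeasure (γ.withDensity fun x =>
      ENNReal.ofReal (g x)) := fun g hg => isFiniteMeasure_withDensity_ofReal hg.2
  have h1 := hfin f hfi
  have h2 := hfin (fun x => -f x) hfi.neg
  have hint : ∀ g : ℝ → ℝ, Integrable g γ → ∀ t : ℝ,
      Integrable (fun x => (g x : ℂ) * Complex.exp (t * x * Complex.I)) γ := by
    intro g hg t
    refine hg.mono (AEStronglyMeasurable.mul ?_ (by fun_prop)) (ae_of_all _ fun x => ?_)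
    · exact (Complex.measurable_ofReal.comp_aemeasurable hg.aemeasurable).aestronglyMeasurable
    · rw [norm_mul, ← Complex.ofReal_mul, Complex.norm_exp_ofReal_mul_I, mul_one, Complex.norm_real]
  -- The positive and negative parts of `f` are densities of finite measures with equal
  -- characteristic functions, so they agree almost everywhere; having disjoint supports, both
  -- vanish.
  have heq : γ.withDensity (fun x => ENNReal.ofReal (f x)) =
      γ.withDensity (fun x => ENNReal.ofReal (-f x)) := by
    refine Measure.ext_of_charFun (funext fun t => ?_)
    have hd : ∀ g : ℝ → ℝ, Integrable g γ → charFun (γ.withDensity fun x => ENNReal.ofReal (g x)) t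
        = ∫ x, ((max (g x) 0 : ℝ) : ℂ) * Complex.exp (t * x * Complex.I) ∂γ := by
      intro g hg
      rw [charFun_apply_real, integral_withDensity_eq_integral_toReal_smul₀
        hg.aemeasurable.ennreal_ofReal (ae_of_all _ fun x => ENNReal.ofReal_lt_top)]
      simp only [ENNReal.toReal_ofReal', Complex.real_smul]
    rw [hd f hfi, hd (fun x => -f x) hfi.neg, ← sub_eq_zero, ← integral_sub (hint _ hfi.pos_part t)
      (hint _ hfi.neg_part t), ← hchar t]
    congr 1 with x
    rw [← sub_mul, ← Complex.ofReal_sub]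
    congr 2
    rcases le_total (f x) 0 with h | h
    · rw [max_eq_right h, max_eq_left (neg_nonneg.2 h)]; ring
    · rw [max_eq_left h, max_eq_right (neg_nonpos.2 h)]; ring
  have hae := (withDensity_eq_iff_of_sigmaFinite hfm.ennreal_ofReal
    (hfm.neg : AEMeasurable (fun x => -f x) γ).ennreal_ofReal).1 heq
  filter_upwards [hae] with x hx
  rw [Pi.neg_apply] at hx
  rcases le_total (f x) 0 with h | h
  · rw [ENNReal.ofReal_of_nonpos h, eq_comm, ENNReal.ofReal_eq_zero] at hx
    exact le_antisymm h (neg_nonpos.1 hx)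
  · rw [ENNReal.ofReal_of_nonpos (neg_nonpos.2 h), ENNReal.ofReal_eq_zero] at hx
    exact le_antisymm hx h

theorem span_range_hermiteLp_orthogonal :
    (Submodule.span ℝ (Set.range hermiteLp))ᗮ = ⊥ := by
  rw [Submodule.eq_bot_iff]
  intro f hf
  have hf2 := Lp.memLp f
  have hpoly : ∀ q : ℝ[X], ∫ x, q.eval x * f x ∂(gaussianReal 0 1) = 0 := by
    intro q
    have hint : ∀ q : ℝ[X], Integrable (fun x => q.eval x * f x) (gaussianReal 0 1) := fun q =>
      (hasAllMoments_eval_gaussianReal q).memLp_two.integrable_mul hf2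
    have hq : q ∈ Submodule.span ℝ (Set.range hermiteR) := by
      rw [span_range_hermiteR]; trivial
    induction hq using Submodule.span_induction with
    | mem q hq =>
      obtain ⟨m, rfl⟩ := hq
      have h1 := (Submodule.mem_orthogonal _ _).1 hf (hermiteLp m)
        (Submodule.subset_span ⟨m, rfl⟩)
      rw [hermiteLp, ← Lp.toLp_coeFn f hf2, inner_toLp_toLp] at h1
      have h2 : ∀ x, (hermiteR m).eval x * f x =
          √(m.factorial : ℝ) * (hermiteH m x * f x) := fun x => by
        have : √(m.factorial : ℝ) ≠ 0 :=
          (Real.sqrt_pos.2 (Nat.cast_pos.2 m.factorial_pos)).ne'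
        rw [hermiteH_eq]
        field_simp
      simp only [h2, integral_const_mul, h1, mul_zero]
    | zero => simp
    | add p q _ _ hp hq =>
      simp only [eval_add, add_mul]
      rw [integral_add (hint p) (hint q), hp, hq, add_zero]
    | smul c q _ hq =>
      simp only [eval_smul, smul_eq_mul, mul_assoc, integral_const_mul, hq, mul_zero]
  have := ae_eq_zero_of_forall_integral_pow_mul_eq_zero hf2 fun n => by
    simpa using hpoly (X ^ n)
  exact (Lp.eq_zero_iff_ae_eq_zero).2 this

/-- The Hilbert basis of `L²` of the standard Gaussian measure given by the normalized Hermite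
polynomials. -/
noncomputable def hermiteBasis : HilbertBasis ℕ ℝ (Lp ℝ 2 (gaussianReal 0 1)) :=
  HilbertBasis.mkOfOrthogonalEqBot orthonormal_hermiteLp span_range_hermiteLp_orthogonal

theorem hermiteBasis_apply (m : ℕ) : hermiteBasis m = hermiteLp m := by
  rw [hermiteBasis, HilbertBasis.coe_mkOfOrthogonalEqBot]

theorem hermiteBasis_repr_toLp {f : ℝ → ℝ} (hf : MemLp f 2 (gaussianReal 0 1)) (m : ℕ) :
    hermiteBasis.repr hf.toLp m = hermiteCoeff f m := by
  rw [HilbertBasis.repr_apply_apply, hermiteBasis_apply, hermiteLp, inner_toLp_toLp, hermiteCoeff]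
  simp only [mul_comm]

theorem hermiteR_eval_neg (m : ℕ) (x : ℝ) :
    (hermiteR m).eval (-x) = (-1) ^ m * (hermiteR m).eval x := by
  have : (hermiteR m).comp (-X) = (-1) ^ m * hermiteR m := by
    induction m with
    | zero => simp
    | succ m ih =>
      have h2 := congrArg derivative ih
      have e : ((-1 : ℝ[X]) ^ m) = Polynomial.C ((-1) ^ m) := by simp
      rw [derivative_comp, e, derivative_C_mul, ← e] at h2
      simp only [derivative_neg, derivative_X] at h2
      rw [hermiteR_succ, sub_comp, mul_comp, X_comp, ih, pow_succ]
      linear_combination h2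
  have h := congrArg (Polynomial.eval x) this
  simpa [eval_comp] using h

theorem hermiteCoeff_odd_eq_zero {f : ℝ → ℝ} (hsymm : ∀ᵐ x ∂(gaussianReal 0 1), f (-x) = f x)
    {m : ℕ} (hm : Odd m) : hermiteCoeff f m = 0 := by
  have hmap : (gaussianReal 0 1).map (fun x => -x) = gaussianReal 0 1 := by
    rw [gaussianReal_map_neg, neg_zero]
  have h1 : hermiteCoeff f m = ∫ x, f (-x) * hermiteH m (-x) ∂(gaussianReal 0 1) := by
    have hme : MeasurableEmbedding (fun x : ℝ => -x) := (MeasurableEquiv.neg ℝ).measurableEmbedding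
    rw [hermiteCoeff]
    conv_lhs => rw [← hmap]
    rw [hme.integral_map]
  have h2 : ∫ x, f (-x) * hermiteH m (-x) ∂(gaussianReal 0 1) = -hermiteCoeff f m := by
    rw [hermiteCoeff, ← integral_neg]
    refine integral_congr_ae ?_
    filter_upwards [hsymm] with x hx
    rw [hx, hermiteH_eq, hermiteH_eq, hermiteR_eval_neg, hm.neg_one_pow]
    ring
  linarith

end HermiteBasis

/-! ### Riemann sums in normed spaces -/

section RiemannSums

variable {E : Type*} [NormedAddCommGroup E] [NormedSpace ℝ E]

/-- Left Riemann sums of a continuous function on uniform partitions converge to the integral. -/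
theorem tendsto_riemannSum [CompleteSpace E] {F : ℝ → E} (hF : Continuous F) (a : ℝ) {L : ℝ}
    (hL : 0 < L) :
    Tendsto (fun n : ℕ => ∑ j ∈ Finset.range n, (L / n) • F (a + j * (L / n))) atTop
      (𝓝 (∫ x in a..(a + L), F x)) := by
  rw [Metric.tendsto_atTop]
  intro ε hε
  have huc := isCompact_Icc.uniformContinuousOn_of_continuous
    (hF.continuousOn (s := Set.Icc a (a + L)))
  rw [Metric.uniformContinuousOn_iff] at huc
  obtain ⟨δ, hδ, h⟩ := huc (ε / (2 * L)) (by positivity)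
  obtain ⟨N, hN⟩ := exists_nat_gt (L / δ)
  refine ⟨N + 1, fun n hn => ?_⟩
  have hn0 : (0 : ℝ) < n := Nat.cast_pos.2 (by lia)
  have hw : 0 < L / n := by positivity
  have hwδ : L / n < δ := by
    rw [div_lt_iff₀ hn0]
    rw [div_lt_iff₀ hδ] at hN
    have : (N : ℝ) ≤ n := Nat.cast_le.2 (by lia)
    nlinarith
  have hsum : ∫ x in a..(a + L), F x =
      ∑ j ∈ Finset.range n, ∫ x in (a + j * (L / n))..(a + (j + 1 : ℕ) * (L / n)), F x := by
    rw [intervalIntegral.sum_integral_adjacent_intervals (a := fun j : ℕ => a + j * (L / n))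
      fun _ _ => hF.intervalIntegrable _ _]
    congr 1
    · simp
    · field_simp
  rw [dist_eq_norm, hsum, ← Finset.sum_sub_distrib]
  have hterm : ∀ j ∈ Finset.range n, ‖(L / n) • F (a + j * (L / n)) -
      ∫ x in (a + j * (L / n))..(a + (j + 1 : ℕ) * (L / n)), F x‖ ≤ ε / (2 * L) * (L / n) := by
    intro j hj
    have hlen : a + (j + 1 : ℕ) * (L / n) - (a + j * (L / n)) = L / n := by push_cast; ring
    have hc : (L / n) • F (a + j * (L / n)) =
        ∫ x in (a + j * (L / n))..(a + (j + 1 : ℕ) * (L / n)), F (a + j * (L / n)) := by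
      rw [intervalIntegral.integral_const, hlen]
    rw [hc, ← intervalIntegral.integral_sub intervalIntegrable_const (hF.intervalIntegrable _ _)]
    have hle : a + j * (L / n) ≤ a + (j + 1 : ℕ) * (L / n) := by linarith
    have hj1 : ((j + 1 : ℕ) : ℝ) * (L / n) ≤ L := by
      have : ((j + 1 : ℕ) : ℝ) ≤ n := Nat.cast_le.2 (by have := Finset.mem_range.1 hj; lia)
      calc ((j + 1 : ℕ) : ℝ) * (L / n) ≤ n * (L / n) := by gcongr
        _ = L := by field_simp
    have hj0 : 0 ≤ (j : ℝ) * (L / n) := by positivity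
    refine (intervalIntegral.norm_integral_le_of_norm_le_const (C := ε / (2 * L))
      fun x hx => ?_).trans (le_of_eq (by rw [hlen, abs_of_pos hw]))
    rw [Set.uIoc_of_le hle] at hx
    rw [← dist_eq_norm]
    refine (h _ ⟨by linarith, by linarith⟩ _ ⟨by linarith [hx.1], by linarith [hx.2]⟩ ?_).le
    rw [dist_comm, Real.dist_eq, abs_of_pos (by linarith [hx.1])]
    linarith [hx.2]
  calc _ ≤ ∑ j ∈ Finset.range n, ε / (2 * L) * (L / n) :=
        (norm_sum_le _ _).trans (Finset.sum_le_sum hterm)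
    _ = ε / 2 := by
        rw [Finset.sum_const, Finset.card_range, nsmul_eq_mul]
        field_simp
    _ < ε := by linarith

end RiemannSums

/-! ### Stationary Gaussian processes and integrals with values in `L²` -/

section StationaryGaussian

open scoped InnerProductSpace

variable {Ω : Type*} [MeasurableSpace Ω] {P : Measure Ω} {Y : ℝ → Ω → ℝ} {k : ℝ → ℝ}

/-- A measurable centered stationary Gaussian process of unit variance with continuous correlation
function `k`. -/
structure IsStationaryGaussian (Y : ℝ → Ω → ℝ) (k : ℝ → ℝ) (P : Measure Ω) : Prop where
  isGaussianProcess : IsGaussianProcess Y P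
  integral_eq_zero : ∀ x, ∫ ω, Y x ω ∂P = 0
  integral_mul : ∀ x y, ∫ ω, Y x ω * Y y ω ∂P = k (x - y)
  aemeasurable_uncurry : AEMeasurable (fun p : ℝ × Ω => Y p.1 p.2) (volume.prod P)
  continuous : Continuous k
  zero : k 0 = 1

namespace IsStationaryGaussian

theorem isGaussianVector (hY : IsStationaryGaussian Y k P) {ι : Type*} [Finite ι] (x : ι → ℝ) :
    IsGaussianVector (fun i => Y (x i)) (fun i j => k (x i - x j)) P where
  hasGaussianLaw := by
    classical
    have := Fintype.ofFinite ι
    have h := hY.isGaussianProcess.hasGaussianLaw (Finset.univ.image x)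
    let L : ((Finset.univ.image x) → ℝ) →L[ℝ] (ι → ℝ) := ContinuousLinearMap.pi fun i =>
      ContinuousLinearMap.proj ⟨x i, Finset.mem_image_of_mem x (Finset.mem_univ i)⟩
    exact h.map_fun L
  integral_eq_zero i := hY.integral_eq_zero (x i)
  integral_mul i j := hY.integral_mul (x i) (x j)

theorem isProbabilityMeasure (hY : IsStationaryGaussian Y k P) : IsProbabilityMeasure P :=
  hY.isGaussianProcess.isProbabilityMeasure

theorem diag (hY : IsStationaryGaussian Y k P) (x : ℝ) : k (x - x) = 1 := by
  rw [sub_self, hY.zero]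

theorem even (hY : IsStationaryGaussian Y k P) (t : ℝ) : k (-t) = k t := by
  have h1 := hY.integral_mul 0 t
  have h2 := hY.integral_mul t 0
  rw [zero_sub] at h1
  rw [sub_zero] at h2
  rw [← h1, ← h2]
  simp only [mul_comm]

theorem aemeasurable (hY : IsStationaryGaussian Y k P) (x : ℝ) : AEMeasurable (Y x) P :=
  hY.isGaussianProcess.aemeasurable x

theorem map_eq (hY : IsStationaryGaussian Y k P) (x : ℝ) : P.map (Y x) = gaussianReal 0 1 :=
  (hY.isGaussianVector (fun _ : Unit => x)).map_eq (i := ()) (hY.diag x)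

/-- `Y x` is only almost everywhere measurable; a measurable version is needed to define the
composition operator on `L²`. -/
theorem measurePreserving (hY : IsStationaryGaussian Y k P) (x : ℝ) :
    MeasurePreserving ((hY.aemeasurable x).mk (Y x)) P (gaussianReal 0 1) where
  measurable := (hY.aemeasurable x).measurable_mk
  map_eq := by rw [← Measure.map_congr (hY.aemeasurable x).ae_eq_mk, hY.map_eq]

/-- Composition with the value of the process at `x`, as an isometry of `L²` spaces. -/
noncomputable def compLp (hY : IsStationaryGaussian Y k P) (x : ℝ) :
    Lp ℝ 2 (gaussianReal 0 1) →ₗᵢ[ℝ] Lp ℝ 2 P :=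
  Lp.compMeasurePreservingₗᵢ ℝ _ (hY.measurePreserving x)

theorem memLp_comp (hY : IsStationaryGaussian Y k P) {f : ℝ → ℝ}
    (hf : MemLp f 2 (gaussianReal 0 1)) (x : ℝ) : MemLp (fun ω => f (Y x ω)) 2 P := by
  refine (hf.comp_measurePreserving (hY.measurePreserving x)).ae_eq ?_
  filter_upwards [(hY.aemeasurable x).ae_eq_mk] with ω hω
  rw [Function.comp_apply, ← hω]

theorem compLp_toLp (hY : IsStationaryGaussian Y k P) {f : ℝ → ℝ}
    (hf : MemLp f 2 (gaussianReal 0 1)) (x : ℝ) :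
    hY.compLp x hf.toLp = (hY.memLp_comp hf x).toLp := by
  have h1 : hY.compLp x hf.toLp = (hf.comp_measurePreserving (hY.measurePreserving x)).toLp := rfl
  rw [h1, MemLp.toLp_eq_toLp_iff]
  filter_upwards [(hY.aemeasurable x).ae_eq_mk] with ω hω
  rw [Function.comp_apply, ← hω]

theorem inner_compLp_hermiteLp (hY : IsStationaryGaussian Y k P) (x y : ℝ) (m n : ℕ) :
    ⟪hY.compLp x (hermiteLp m), hY.compLp y (hermiteLp n)⟫_ℝ =
      if m = n then k (x - y) ^ m else 0 := by
  rw [hermiteLp, hermiteLp, hY.compLp_toLp, hY.compLp_toLp, inner_toLp_toLp]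
  have := (hY.isGaussianVector ![x, y]).integral_hermiteH_mul_hermiteH (i := 0) (j := 1)
    (hY.diag _) (hY.diag _) m n
  simpa using this

/-- Cauchy–Schwarz for the Hermite polynomial of degree one. -/
theorem abs_le_one (hY : IsStationaryGaussian Y k P) (t : ℝ) : |k t| ≤ 1 := by
  have h := abs_real_inner_le_norm (hY.compLp t (hermiteLp 1)) (hY.compLp 0 (hermiteLp 1))
  rw [hY.inner_compLp_hermiteLp, LinearIsometry.norm_map, LinearIsometry.norm_map,
    orthonormal_hermiteLp.1 1] at h
  simpa using h

theorem continuous_compLp_hermiteLp (hY : IsStationaryGaussian Y k P) (m : ℕ) :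
    Continuous fun x => hY.compLp x (hermiteLp m) := by
  rw [continuous_iff_continuousAt]
  intro x
  rw [ContinuousAt, tendsto_iff_norm_sub_tendsto_zero]
  have hsq : ∀ y, ‖hY.compLp y (hermiteLp m) - hY.compLp x (hermiteLp m)‖ =
      √(2 - 2 * k (y - x) ^ m) := by
    intro y
    rw [← Real.sqrt_sq (norm_nonneg (hY.compLp y (hermiteLp m) - hY.compLp x (hermiteLp m))),
      norm_sub_sq_real, hY.inner_compLp_hermiteLp, LinearIsometry.norm_map,
      LinearIsometry.norm_map, orthonormal_hermiteLp.1 m, if_pos rfl]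
    congr 1
    ring
  simp only [hsq]
  have hc : Continuous fun y => √(2 - 2 * k (y - x) ^ m) := by
    have := hY.continuous
    fun_prop
  have := hc.tendsto x
  simpa [hY.zero] using this

/-- Composition at every time is an isometry, so the Hermite expansion of `g` converges uniformly in
`x`, and continuity passes from the Hermite polynomials to `g`. It makes the `L²`-valued integral a
limit of Riemann sums. -/
theorem continuous_compLp (hY : IsStationaryGaussian Y k P) (g : Lp ℝ 2 (gaussianReal 0 1)) :
    Continuous fun x => hY.compLp x g := by
  have hsum := hermiteBasis.hasSum_repr g
  have hlim : TendstoUniformly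
      (fun (s : Finset ℕ) x => hY.compLp x (∑ m ∈ s, hermiteBasis.repr g m • hermiteBasis m))
      (fun x => hY.compLp x g) atTop := by
    rw [Metric.tendstoUniformly_iff]
    intro ε hε
    filter_upwards [Metric.tendsto_nhds.1 hsum ε hε] with s hs x
    rwa [(hY.compLp x).dist_map, dist_comm]
  refine hlim.continuous (Frequently.of_forall fun s => ?_)
  simp only [map_sum, map_smul, hermiteBasis_apply]
  exact continuous_finsetSum _ fun m _ =>
    (hY.continuous_compLp_hermiteLp m).fun_const_smul (hermiteBasis.repr g m)

/-- The integral over `[a, b]` of `g` along the process, as a continuous linear map. -/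
noncomputable def integralLp (hY : IsStationaryGaussian Y k P) (a b : ℝ) :
    Lp ℝ 2 (gaussianReal 0 1) →L[ℝ] Lp ℝ 2 P :=
  LinearMap.mkContinuous
    { toFun := fun g => ∫ x in a..b, hY.compLp x g
      map_add' := fun f g => by
        simp only [map_add]
        exact intervalIntegral.integral_add ((hY.continuous_compLp f).intervalIntegrable _ _)
          ((hY.continuous_compLp g).intervalIntegrable _ _)
      map_smul' := fun c g => by
        simp only [map_smul, RingHom.id_apply]
        exact intervalIntegral.integral_smul _ _ } |b - a| fun g => by
    rw [mul_comm]
    exact intervalIntegral.norm_integral_le_of_norm_le_const fun x _ =>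
      ((hY.compLp x).norm_map g).le

theorem integralLp_apply (hY : IsStationaryGaussian Y k P) (a b : ℝ)
    (g : Lp ℝ 2 (gaussianReal 0 1)) : hY.integralLp a b g = ∫ x in a..b, hY.compLp x g := rfl

theorem inner_integralLp (hY : IsStationaryGaussian Y k P) (a b : ℝ)
    (g : Lp ℝ 2 (gaussianReal 0 1)) (ψ : Lp ℝ 2 P) :
    ⟪ψ, hY.integralLp a b g⟫_ℝ = ∫ x in a..b, ⟪ψ, hY.compLp x g⟫_ℝ := by
  rw [integralLp_apply]
  exact ((innerSL ℝ ψ).intervalIntegral_comp_comm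
    ((hY.continuous_compLp g).intervalIntegrable a b)).symm

/-- The variance of the `m`-th Hermite component of an integral functional. -/
noncomputable def _root_.correlationIntegral (k : ℝ → ℝ) (a b : ℝ) (m : ℕ) : ℝ :=
  ∫ x in a..b, ∫ y in a..b, k (x - y) ^ m

theorem inner_integralLp_hermiteLp (hY : IsStationaryGaussian Y k P) (a b : ℝ) (m n : ℕ) :
    ⟪hY.integralLp a b (hermiteLp m), hY.integralLp a b (hermiteLp n)⟫_ℝ =
      if m = n then correlationIntegral k a b m else 0 := by
  rw [real_inner_comm, hY.inner_integralLp]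
  have h1 : ∀ x, ⟪hY.integralLp a b (hermiteLp n), hY.compLp x (hermiteLp m)⟫_ℝ =
      ∫ y in a..b, if m = n then k (x - y) ^ m else 0 := by
    intro x
    rw [real_inner_comm, hY.inner_integralLp]
    simp only [hY.inner_compLp_hermiteLp]
  simp only [h1]
  split_ifs with h
  · rfl
  · simp

theorem inner_hermiteLp_integralLp (hY : IsStationaryGaussian Y k P) (a b : ℝ) (m : ℕ)
    (g : Lp ℝ 2 (gaussianReal 0 1)) :
    ⟪hY.integralLp a b (hermiteLp m), hY.integralLp a b g⟫_ℝ =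
      hermiteBasis.repr g m * correlationIntegral k a b m := by
  have h1 := ((hermiteBasis.hasSum_repr g).mapL (hY.integralLp a b)).mapL
    (innerSL ℝ (hY.integralLp a b (hermiteLp m)))
  have h2 := h1.unique (hasSum_single m fun n hn => ?_)
  · rw [innerSL_apply_apply] at h2
    rw [h2, map_smul, innerSL_apply_apply, hermiteBasis_apply, inner_smul_right,
      inner_integralLp_hermiteLp]
    simp
  · rw [map_smul, innerSL_apply_apply, hermiteBasis_apply, inner_smul_right,
      inner_integralLp_hermiteLp, if_neg (Ne.symm hn), mul_zero]

/-- The integrals of different Hermite polynomials are orthogonal, so the squared norm splits over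
the degrees. -/
theorem hasSum_norm_integralLp_sq (hY : IsStationaryGaussian Y k P) (a b : ℝ)
    (g : Lp ℝ 2 (gaussianReal 0 1)) :
    HasSum (fun m => hermiteBasis.repr g m ^ 2 * correlationIntegral k a b m)
      (‖hY.integralLp a b g‖ ^ 2) := by
  have h1 := ((hermiteBasis.hasSum_repr g).mapL (hY.integralLp a b)).mapL
    (innerSL ℝ (hY.integralLp a b g))
  rw [innerSL_apply_apply, real_inner_self_eq_norm_sq] at h1
  have h2 : ∀ m, innerSL ℝ (hY.integralLp a b g) (hY.integralLp a b
      (hermiteBasis.repr g m • hermiteBasis m)) =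
      hermiteBasis.repr g m ^ 2 * correlationIntegral k a b m := fun m => by
    rw [map_smul, map_smul, innerSL_apply_apply, hermiteBasis_apply, smul_eq_mul,
      real_inner_comm, hY.inner_hermiteLp_integralLp]
    ring
  simpa only [h2] using h1

end IsStationaryGaussian
end StationaryGaussian

/-! ### Integrals along paths -/

section PathIntegral

open scoped InnerProductSpace

variable {Ω : Type*} [MeasurableSpace Ω] {P : Measure Ω} {Y : ℝ → Ω → ℝ} {k : ℝ → ℝ}

/-- Cauchy–Schwarz against the constant `1`, from `∫ (F - c)² ≥ 0` at the mean `c = I / L`. -/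
theorem sq_integral_le_measure_mul_integral_sq {α : Type*} [MeasurableSpace α] {ν : Measure α}
    [IsFiniteMeasure ν] {F : α → ℝ} (h1 : Integrable F ν) (h2 : Integrable (fun x => F x ^ 2) ν) :
    (∫ x, F x ∂ν) ^ 2 ≤ ν.real Set.univ * ∫ x, F x ^ 2 ∂ν := by
  set I := ∫ x, F x ∂ν with hI
  set L := ν.real Set.univ with hL
  have hL0 : 0 ≤ L := measureReal_nonneg
  have key : ∀ c : ℝ, 0 ≤ ∫ x, F x ^ 2 ∂ν - 2 * c * I + c ^ 2 * L := by
    intro c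
    have h3 : ∫ x, (F x - c) ^ 2 ∂ν = ∫ x, F x ^ 2 ∂ν - 2 * c * I + c ^ 2 * L := by
      have : ∀ x, (F x - c) ^ 2 = F x ^ 2 - 2 * c * F x + c ^ 2 := fun x => by ring
      simp only [this]
      rw [integral_add, integral_sub h2 (h1.const_mul _), integral_const_mul, integral_const,
        smul_eq_mul]
      · ring
      · exact h2.sub (h1.const_mul _)
      · exact integrable_const _
    rw [← h3]
    exact integral_nonneg fun x => sq_nonneg _
  rcases hL0.eq_or_lt with h0 | hpos
  · have hν : ν = 0 := by
      rw [← Measure.measure_univ_eq_zero]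
      rw [hL, measureReal_def, eq_comm, ENNReal.toReal_eq_zero_iff] at h0
      exact h0.resolve_right (measure_ne_top _ _)
    simp [hI, hν]
  · have := key (I / L)
    have e : ∫ x, F x ^ 2 ∂ν - 2 * (I / L) * I + (I / L) ^ 2 * L = ∫ x, F x ^ 2 ∂ν - I ^ 2 / L := by
      field_simp
      ring
    rw [e, sub_nonneg, div_le_iff₀ hpos] at this
    linarith

namespace IsStationaryGaussian

variable {f : ℝ → ℝ} {a b : ℝ}

/-- `f` is measurable only up to a Gaussian null set. Every `Y x` is standard Gaussian, so by Fubini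
such null sets pull back to null sets of the product. -/
theorem aestronglyMeasurable_comp_uncurry (hY : IsStationaryGaussian Y k P)
    (hf : MemLp f 2 (gaussianReal 0 1)) (a b : ℝ) :
    AEStronglyMeasurable (fun p : ℝ × Ω => f (Y p.1 p.2))
      ((volume.restrict (Set.Ioc a b)).prod P) := by
  have := hY.isProbabilityMeasure
  have hle : (volume.restrict (Set.Ioc a b)).prod P ≤ volume.prod P :=
    Measure.prod_mono Measure.restrict_le_self le_rfl
  have hYm := hY.aemeasurable_uncurry.mono_measure hle
  refine AEStronglyMeasurable.comp_aemeasurable (hf.aestronglyMeasurable.mono_ac ?_) hYm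
  refine Measure.AbsolutelyContinuous.mk fun s hs h0 => ?_
  rw [Measure.map_apply_of_aemeasurable hYm hs]
  have hae := hYm.ae_eq_mk
  have h1 : ((volume.restrict (Set.Ioc a b)).prod P) (hYm.mk _ ⁻¹' s) = 0 := by
    rw [Measure.measure_prod_null (hYm.measurable_mk hs)]
    filter_upwards [Measure.ae_ae_of_ae_prod hae] with x hx
    have h2 : P (Y x ⁻¹' s) = 0 := by
      rw [← Measure.map_apply_of_aemeasurable (hY.aemeasurable x) hs, hY.map_eq, h0]
    rw [Pi.zero_apply, ← h2]
    refine measure_congr ?_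
    filter_upwards [hx] with ω hω
    change (_ ∈ s) = (_ ∈ s)
    rw [hω]
  rw [← h1]
  refine measure_congr ?_
  filter_upwards [hae] with p hp
  change (Y p.1 p.2 ∈ s) = (_ ∈ s)
  rw [hp]

theorem memLp_comp_uncurry (hY : IsStationaryGaussian Y k P)
    (hf : MemLp f 2 (gaussianReal 0 1)) (a b : ℝ) :
    MemLp (fun p : ℝ × Ω => f (Y p.1 p.2)) 2 ((volume.restrict (Set.Ioc a b)).prod P) := by
  have := hY.isProbabilityMeasure
  have hm := hY.aestronglyMeasurable_comp_uncurry hf a b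
  have hm2 : AEStronglyMeasurable (fun p : ℝ × Ω => f (Y p.1 p.2) ^ 2)
      ((volume.restrict (Set.Ioc a b)).prod P) := hm.pow 2
  rw [memLp_two_iff_integrable_sq hm, integrable_prod_iff hm2]
  refine ⟨ae_of_all _ fun x => (hY.memLp_comp hf x).integrable_sq, ?_⟩
  have : ∀ x, ∫ ω, ‖f (Y x ω) ^ 2‖ ∂P = ∫ y, ‖f y ^ 2‖ ∂(gaussianReal 0 1) := by
    intro x
    rw [← hY.map_eq x, integral_map (hY.aemeasurable x)]
    rw [hY.map_eq]
    exact (hf.aestronglyMeasurable.pow 2).norm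
  simp only [this]
  exact integrable_const _

theorem ae_intervalIntegrable (hY : IsStationaryGaussian Y k P)
    (hf : MemLp f 2 (gaussianReal 0 1)) (hab : a ≤ b) :
    ∀ᵐ ω ∂P, IntervalIntegrable (fun x => f (Y x ω)) volume a b := by
  have := hY.isProbabilityMeasure
  have h := ((hY.memLp_comp_uncurry hf a b).integrable (by norm_num)).prod_left_ae
  filter_upwards [h] with ω hω
  rwa [intervalIntegrable_iff_integrableOn_Ioc_of_le hab]

theorem memLp_integral (hY : IsStationaryGaussian Y k P)
    (hf : MemLp f 2 (gaussianReal 0 1)) (hab : a ≤ b) :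
    MemLp (fun ω => ∫ x in a..b, f (Y x ω)) 2 P := by
  have := hY.isProbabilityMeasure
  have hF := hY.memLp_comp_uncurry hf a b
  have hFi := hF.integrable (by norm_num)
  simp only [intervalIntegral.integral_of_le hab]
  have hm : AEStronglyMeasurable (fun ω => ∫ x in Set.Ioc a b, f (Y x ω)) P :=
    hFi.aestronglyMeasurable.prod_swap.integral_prod_right'
  rw [memLp_two_iff_integrable_sq hm]
  refine (hF.integrable_sq.integral_prod_right.const_mul
    ((volume.restrict (Set.Ioc a b)).real Set.univ)).mono (hm.pow 2) ?_
  filter_upwards [hFi.prod_left_ae, hF.integrable_sq.prod_left_ae] with ω h1 h2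
  rw [Real.norm_of_nonneg (sq_nonneg _)]
  exact (sq_integral_le_measure_mul_integral_sq h1 h2).trans (le_abs_self _)

/-- The integral along the paths represents the `L²`-valued integral. -/
theorem integralLp_toLp (hY : IsStationaryGaussian Y k P)
    (hf : MemLp f 2 (gaussianReal 0 1)) (hab : a ≤ b) :
    hY.integralLp a b hf.toLp = (hY.memLp_integral hf hab).toLp := by
  have := hY.isProbabilityMeasure
  -- Tested against `ψ`, the two integrals differ only by the order of integration, and Fubini
  -- applies.
  refine ext_inner_left ℝ fun ψ => ?_
  have hψ := Lp.memLp ψ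
  have hψ2 : MemLp (fun p : ℝ × Ω => ψ p.2) 2 ((volume.restrict (Set.Ioc a b)).prod P) :=
    hψ.comp_snd _
  have hint := hψ2.integrable_mul (hY.memLp_comp_uncurry hf a b)
  rw [hY.inner_integralLp, ← Lp.toLp_coeFn ψ hψ, inner_toLp_toLp]
  simp only [hY.compLp_toLp, inner_toLp_toLp]
  rw [intervalIntegral.integral_of_le hab, integral_integral_swap hint]
  simp only [integral_const_mul, intervalIntegral.integral_of_le hab]

end IsStationaryGaussian
end PathIntegral

/-! ### Characteristic functions of integral functionals of finite Hermite sums -/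

section IntegralFunctionalCharFun

open Polynomial
open scoped InnerProductSpace

variable {Ω : Type*} [MeasurableSpace Ω] {P : Measure Ω} {Y : ℝ → Ω → ℝ} {k : ℝ → ℝ}

theorem integrable_cexp_mul_I [IsFiniteMeasure P] {X : Ω → ℝ} (hX : AEStronglyMeasurable X P)
    (s : ℝ) : Integrable (fun ω => Complex.exp (s * X ω * Complex.I)) P := by
  have hc : Continuous fun x : ℝ => Complex.exp (s * x * Complex.I) := by fun_prop
  refine (integrable_const (1 : ℝ)).mono' (hc.comp_aestronglyMeasurable hX)
    (ae_of_all _ fun ω => ?_)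
  rw [← Complex.ofReal_mul, Complex.norm_exp_ofReal_mul_I]

theorem integral_abs_le_norm_toLp [IsProbabilityMeasure P] {X : Ω → ℝ} (hX : MemLp X 2 P) :
    ∫ ω, |X ω| ∂P ≤ ‖hX.toLp‖ := by
  have hi : Integrable (fun ω => |X ω|) P := (hX.integrable (by norm_num)).abs
  have hi2 : Integrable (fun ω => |X ω| ^ 2) P := by simpa only [sq_abs] using hX.integrable_sq
  have h := sq_integral_le_measure_mul_integral_sq hi hi2
  rw [probReal_univ, one_mul] at h
  refine abs_le_of_sq_le_sq' (h.trans (le_of_eq ?_)) (norm_nonneg _) |>.2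
  rw [← real_inner_self_eq_norm_sq, inner_toLp_toLp]
  simp only [sq, abs_mul_abs_self]

/-- Characteristic functions are Lipschitz with respect to the `L²` norm. -/
theorem norm_integral_exp_sub_integral_exp_le [IsProbabilityMeasure P] (X Z : Lp ℝ 2 P) (s : ℝ) :
    ‖(∫ ω, Complex.exp (s * X ω * Complex.I) ∂P) - ∫ ω, Complex.exp (s * Z ω * Complex.I) ∂P‖ ≤
      |s| * ‖X - Z‖ := by
  have hX := Lp.memLp X
  have hZ := Lp.memLp Z
  rw [← integral_sub (integrable_cexp_mul_I hX.aestronglyMeasurable s)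
    (integrable_cexp_mul_I hZ.aestronglyMeasurable s)]
  have hi : Integrable (fun ω => |s| * |X ω - Z ω|) P :=
    ((hX.sub hZ).integrable (by norm_num)).abs.const_mul _
  refine (norm_integral_le_of_norm_le hi (ae_of_all _ fun ω => ?_)).trans ?_
  · have h1 : Complex.exp (s * X ω * Complex.I) - Complex.exp (s * Z ω * Complex.I) =
        Complex.exp (s * Z ω * Complex.I) *
          (Complex.exp (Complex.I * ((s * (X ω - Z ω) : ℝ) : ℂ)) - 1) := by
      rw [mul_sub, ← Complex.exp_add, mul_one]
      push_cast
      ring_nf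
    rw [h1, norm_mul, ← Complex.ofReal_mul, Complex.norm_exp_ofReal_mul_I, one_mul, ← abs_mul]
    exact Real.norm_exp_I_mul_ofReal_sub_one_le
  · rw [integral_const_mul]
    refine mul_le_mul_of_nonneg_left ?_ (abs_nonneg s)
    have h2 := integral_abs_le_norm_toLp (hX.sub hZ)
    rwa [MemLp.toLp_sub hX hZ, Lp.toLp_coeFn, Lp.toLp_coeFn] at h2

/-- Each distance `|i - j|` occurs at most once on either side of `i`. -/
theorem sum_range_natAbs_sub_le {F : ℕ → ℝ} (hF : ∀ m, 0 ≤ F m) {i n : ℕ} (hi : i < n) :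
    ∑ j ∈ Finset.range n, F ((i : ℤ) - j).natAbs ≤ 2 * ∑ m ∈ Finset.range n, F m := by
  rw [← Finset.sum_filter_add_sum_filter_not _ (fun j => j ≤ i), two_mul]
  have key : ∀ T : Finset ℕ, T ⊆ Finset.range n → Set.InjOn (fun j : ℕ => ((i : ℤ) - j).natAbs) T →
      ∑ j ∈ T, F ((i : ℤ) - j).natAbs ≤ ∑ m ∈ Finset.range n, F m := by
    intro T hT hinj
    rw [← Finset.sum_image (f := F) hinj]
    refine Finset.sum_le_sum_of_subset_of_nonneg (fun m hm => ?_) fun m _ _ => hF m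
    obtain ⟨j, hj, rfl⟩ := Finset.mem_image.1 hm
    have := Finset.mem_range.1 (hT hj)
    rw [Finset.mem_range]
    lia
  refine add_le_add (key _ (Finset.filter_subset _ _) ?_) (key _ (Finset.filter_subset _ _) ?_)
  · intro x hx y hy hxy
    simp only [Finset.coe_filter, Set.mem_ofPred_eq] at hx hy
    simp only at hxy
    lia
  · intro x hx y hy hxy
    simp only [Finset.coe_filter, Set.mem_ofPred_eq] at hx hy
    simp only at hxy
    lia

/-- The Riemann sum of `2 ∫_0^L |k|^p`. -/
noncomputable def rowSumBound (k : ℝ → ℝ) (L : ℝ) (n p : ℕ) : ℝ :=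
  2 * ∑ m ∈ Finset.range n, L / n * |k (m * (L / n))| ^ p

theorem rowSumBound_nonneg (k : ℝ → ℝ) {L : ℝ} (hL : 0 ≤ L) (n p : ℕ) : 0 ≤ rowSumBound k L n p :=
  mul_nonneg zero_le_two (Finset.sum_nonneg fun _ _ => by positivity)

theorem tendsto_rowSumBound (hk : Continuous k) {L : ℝ} (hL : 0 < L) (p : ℕ) :
    Tendsto (fun n => rowSumBound k L n p) atTop (𝓝 (2 * ∫ t in (0 : ℝ)..L, |k t| ^ p)) := by
  have := (tendsto_riemannSum (hk.abs.pow p) 0 hL).const_mul 2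
  simpa [rowSumBound] using this

namespace IsStationaryGaussian

/-- On a uniform grid stationarity bounds all row sums by twice a one-sided Riemann sum. `Q` is
taken as the sum of all the products it has to dominate. -/
theorem kernelBounds (hY : IsStationaryGaussian Y k P) (a : ℝ) {L : ℝ} (hL : 0 < L) (n d : ℕ) :
    KernelBounds (fun _ : Fin n => L / n)
      (fun i j => |k (a + (i : ℕ) * (L / n) - (a + (j : ℕ) * (L / n)))|) d (rowSumBound k L n)
      (∑ p ∈ Finset.Ioo 0 d, rowSumBound k L n p * rowSumBound k L n (d - p)) where
  weight_nonneg _ := by positivity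
  nonneg _ _ := abs_nonneg _
  le_one _ _ := hY.abs_le_one _
  symm i j := by rw [← hY.even, neg_sub]
  sum_le p i := by
    have hk : ∀ j : ℕ, |k (a + (i : ℕ) * (L / n) - (a + j * (L / n)))| =
        |k ((((i : ℕ) : ℤ) - j).natAbs * (L / n))| := by
      intro j
      have h1 : a + (i : ℕ) * (L / n) - (a + j * (L / n)) =
          ((((i : ℕ) : ℤ) - j : ℤ) : ℝ) * (L / n) := by
        push_cast
        ring
      rw [h1]
      rcases Int.natAbs_eq (((i : ℕ) : ℤ) - j) with h | h
      · conv_lhs => rw [h]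
        rw [Int.cast_natCast]
      · conv_lhs => rw [h]
        rw [Int.cast_neg, Int.cast_natCast, neg_mul, hY.even]
    simp only [hk]
    rw [Fin.sum_univ_eq_sum_range
      (fun j : ℕ => L / n * |k ((((i : ℕ) : ℤ) - j).natAbs * (L / n))| ^ p)]
    exact sum_range_natAbs_sub_le (F := fun m => L / n * |k (m * (L / n))| ^ p)
      (fun m => by positivity) i.2
  mul_le p hp hpd := Finset.single_le_sum
    (f := fun p => rowSumBound k L n p * rowSumBound k L n (d - p))
    (fun _ _ => mul_nonneg (rowSumBound_nonneg k hL.le _ _) (rowSumBound_nonneg k hL.le _ _))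
    (Finset.mem_Ioo.2 ⟨hp, hpd⟩)

theorem memLp_eval_gaussianReal (q : ℝ[X]) : MemLp (fun x => q.eval x) 2 (gaussianReal 0 1) :=
  (hasAllMoments_eval_gaussianReal q).memLp_two

/-- The weighted sum along a uniform grid, as an element of `L²`. -/
theorem toLp_weightedSum (hY : IsStationaryGaussian Y k P) (q : ℝ[X]) (a L : ℝ) (n : ℕ)
    (h : MemLp (fun ω => weightedSum (fun _ : Fin n => L / n) q
      (fun j => Y (a + (j : ℕ) * (L / n)) ω)) 2 P) :
    h.toLp = ∑ j ∈ Finset.range n, (L / n) • hY.compLp (a + j * (L / n))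
      (memLp_eval_gaussianReal q).toLp := by
  simp only [hY.compLp_toLp]
  rw [← Fin.sum_univ_eq_sum_range (fun j : ℕ => (L / n) •
    (hY.memLp_comp (memLp_eval_gaussianReal q) (a + j * (L / n))).toLp)]
  refine Lp.ext ?_
  have h2 : ∀ᵐ ω ∂P, ∀ j : Fin n, ((L / n) • (hY.memLp_comp (memLp_eval_gaussianReal q)
      (a + (j : ℕ) * (L / n))).toLp : Lp ℝ 2 P) ω =
        L / n * q.eval (Y (a + (j : ℕ) * (L / n)) ω) := by
    rw [ae_all_iff]
    intro j
    filter_upwards [Lp.coeFn_smul (L / n : ℝ) (hY.memLp_comp (memLp_eval_gaussianReal q)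
      (a + (j : ℕ) * (L / n))).toLp, (hY.memLp_comp (memLp_eval_gaussianReal q)
      (a + (j : ℕ) * (L / n))).coeFn_toLp] with ω h1 h2
    rw [h1, Pi.smul_apply, h2, smul_eq_mul]
  filter_upwards [h.coeFn_toLp, Lp.coeFn_finsetSum Finset.univ (fun j : Fin n => ((L / n) •
    (hY.memLp_comp (memLp_eval_gaussianReal q) (a + (j : ℕ) * (L / n))).toLp : Lp ℝ 2 P)), h2]
    with ω h1 h2 h3
  rw [h1, h2, weightedSum, Finset.sum_apply]
  exact Finset.sum_congr rfl fun j _ => (h3 j).symm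

/-- The estimate for Gaussian vectors is applied on the grid of `n` points with a constant
independent of `n`, and `n → ∞`. The Riemann sums converge in `L²`, and both their characteristic
functions and their variances are continuous there. -/
theorem exists_norm_integral_exp_integralLp_toLp_sub_le [IsProbabilityMeasure P] {d : ℕ}
    (hd : 2 ≤ d) (S : Finset ℕ) (hS : ∀ n ∈ S, d ≤ n + 1) (c : ℕ → ℝ) :
    ∃ A ≥ 0, ∀ (Y : ℝ → Ω → ℝ) (k : ℝ → ℝ) (hY : IsStationaryGaussian Y k P) (a L : ℝ), 0 < L →
      ∀ s : ℝ, ‖(∫ ω, Complex.exp (s * hY.integralLp a (a + L)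
          (memLp_eval_gaussianReal (hermiteSum S c)).toLp ω * Complex.I) ∂P) -
        Complex.exp (-(s ^ 2 * ‖hY.integralLp a (a + L)
          (memLp_eval_gaussianReal (hermiteSum S c)).toLp‖ ^ 2 : ℝ) / 2)‖ ≤
        s ^ 2 * (A * √(L * (2 * ∫ t in (0 : ℝ)..L, |k t| ^ d) *
          ∑ p ∈ Finset.Ioo 0 d, (2 * ∫ t in (0 : ℝ)..L, |k t| ^ p) *
            (2 * ∫ t in (0 : ℝ)..L, |k t| ^ (d - p)))) := by
  obtain ⟨A, hA, H⟩ := exists_norm_integral_exp_sub_le (P := P) hd S hS c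
  refine ⟨A, hA, fun Y k hY a L hL s => ?_⟩
  set g := (memLp_eval_gaussianReal (hermiteSum S c)).toLp with hg
  set Z : ℕ → Lp ℝ 2 P := fun n => ∑ j ∈ Finset.range n, (L / n) • hY.compLp (a + j * (L / n)) g
    with hZ
  have hZlim : Tendsto Z atTop (𝓝 (hY.integralLp a (a + L) g)) :=
    tendsto_riemannSum (hY.continuous_compLp g) a hL
  have hbound : ∀ n : ℕ, 1 ≤ n → ‖(∫ ω, Complex.exp (s * Z n ω * Complex.I) ∂P) -
      Complex.exp (-(s ^ 2 * ‖Z n‖ ^ 2 : ℝ) / 2)‖ ≤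
      s ^ 2 * (A * √(L * rowSumBound k L n d *
        ∑ p ∈ Finset.Ioo 0 d, rowSumBound k L n p * rowSumBound k L n (d - p))) := by
    intro n hn
    have hn0 : (n : ℝ) ≠ 0 := Nat.cast_ne_zero.2 (by lia)
    have hvec := hY.isGaussianVector (fun j : Fin n => a + (j : ℕ) * (L / n))
    have hmem := (hvec.hasAllMoments_weightedSum (fun _ => L / n) (hermiteSum S c)).memLp_two
    have hZn : hmem.toLp = Z n := hY.toLp_weightedSum _ a L n hmem
    have h1 := H (Fin n) _ _ _ _ _ hvec (fun i => hY.diag _) (hY.kernelBounds a hL n d) s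
    have hsum : ∑ _i : Fin n, L / n = L := by
      rw [Finset.sum_const, Finset.card_univ, Fintype.card_fin, nsmul_eq_mul]
      field_simp
    rw [hsum] at h1
    rw [← hZn, ← real_inner_self_eq_norm_sq, inner_toLp_toLp]
    simp only [sq] at h1 ⊢
    convert h1 using 3
    refine integral_congr_ae ?_
    filter_upwards [hmem.coeFn_toLp] with ω hω
    rw [hω]
  refine le_of_tendsto_of_tendsto ?_ ?_ (eventually_atTop.2 ⟨1, hbound⟩)
  · refine (Tendsto.sub ?_ ?_).norm
    · rw [tendsto_iff_norm_sub_tendsto_zero]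
      have h0 := ((tendsto_iff_norm_sub_tendsto_zero.1 hZlim).const_mul |s|)
      rw [mul_zero] at h0
      exact squeeze_zero (fun _ => norm_nonneg _)
        (fun n => norm_integral_exp_sub_integral_exp_le _ _ s) h0
    · have hc : Continuous fun x : ℝ => Complex.exp (-((s ^ 2 * x ^ 2 : ℝ) : ℂ) / 2) := by fun_prop
      exact (hc.tendsto _).comp hZlim.norm
  · have hR := fun p => tendsto_rowSumBound hY.continuous hL p
    refine ((((hR d).const_mul L).mul (tendsto_finsetSum _ fun p _ =>
      (hR p).mul (hR (d - p)))).sqrt.const_mul A).const_mul _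

theorem exists_norm_integral_exp_integralLp_sub_le [IsProbabilityMeasure P] {d : ℕ}
    (hd : 2 ≤ d) (S : Finset ℕ) (hS : ∀ m ∈ S, d ≤ m) (α : ℕ → ℝ) :
    ∃ A ≥ 0, ∀ (Y : ℝ → Ω → ℝ) (k : ℝ → ℝ) (hY : IsStationaryGaussian Y k P) (a L : ℝ), 0 < L →
      ∀ s : ℝ, ‖(∫ ω, Complex.exp (s * hY.integralLp a (a + L)
          (∑ m ∈ S, α m • hermiteLp m) ω * Complex.I) ∂P) -
        Complex.exp (-(s ^ 2 * ‖hY.integralLp a (a + L) (∑ m ∈ S, α m • hermiteLp m)‖ ^ 2 : ℝ) / 2)‖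
        ≤ s ^ 2 * (A * √(L * (2 * ∫ t in (0 : ℝ)..L, |k t| ^ d) *
          ∑ p ∈ Finset.Ioo 0 d, (2 * ∫ t in (0 : ℝ)..L, |k t| ^ p) *
            (2 * ∫ t in (0 : ℝ)..L, |k t| ^ (d - p)))) := by
  -- `hermiteSum` attaches the coefficient of index `n` to the unnormalized polynomial of degree `n
  -- + 1`, hence the shift and the division by the root of the factorial. The shift is injective on
  -- `S`, whose elements are at least `d ≥ 2`.
  set T := S.image (fun m => m - 1) with hT
  have hT1 : ∀ n ∈ T, d ≤ n + 1 := by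
    intro n hn
    obtain ⟨m, hm, rfl⟩ := Finset.mem_image.1 hn
    have := hS m hm
    lia
  obtain ⟨A, hA, H⟩ := exists_norm_integral_exp_integralLp_toLp_sub_le (P := P) hd T hT1
    (fun n => α (n + 1) / √((n + 1).factorial : ℝ))
  have hg : (memLp_eval_gaussianReal (hermiteSum T
      (fun n => α (n + 1) / √((n + 1).factorial : ℝ)))).toLp = ∑ m ∈ S, α m • hermiteLp m := by
    have h1 : ∀ x, (hermiteSum T (fun n => α (n + 1) / √((n + 1).factorial : ℝ))).eval x =
        ∑ m ∈ S, α m * hermiteH m x := by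
      intro x
      rw [hermiteSum, hT, Finset.sum_image, eval_finsetSum]
      · refine Finset.sum_congr rfl fun m hm => ?_
        have : m - 1 + 1 = m := by have := hS m hm; lia
        rw [eval_mul, eval_C, this, hermiteH_eq]
        ring
      · intro x hx y hy hxy
        have := hS x hx
        have := hS y hy
        simp only at hxy
        lia
    refine Lp.ext ?_
    have h2 : ∀ᵐ x ∂(gaussianReal 0 1), ∀ m,
        (α m • hermiteLp m : Lp ℝ 2 (gaussianReal 0 1)) x = α m * hermiteH m x := by
      rw [ae_all_iff]
      intro m
      filter_upwards [Lp.coeFn_smul (α m) (hermiteLp m), (memLp_hermiteH m).coeFn_toLp] with x h1 h2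
      rw [h1, Pi.smul_apply, hermiteLp, h2, smul_eq_mul]
    filter_upwards [(memLp_eval_gaussianReal (hermiteSum T
      (fun n => α (n + 1) / √((n + 1).factorial : ℝ)))).coeFn_toLp,
      Lp.coeFn_finsetSum S (fun m => (α m • hermiteLp m : Lp ℝ 2 (gaussianReal 0 1))), h2]
      with x e1 e2 e3
    rw [e1, e2, h1, Finset.sum_apply]
    exact Finset.sum_congr rfl fun m _ => (e3 m).symm
  rw [← hg]
  exact ⟨A, hA, H⟩

end IsStationaryGaussian
end IntegralFunctionalCharFun

/-! ### Rescaling of the error bound -/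

section Scaling

variable {ρ : ℝ → ℝ}

theorem integral_abs_comp_div_pow (ρ : ℝ → ℝ) {h : ℝ} (hh : h ≠ 0) (L : ℝ) (p : ℕ) :
    ∫ t in (0 : ℝ)..L, |ρ (t / h)| ^ p = h * ∫ u in (0 : ℝ)..(L / h), |ρ u| ^ p := by
  rw [intervalIntegral.integral_comp_div (fun u => |ρ u| ^ p) hh, zero_div, smul_eq_mul]

/-- The numerator is the error bound for finite Hermite sums without its constant; the denominator
is the lower bound for the variance in degree `d`. Under `u = t / h` the powers of `h` combine so
that the quotient depends on `Λ = L / h` through the ratios `F_p F_{d-p} / (Λ F_d)`. -/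
theorem tendsto_sqrt_integral_div_integral (hρ : Continuous ρ) (hρ1 : ρ 0 = 1) {d : ℕ} {c : ℝ}
    (hc : ∀ t, 2 ≤ t → |ρ t| ^ d ≤ c * t⁻¹) {L : ℝ} (hL : 0 < L) :
    Tendsto (fun h => √(L * (2 * ∫ t in (0 : ℝ)..L, |ρ (t / h)| ^ d) *
      ∑ p ∈ Finset.Ioo 0 d, (2 * ∫ t in (0 : ℝ)..L, |ρ (t / h)| ^ p) *
        (2 * ∫ t in (0 : ℝ)..L, |ρ (t / h)| ^ (d - p))) /
        (L * ∫ t in (0 : ℝ)..(L / 2), |ρ (t / h)| ^ d)) (𝓝[>] 0) (𝓝 0) := by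
  set F : ℕ → ℝ → ℝ := fun p Λ => ∫ u in (0 : ℝ)..Λ, |ρ u| ^ p with hF
  have habs0 : |ρ 0| = 1 := by rw [hρ1, abs_one]
  have hpos : ∀ p Λ, 0 < Λ → 0 < F p Λ := fun p Λ hΛ =>
    integral_pow_pos hρ.abs (fun _ => abs_nonneg _) habs0 p hΛ
  have hΛ : Tendsto (fun h : ℝ => L / h) (𝓝[>] 0) atTop :=
    tendsto_inv_nhdsGT_zero.const_mul_atTop hL
  have hlim : Tendsto (fun Λ => 2 * √(8 * ∑ p ∈ Finset.Ioo 0 d,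
      F p Λ * F (d - p) Λ / (Λ * F d Λ))) atTop (𝓝 0) := by
    have h1 : Tendsto (fun Λ => ∑ p ∈ Finset.Ioo 0 d, F p Λ * F (d - p) Λ / (Λ * F d Λ)) atTop
        (𝓝 0) := by
      rw [← Finset.sum_const_zero (s := Finset.Ioo 0 d) (M := ℝ)]
      refine tendsto_finsetSum (Finset.Ioo 0 d) (fun p hp => ?_)
      obtain ⟨hp0, hpd⟩ := Finset.mem_Ioo.1 hp
      have hsum : p + (d - p) = d := by lia
      have := tendsto_integral_pow_mul_integral_pow hρ.abs (fun _ => abs_nonneg _) habs0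
        (p := p) (q := d - p) hp0 (by lia) (c := c) (by rwa [hsum])
      rwa [hsum] at this
    have h2 := ((h1.const_mul 8).sqrt).const_mul 2
    simpa using h2
  -- The variance bound only sees `[0, L / 2]`. Negligibility of the tail over `[Λ / 2, Λ]` shows
  -- that this loses at most a factor `2`.
  have htail : ∀ᶠ Λ in atTop, F d Λ ≤ 2 * F d (Λ / 2) := by
    have h1 := tendsto_integral_pow_tail hρ.abs (fun _ => abs_nonneg _) habs0 hc
      (ε := 1 / 2) (by norm_num) (by norm_num)
    filter_upwards [h1.eventually_le_const (show (0 : ℝ) < 1 / 2 by norm_num),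
      eventually_gt_atTop 0] with Λ h2 hΛ0
    rw [div_le_iff₀ (hpos d Λ hΛ0)] at h2
    have hi : ∀ a b : ℝ, IntervalIntegrable (fun u => |ρ u| ^ d) volume a b :=
      fun a b => (hρ.abs.pow d).intervalIntegrable a b
    have h3 := intervalIntegral.integral_add_adjacent_intervals (hi 0 (1 / 2 * Λ)) (hi _ Λ)
    have h4 : F d (Λ / 2) = ∫ u in (0 : ℝ)..(1 / 2 * Λ), |ρ u| ^ d := by
      simp only [hF]
      congr 1
      ring
    rw [h4]
    simp only [hF] at h2 ⊢
    linarith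
  refine squeeze_zero' (Eventually.of_forall fun h => ?_) ?_ (hlim.comp hΛ)
  · exact div_nonneg (Real.sqrt_nonneg _) (mul_nonneg hL.le
      (intervalIntegral.integral_nonneg (by positivity) fun _ _ => by positivity))
  filter_upwards [hΛ.eventually htail, self_mem_nhdsWithin] with h h1 h0
  have h0 : 0 < h := h0
  have hΛ0 : 0 < L / h := by positivity
  simp only [integral_abs_comp_div_pow ρ h0.ne', Function.comp_apply]
  change √(L * (2 * (h * F d (L / h))) * ∑ p ∈ Finset.Ioo 0 d, (2 * (h * F p (L / h))) *
    (2 * (h * F (d - p) (L / h)))) / (L * (h * F d (L / 2 / h))) ≤ _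
  have hFd := hpos d _ hΛ0
  have hlow : L * h * F d (L / h) / 2 ≤ L * (h * F d (L / 2 / h)) := by
    rw [show L / 2 / h = L / h / 2 by ring]
    have := mul_le_mul_of_nonneg_left h1 (mul_pos hL h0).le
    nlinarith
  have hS : L * (2 * (h * F d (L / h))) * ∑ p ∈ Finset.Ioo 0 d, (2 * (h * F p (L / h))) *
      (2 * (h * F (d - p) (L / h))) = (L * h * F d (L / h)) ^ 2 * (8 * ∑ p ∈ Finset.Ioo 0 d,
        F p (L / h) * F (d - p) (L / h) / (L / h * F d (L / h))) := by
    rw [Finset.mul_sum, Finset.mul_sum, Finset.mul_sum]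
    refine Finset.sum_congr rfl fun p _ => ?_
    field_simp
    ring
  rw [hS, Real.sqrt_mul (sq_nonneg _), Real.sqrt_sq (by positivity)]
  refine (div_le_div_of_nonneg_left (by positivity) (by positivity) hlow).trans (le_of_eq ?_)
  field_simp

end Scaling

/-! ### The double integral of a power of the correlation -/

section CorrelationIntegral

variable {k : ℝ → ℝ}

theorem continuous_integral_comp_sub_pow (hk : Continuous k) (a b : ℝ) (m : ℕ) :
    Continuous fun x => ∫ y in a..b, k (x - y) ^ m := by
  refine intervalIntegral.continuous_parametric_intervalIntegral_of_continuous' ?_ a b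
  fun_prop

/-- From any point of `[a, a + L]` the interval extends at least `L / 2` to one side. By evenness of
`k` the side is irrelevant, and as `d` is even the rest contributes nonnegatively. -/
theorem mul_integral_le_correlationIntegral (hk : Continuous k) (hk1 : ∀ t, k (-t) = k t) {d : ℕ}
    (hd : Even d) (a : ℝ) {L : ℝ} (hL : 0 ≤ L) :
    L * ∫ t in (0 : ℝ)..(L / 2), |k t| ^ d ≤ correlationIntegral k a (a + L) d := by
  have hpow : ∀ t, |k t| ^ d = k t ^ d := fun t => hd.pow_abs (k t)
  simp only [hpow]
  have hi : ∀ x y : ℝ, IntervalIntegrable (fun u => k u ^ d) volume x y :=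
    fun x y => (hk.pow d).intervalIntegrable x y
  have hmono : ∀ {x y x' y' : ℝ}, x' ≤ x → x ≤ y → y ≤ y' →
      ∫ u in x..y, k u ^ d ≤ ∫ u in x'..y', k u ^ d := fun h1 h2 h3 =>
    intervalIntegral.integral_mono_interval h1 h2 h3
      (ae_of_all _ fun u => hd.pow_nonneg (k u)) (hi _ _)
  have hneg : ∫ u in (-(L / 2))..0, k u ^ d = ∫ u in (0 : ℝ)..(L / 2), k u ^ d := by
    rw [← neg_zero, ← intervalIntegral.integral_comp_neg]
    simp [hk1]
  have hinner : ∀ x ∈ Set.Icc a (a + L),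
      ∫ t in (0 : ℝ)..(L / 2), k t ^ d ≤ ∫ y in a..(a + L), k (x - y) ^ d := by
    intro x hx
    rw [intervalIntegral.integral_comp_sub_left (fun u => k u ^ d)]
    rcases le_total (x - a) (L / 2) with h | h
    · rw [← hneg]
      exact hmono (by linarith) (by linarith) (by linarith [hx.1])
    · exact hmono (by linarith [hx.2]) (by linarith) h
  calc L * ∫ t in (0 : ℝ)..(L / 2), k t ^ d
      = ∫ _x in a..(a + L), ∫ t in (0 : ℝ)..(L / 2), k t ^ d := by
        rw [intervalIntegral.integral_const, smul_eq_mul]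
        ring
    _ ≤ _ := intervalIntegral.integral_mono_on (by linarith) intervalIntegrable_const
        ((continuous_integral_comp_sub_pow hk _ _ _).intervalIntegrable _ _) hinner

theorem correlationIntegral_le (hk : Continuous k) (hk1 : ∀ t, |k t| ≤ 1) {d m : ℕ} (hd : Even d)
    (hdm : d ≤ m) {a b : ℝ} (hab : a ≤ b) :
    correlationIntegral k a b m ≤ correlationIntegral k a b d := by
  refine intervalIntegral.integral_mono_on hab
    ((continuous_integral_comp_sub_pow hk _ _ _).intervalIntegrable _ _)
    ((continuous_integral_comp_sub_pow hk _ _ _).intervalIntegrable _ _) fun x _ => ?_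
  refine intervalIntegral.integral_mono_on hab
    ((by fun_prop : Continuous fun y => k (x - y) ^ m).intervalIntegrable _ _)
    ((by fun_prop : Continuous fun y => k (x - y) ^ d).intervalIntegrable _ _) fun y _ => ?_
  rw [← hd.pow_abs (k (x - y))]
  refine (le_abs_self _).trans ?_
  rw [abs_pow]
  exact pow_le_pow_of_le_one (abs_nonneg _) (hk1 _) hdm

theorem correlationIntegral_pos (hk : Continuous k) (hk1 : ∀ t, k (-t) = k t) (hk0 : k 0 = 1)
    {d : ℕ} (hd : Even d) {a b : ℝ} (hab : a < b) : 0 < correlationIntegral k a b d := by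
  have h1 := mul_integral_le_correlationIntegral hk hk1 hd a (sub_nonneg.2 hab.le)
  rw [add_sub_cancel] at h1
  refine lt_of_lt_of_le (mul_pos (sub_pos.2 hab) ?_) h1
  exact integral_pow_pos hk.abs (fun _ => abs_nonneg _) (by rw [hk0, abs_one]) d
    (half_pos (sub_pos.2 hab))

end CorrelationIntegral

/-! ### The central limit theorem for characteristic functions -/

section CentralLimit

open scoped InnerProductSpace

variable {Ω : Type*} [MeasurableSpace Ω] {P : Measure Ω} {Y : ℝ → Ω → ℝ} {k : ℝ → ℝ}

namespace IsStationaryGaussian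

theorem correlationIntegral_nonneg (hY : IsStationaryGaussian Y k P) (a b : ℝ) (m : ℕ) :
    0 ≤ correlationIntegral k a b m := by
  have h := hY.inner_integralLp_hermiteLp a b m m
  rw [if_pos rfl, real_inner_self_eq_norm_sq] at h
  rw [← h]
  positivity

theorem abs_repr_mul_sqrt_le_norm_integralLp (hY : IsStationaryGaussian Y k P) (a b : ℝ)
    (g : Lp ℝ 2 (gaussianReal 0 1)) (m : ℕ) :
    |hermiteBasis.repr g m| * √(correlationIntegral k a b m) ≤ ‖hY.integralLp a b g‖ := by
  have h := le_hasSum (hY.hasSum_norm_integralLp_sq a b g) m fun n _ =>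
    mul_nonneg (sq_nonneg _) (hY.correlationIntegral_nonneg a b n)
  refine abs_le_of_sq_le_sq' ?_ (norm_nonneg _) |>.2
  rwa [mul_pow, sq_abs, Real.sq_sqrt (hY.correlationIntegral_nonneg a b m)]

/-- Degree `d` has the largest correlation integral among all degrees from `d` on. Together with the
lower bound through a single coefficient, this makes the truncation error relative to the standard
deviation uniform in the process. -/
theorem norm_integralLp_le (hY : IsStationaryGaussian Y k P) {a b : ℝ} (hab : a ≤ b) {d : ℕ}
    (hd : Even d) {g : Lp ℝ 2 (gaussianReal 0 1)} (hg : ∀ m < d, hermiteBasis.repr g m = 0) :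
    ‖hY.integralLp a b g‖ ≤ ‖g‖ * √(correlationIntegral k a b d) := by
  refine abs_le_of_sq_le_sq' ?_ (by positivity) |>.2
  rw [mul_pow, Real.sq_sqrt (hY.correlationIntegral_nonneg a b d)]
  have h1 : HasSum (fun m => hermiteBasis.repr g m ^ 2) (‖g‖ ^ 2) := by
    have := lp.hasSum_norm (p := 2) (by norm_num) (hermiteBasis.repr g)
    simpa using this
  refine hasSum_le (fun m => ?_) (hY.hasSum_norm_integralLp_sq a b g)
    (h1.mul_right (correlationIntegral k a b d))
  rcases lt_or_ge m d with h | h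
  · simp [hg m h]
  · exact mul_le_mul_of_nonneg_left (correlationIntegral_le hY.continuous hY.abs_le_one hd h hab)
      (sq_nonneg _)

end IsStationaryGaussian

theorem norm_normalize_sub_normalize_le {E : Type*} [NormedAddCommGroup E] [NormedSpace ℝ E]
    {x y : E} (hx : x ≠ 0) (hy : y ≠ 0) : ‖‖x‖⁻¹ • x - ‖y‖⁻¹ • y‖ ≤ 2 * ‖x - y‖ / ‖x‖ := by
  have hx0 := norm_pos_iff.2 hx
  have hy0 := norm_pos_iff.2 hy
  have h1 : ‖x‖⁻¹ • x - ‖y‖⁻¹ • y = ‖x‖⁻¹ • ((x - y) + ((‖y‖ - ‖x‖) * ‖y‖⁻¹) • y) := by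
    have e : ‖y‖⁻¹ = ‖x‖⁻¹ * (1 - (‖y‖ - ‖x‖) * ‖y‖⁻¹) := by
      field_simp
      ring
    conv_lhs => rw [e]
    rw [mul_smul, ← smul_sub, sub_smul, one_smul]
    congr 1
    abel
  rw [h1, norm_smul, norm_inv, norm_norm, div_eq_inv_mul]
  refine mul_le_mul_of_nonneg_left ?_ (by positivity)
  refine (norm_add_le _ _).trans ?_
  rw [norm_smul, norm_mul, norm_inv, norm_norm, mul_assoc, inv_mul_cancel₀ hy0.ne', mul_one,
    two_mul, Real.norm_eq_abs, abs_sub_comm]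
  exact add_le_add_right (abs_norm_sub_norm_le x y) _

theorem integral_exp_mul_smul (X : Lp ℝ 2 P) (t c : ℝ) :
    ∫ ω, Complex.exp (t * (c • X : Lp ℝ 2 P) ω * Complex.I) ∂P =
      ∫ ω, Complex.exp ((t * c : ℝ) * X ω * Complex.I) ∂P := by
  refine integral_congr_ae ?_
  filter_upwards [Lp.coeFn_smul c X] with ω hω
  rw [hω, Pi.smul_apply, smul_eq_mul]
  push_cast
  ring_nf

theorem repr_sum_smul_hermiteLp (S : Finset ℕ) (α : ℕ → ℝ) (m : ℕ) :
    hermiteBasis.repr (∑ n ∈ S, α n • hermiteLp n) m = if m ∈ S then α m else 0 := by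
  rw [hermiteBasis.repr_apply_apply, hermiteBasis_apply, inner_sum]
  simp only [inner_smul_right, orthonormal_iff_ite.1 orthonormal_hermiteLp]
  simp

/-- The central limit theorem for integral functionals of rescaled stationary Gaussian processes,
in terms of characteristic functions. -/
theorem eventually_norm_integral_exp_normalize_sub_le [IsProbabilityMeasure P] {ρ : ℝ → ℝ}
    (hρ : Continuous ρ) (hρ1 : ρ 0 = 1) {d : ℕ} (hd : 2 ≤ d) (hde : Even d) {c : ℝ}
    (hc : ∀ t, 2 ≤ t → |ρ t| ^ d ≤ c * t⁻¹) (a : ℝ) {L : ℝ} (hL : 0 < L)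
    {g : Lp ℝ 2 (gaussianReal 0 1)} (hg : ∀ m < d, hermiteBasis.repr g m = 0)
    (hgd : hermiteBasis.repr g d ≠ 0) (t : ℝ) {ε : ℝ} (hε : 0 < ε) :
    ∀ᶠ h in 𝓝[>] (0 : ℝ), ∀ (Y : ℝ → Ω → ℝ) (hY : IsStationaryGaussian Y (fun t => ρ (t / h)) P),
      ‖(∫ ω, Complex.exp (t * (‖hY.integralLp a (a + L) g‖⁻¹ • hY.integralLp a (a + L) g :
        Lp ℝ 2 P) ω * Complex.I) ∂P) - Complex.exp (-(t ^ 2 : ℝ) / 2)‖ ≤ ε := by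
  set α : ℕ → ℝ := fun m => hermiteBasis.repr g m with hα
  have hαd : 0 < |α d| := abs_pos.2 hgd
  -- The truncation is fixed before `h`. The division by `|α d|` anticipates the common lower bound
  -- `|α d| * √V` for both norms, in which `√V` cancels.
  obtain ⟨S, hdS, hS, hSg⟩ : ∃ S : Finset ℕ, d ∈ S ∧ (∀ m ∈ S, d ≤ m) ∧
      |t| * (2 * (‖g - ∑ m ∈ S, α m • hermiteLp m‖ / |α d|)) ≤ ε / 2 := by
    have h1 : Tendsto (fun s : Finset ℕ => |t| * (2 * (‖g - ∑ m ∈ s, α m • hermiteLp m‖ / |α d|)))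
        atTop (𝓝 0) := by
      have h2 := hermiteBasis.hasSum_repr g
      simp only [hermiteBasis_apply] at h2
      have h3 := ((((tendsto_const_nhds (x := g)).sub h2).norm.div_const |α d|).const_mul
        2).const_mul |t|
      simpa using h3
    obtain ⟨s, hs, hds⟩ := ((h1.eventually_le_const (half_pos hε)).and
      (eventually_ge_atTop {d})).exists
    refine ⟨s.filter (d ≤ ·), by simpa using hds, fun m hm => (Finset.mem_filter.1 hm).2, ?_⟩
    rwa [Finset.sum_filter_of_ne]
    intro m _ hm
    by_contra hlt
    exact hm (by rw [hα]; simp only; rw [hg m (not_le.1 hlt), zero_smul])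
  set g' := ∑ m ∈ S, α m • hermiteLp m with hg'
  obtain ⟨A, hA, H⟩ := IsStationaryGaussian.exists_norm_integral_exp_integralLp_sub_le (P := P)
    hd S hS α
  have hlim := ((tendsto_sqrt_integral_div_integral hρ hρ1 hc hL).const_mul (t ^ 2 / α d ^ 2 * A))
  rw [mul_zero] at hlim
  filter_upwards [hlim.eventually_le_const (half_pos hε), self_mem_nhdsWithin] with h h1 hh Y hY
  have hh : 0 < h := hh
  set V := correlationIntegral (fun t => ρ (t / h)) a (a + L) d with hV
  have hVpos : 0 < V := correlationIntegral_pos hY.continuous hY.even hY.zero hde (by linarith)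
  set X := hY.integralLp a (a + L) g with hX
  set X' := hY.integralLp a (a + L) g' with hX'
  have hlow : |α d| * √V ≤ ‖X‖ := hY.abs_repr_mul_sqrt_le_norm_integralLp a (a + L) g d
  have hlow' : |α d| * √V ≤ ‖X'‖ := by
    have := hY.abs_repr_mul_sqrt_le_norm_integralLp a (a + L) g' d
    rwa [repr_sum_smul_hermiteLp, if_pos hdS] at this
  have hXpos : 0 < ‖X‖ := lt_of_lt_of_le (by positivity) hlow
  have hXpos' : 0 < ‖X'‖ := lt_of_lt_of_le (by positivity) hlow'
  have hdiff : ‖X - X'‖ ≤ ‖g - g'‖ * √V := by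
    rw [hX, hX', ← map_sub]
    refine hY.norm_integralLp_le (by linarith) hde fun m hm => ?_
    rw [map_sub, lp.coeFn_sub, Pi.sub_apply, hg m hm, repr_sum_smul_hermiteLp, if_neg, sub_zero]
    exact fun hmS => absurd (hS m hmS) (not_le.2 hm)
  -- Truncation: each side is divided by its own norm, which costs the factor `2`.
  have step1 : ‖(∫ ω, Complex.exp (t * (‖X‖⁻¹ • X : Lp ℝ 2 P) ω * Complex.I) ∂P) -
      ∫ ω, Complex.exp (t * (‖X'‖⁻¹ • X' : Lp ℝ 2 P) ω * Complex.I) ∂P‖ ≤ ε / 2 := by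
    refine (norm_integral_exp_sub_integral_exp_le _ _ t).trans (le_trans ?_ hSg)
    refine mul_le_mul_of_nonneg_left ?_ (abs_nonneg t)
    refine (norm_normalize_sub_normalize_le (norm_pos_iff.1 hXpos) (norm_pos_iff.1 hXpos')).trans ?_
    rw [mul_div_assoc]
    refine mul_le_mul_of_nonneg_left ?_ zero_le_two
    rw [div_le_div_iff₀ hXpos hαd]
    calc ‖X - X'‖ * |α d| ≤ ‖g - g'‖ * √V * |α d| := by gcongr
      _ = ‖g - g'‖ * (|α d| * √V) := by ring
      _ ≤ ‖g - g'‖ * ‖X‖ := by gcongr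
  -- The finite Hermite sum is treated at frequency `t * ‖X'‖⁻¹`, which makes the comparison
  -- Gaussian standard. The factor `‖X'‖⁻¹ ^ 2` from the Stein bound is paid for by the lower bound
  -- on the variance.
  have step2 : ‖(∫ ω, Complex.exp (t * (‖X'‖⁻¹ • X' : Lp ℝ 2 P) ω * Complex.I) ∂P) -
      Complex.exp (-(t ^ 2 : ℝ) / 2)‖ ≤ ε / 2 := by
    have h2 := H Y _ hY a L hL (t * ‖X'‖⁻¹)
    rw [integral_exp_mul_smul]
    have h3 : (t * ‖X'‖⁻¹) ^ 2 * ‖X'‖ ^ 2 = t ^ 2 := by field_simp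
    rw [← hg', ← hX', h3] at h2
    refine h2.trans (le_trans ?_ h1)
    have hDpos : 0 < ∫ t in (0 : ℝ)..(L / 2), |ρ (t / h)| ^ d :=
      integral_pow_pos (hY.continuous.abs) (fun _ => abs_nonneg _) (by rw [hY.zero, abs_one]) d
        (by positivity)
    have hVlow := mul_integral_le_correlationIntegral hY.continuous hY.even hde a hL.le
    have h4 : ‖X'‖⁻¹ ^ 2 ≤ (α d ^ 2 * (L * ∫ t in (0 : ℝ)..(L / 2), |ρ (t / h)| ^ d))⁻¹ := by
      rw [inv_pow]
      refine inv_anti₀ (mul_pos (by positivity) (by positivity)) ?_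
      calc α d ^ 2 * (L * ∫ t in (0 : ℝ)..(L / 2), |ρ (t / h)| ^ d) ≤ α d ^ 2 * V := by gcongr
        _ = (|α d| * √V) ^ 2 := by rw [mul_pow, sq_abs, Real.sq_sqrt hVpos.le]
        _ ≤ ‖X'‖ ^ 2 := by gcongr
    rw [mul_pow]
    refine (mul_le_mul_of_nonneg_right (mul_le_mul_of_nonneg_left h4 (sq_nonneg t))
      (by positivity)).trans (le_of_eq ?_)
    rw [mul_inv]
    ring
  calc _ ≤ _ := norm_sub_le_norm_sub_add_norm_sub _
        (∫ ω, Complex.exp (t * (‖X'‖⁻¹ • X' : Lp ℝ 2 P) ω * Complex.I) ∂P) _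
    _ ≤ ε / 2 + ε / 2 := add_le_add step1 step2
    _ = ε := by ring

end CentralLimit

/-! ### Mean, variance and standardization of path functionals -/

section CenteredFunctional

open scoped InnerProductSpace

variable {Ω : Type*} [MeasurableSpace Ω] {P : Measure Ω} {Y : ℝ → Ω → ℝ} {k : ℝ → ℝ} {f : ℝ → ℝ}

theorem memLp_sub_integral (hf : MemLp f 2 (gaussianReal 0 1)) :
    MemLp (fun x => f x - ∫ y, f y ∂(gaussianReal 0 1)) 2 (gaussianReal 0 1) :=
  hf.sub (memLp_const _)

theorem hermiteH_zero (x : ℝ) : hermiteH 0 x = 1 := by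
  simp [hermiteH]

theorem toLp_sub_integral (hf : MemLp f 2 (gaussianReal 0 1)) :
    (memLp_sub_integral hf).toLp =
      hf.toLp - (∫ y, f y ∂(gaussianReal 0 1)) • hermiteLp 0 := by
  rw [hermiteLp, ← MemLp.toLp_const_smul, ← MemLp.toLp_sub hf, MemLp.toLp_eq_toLp_iff]
  refine ae_of_all _ fun x => ?_
  simp [hermiteH_zero]

theorem repr_toLp_sub_integral_zero (hf : MemLp f 2 (gaussianReal 0 1)) :
    hermiteBasis.repr (memLp_sub_integral hf).toLp 0 = 0 := by
  rw [hermiteBasis_repr_toLp, hermiteCoeff]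
  simp only [hermiteH_zero, mul_one]
  rw [integral_sub (hf.integrable (by norm_num)) (integrable_const _)]
  simp

theorem repr_toLp_sub_integral_of_ne_zero (hf : MemLp f 2 (gaussianReal 0 1)) {m : ℕ}
    (hm : m ≠ 0) : hermiteBasis.repr (memLp_sub_integral hf).toLp m = hermiteCoeff f m := by
  rw [toLp_sub_integral hf, map_sub, lp.coeFn_sub, Pi.sub_apply, hermiteBasis_repr_toLp hf,
    map_smul, lp.coeFn_smul, Pi.smul_apply, hermiteBasis.repr_apply_apply, hermiteBasis_apply,
    orthonormal_iff_ite.1 orthonormal_hermiteLp, if_neg hm, smul_zero, sub_zero]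

namespace IsStationaryGaussian

variable {a b : ℝ}

theorem coeFn_integralLp_sub_integral (hY : IsStationaryGaussian Y k P)
    (hf : MemLp f 2 (gaussianReal 0 1)) (hab : a ≤ b) :
    (hY.integralLp a b (memLp_sub_integral hf).toLp : Ω → ℝ) =ᵐ[P]
      fun ω => (∫ x in a..b, f (Y x ω)) - (b - a) * ∫ y, f y ∂(gaussianReal 0 1) := by
  rw [hY.integralLp_toLp (memLp_sub_integral hf) hab]
  filter_upwards [(hY.memLp_integral (memLp_sub_integral hf) hab).coeFn_toLp,
    hY.ae_intervalIntegrable hf hab] with ω h1 h2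
  rw [h1, intervalIntegral.integral_sub h2 intervalIntegrable_const,
    intervalIntegral.integral_const, smul_eq_mul]

/-- The integral of `H_0 = 1` is the constant `b - a`, and its inner product with the centred
functional is a multiple of the coefficient of degree `0`, which is zero. -/
theorem integral_integral (hY : IsStationaryGaussian Y k P)
    (hf : MemLp f 2 (gaussianReal 0 1)) (hab : a < b) :
    ∫ ω, (∫ x in a..b, f (Y x ω)) ∂P = (b - a) * ∫ y, f y ∂(gaussianReal 0 1) := by
  have := hY.isProbabilityMeasure
  have h1 := hY.inner_hermiteLp_integralLp a b 0 (memLp_sub_integral hf).toLp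
  rw [repr_toLp_sub_integral_zero hf, zero_mul, hermiteLp, hY.integralLp_toLp _ hab.le,
    hY.integralLp_toLp _ hab.le, inner_toLp_toLp] at h1
  simp only [hermiteH_zero, intervalIntegral.integral_const, smul_eq_mul, mul_one] at h1
  rw [integral_const_mul, mul_eq_zero] at h1
  have h2 := h1.resolve_left (sub_pos.2 hab).ne'
  have h3 : ∫ ω, (∫ x in a..b, (f (Y x ω) - ∫ y, f y ∂(gaussianReal 0 1))) ∂P =
      ∫ ω, ((∫ x in a..b, f (Y x ω)) - (b - a) * ∫ y, f y ∂(gaussianReal 0 1)) ∂P := by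
    refine integral_congr_ae ?_
    filter_upwards [hY.ae_intervalIntegrable hf hab.le] with ω h
    rw [intervalIntegral.integral_sub h intervalIntegrable_const,
      intervalIntegral.integral_const, smul_eq_mul]
  rw [h3, integral_sub ((hY.memLp_integral hf hab.le).integrable (by norm_num))
    (integrable_const _), integral_const, probReal_univ, one_smul] at h2
  linarith

theorem variance_integral (hY : IsStationaryGaussian Y k P)
    (hf : MemLp f 2 (gaussianReal 0 1)) (hab : a < b) :
    Var[fun ω => ∫ x in a..b, f (Y x ω); P] =
      ‖hY.integralLp a b (memLp_sub_integral hf).toLp‖ ^ 2 := by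
  have := hY.isProbabilityMeasure
  rw [variance_eq_integral (hY.memLp_integral hf hab.le).aestronglyMeasurable.aemeasurable,
    hY.integral_integral hf hab, ← real_inner_self_eq_norm_sq, L2.inner_def]
  refine integral_congr_ae ?_
  filter_upwards [hY.coeFn_integralLp_sub_integral hf hab.le] with ω h
  rw [h, real_inner_self_eq_norm_sq, Real.norm_eq_abs, sq_abs]

/-- The standardized path functional represents the normalized `L²`-valued integral. -/
theorem coeFn_normalize_integralLp (hY : IsStationaryGaussian Y k P)
    (hf : MemLp f 2 (gaussianReal 0 1)) (hab : a < b) :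
    ((‖hY.integralLp a b (memLp_sub_integral hf).toLp‖⁻¹ •
      hY.integralLp a b (memLp_sub_integral hf).toLp : Lp ℝ 2 P) : Ω → ℝ) =ᵐ[P]
      fun ω => ((∫ x in a..b, f (Y x ω)) - (b - a) * ∫ y, f y ∂(gaussianReal 0 1)) /
        √(Var[fun ω => ∫ x in a..b, f (Y x ω); P]) := by
  filter_upwards [hY.coeFn_integralLp_sub_integral hf hab.le, Lp.coeFn_smul
    ‖hY.integralLp a b (memLp_sub_integral hf).toLp‖⁻¹
    (hY.integralLp a b (memLp_sub_integral hf).toLp)] with ω h1 h2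
  rw [h2, Pi.smul_apply, h1, hY.variance_integral hf hab, Real.sqrt_sq (norm_nonneg _), smul_eq_mul,
    div_eq_inv_mul]

theorem variance_integral_pos (hY : IsStationaryGaussian Y k P)
    (hf : MemLp f 2 (gaussianReal 0 1)) (hab : a < b) {d : ℕ} (hd : Even d) (hd0 : d ≠ 0)
    (hfd : hermiteCoeff f d ≠ 0) : 0 < Var[fun ω => ∫ x in a..b, f (Y x ω); P] := by
  rw [hY.variance_integral hf hab]
  have h1 := hY.abs_repr_mul_sqrt_le_norm_integralLp a b (memLp_sub_integral hf).toLp d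
  have h2 := correlationIntegral_pos hY.continuous hY.even hY.zero hd hab
  rw [repr_toLp_sub_integral_of_ne_zero hf hd0] at h1
  have := abs_pos.2 hfd
  have : 0 < ‖hY.integralLp a b (memLp_sub_integral hf).toLp‖ := lt_of_lt_of_le (by positivity) h1
  positivity

end IsStationaryGaussian
end CenteredFunctional

/-! ### Normalized increments as a stationary Gaussian process -/

section Increments

variable {Ω : Type*} [MeasurableSpace Ω] {P : Measure Ω} {G : ℝ → Ω → ℝ} {σ2 : ℝ → ℝ} {r : ℝ}

namespace IsCenteredGaussianWithIncrVar

theorem incrVar_neg (hG : IsCenteredGaussianWithIncrVar G P σ2) (t : ℝ) : σ2 (-t) = σ2 t := by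
  rw [← zero_sub, ← hG.integral_sq_incr, ← sub_zero t, ← hG.integral_sq_incr, sub_zero]
  refine integral_congr_ae (ae_of_all _ fun ω => ?_)
  ring

theorem incrVar_eq (hG : IsCenteredGaussianWithIncrVar G P σ2)
    (hσ : ∀ h : ℝ, 0 ≤ h → σ2 h = h ^ r) (t : ℝ) : σ2 t = |t| ^ r := by
  rcases le_total 0 t with h | h
  · rw [abs_of_nonneg h, hσ t h]
  · rw [abs_of_nonpos h, ← hG.incrVar_neg, hσ _ (by linarith)]

theorem memLp_two (hG : IsCenteredGaussianWithIncrVar G P σ2) (x : ℝ) : MemLp (G x) 2 P :=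
  (hG.isGaussianProcess.hasGaussianLaw_eval x).memLp_two

/-- By polarization a product of two increments is a combination of four squared increments, so the
variance function determines the covariances of increments. -/
theorem integral_incr_mul_incr (hG : IsCenteredGaussianWithIncrVar G P σ2) (x y h : ℝ) :
    ∫ ω, (G (x + h) ω - G x ω) * (G (y + h) ω - G y ω) ∂P =
      (σ2 (x - y + h) + σ2 (x - y - h) - 2 * σ2 (x - y)) / 2 := by
  have hi : ∀ u v, Integrable (fun ω => (G u ω - G v ω) ^ 2) P := fun u v =>
    ((hG.memLp_two u).sub (hG.memLp_two v)).integrable_sq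
  have h1 : ∀ ω, (G (x + h) ω - G x ω) * (G (y + h) ω - G y ω) =
      (((G (x + h) ω - G y ω) ^ 2 + (G x ω - G (y + h) ω) ^ 2) -
        ((G (x + h) ω - G (y + h) ω) ^ 2 + (G x ω - G y ω) ^ 2)) / 2 := fun ω => by ring
  simp only [h1]
  rw [integral_div, integral_sub, integral_add (hi _ _) (hi _ _), integral_add (hi _ _) (hi _ _)]
  · simp only [hG.integral_sq_incr]
    ring_nf
  · exact (hi _ _).add (hi _ _)
  · exact (hi _ _).add (hi _ _)

theorem isStationaryGaussian_normIncr [IsProbabilityMeasure P]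
    (hG : IsCenteredGaussianWithIncrVar G P σ2)
    (hr : 0 < r) (hσ : ∀ h : ℝ, 0 ≤ h → σ2 h = h ^ r) {h : ℝ} (hh : h ≠ 0) :
    IsStationaryGaussian (normIncr G σ2 h) (fun t => fracKernel r (t / h)) P where
  isGaussianProcess := by
    classical
    refine hG.isGaussianProcess.of_isGaussianProcess fun x => ⟨{x, x + h},
      (√(σ2 h))⁻¹ • (ContinuousLinearMap.proj ⟨x + h, by simp⟩ -
        ContinuousLinearMap.proj ⟨x, by simp⟩), fun ω => ?_⟩
    simp [normIncr, div_eq_inv_mul]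
  integral_eq_zero x := by
    have hi : ∀ u, Integrable (G u) P := fun u => (hG.memLp_two u).integrable (by norm_num)
    simp only [normIncr]
    rw [integral_div, integral_sub (hi _) (hi _), hG.integral_eq_zero, hG.integral_eq_zero]
    simp
  integral_mul x y := by
    have h0 : 0 < |h| ^ r := Real.rpow_pos_of_pos (abs_pos.2 hh) r
    have h1 : ∀ ω, normIncr G σ2 h x ω * normIncr G σ2 h y ω =
        (G (x + h) ω - G x ω) * (G (y + h) ω - G y ω) / |h| ^ r := by
      intro ω
      rw [normIncr, normIncr, div_mul_div_comm, hG.incrVar_eq hσ h, Real.mul_self_sqrt h0.le]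
    simp only [h1]
    rw [integral_div, hG.integral_incr_mul_incr]
    simp only [hG.incrVar_eq hσ, fracKernel]
    have h2 : ∀ u, |u / h| ^ r = |u| ^ r / |h| ^ r := fun u => by
      rw [abs_div, Real.div_rpow (abs_nonneg _) (abs_nonneg _)]
    rw [show (x - y) / h + 1 = (x - y + h) / h by field_simp,
      show (x - y) / h - 1 = (x - y - h) / h by field_simp, h2, h2, h2]
    ring
  aemeasurable_uncurry := by
    have hs : MeasurePreserving (fun p : ℝ × Ω => (p.1 + h, p.2)) (volume.prod P)
        (volume.prod P) :=
      (measurePreserving_add_right volume h).prod (MeasurePreserving.id P)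
    exact ((hG.aemeasurable_uncurry.comp_quasiMeasurePreserving hs.quasiMeasurePreserving).sub
      hG.aemeasurable_uncurry).div_const _
  continuous := (continuous_fracKernel hr).comp (continuous_id.div_const h)
  zero := by simpa using fracKernel_zero hr

end IsCenteredGaussianWithIncrVar

/-- Convergence in distribution asks for measurability at every index, so `h ≤ 0` is included. At `h
= 0` the increment vanishes and the functional is constant; negative `h` is covered by evenness of
`σ2`. -/
theorem aemeasurable_incrFunctional [IsProbabilityMeasure P]
    (hG : IsCenteredGaussianWithIncrVar G P σ2) (hr : 0 < r)
    (hσ : ∀ h : ℝ, 0 ≤ h → σ2 h = h ^ r) {f : ℝ → ℝ} (hf : MemLp f 2 (gaussianReal 0 1))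
    {a b : ℝ} (hab : a ≤ b) (h : ℝ) : AEMeasurable (incrFunctional G σ2 f a b h) P := by
  rcases eq_or_ne h 0 with rfl | hh
  · have : incrFunctional G σ2 f a b 0 = fun _ => ∫ _x in a..b, f 0 := by
      ext ω
      simp [incrFunctional, normIncr]
    rw [this]
    exact aemeasurable_const
  · exact ((hG.isStationaryGaussian_normIncr hr hσ hh).memLp_integral hf
      hab).aestronglyMeasurable.aemeasurable

end Increments

/-! ### The main theorem -/

theorem theorem1p2 {Ω : Type*} [MeasurableSpace Ω] (P : Measure Ω) [IsProbabilityMeasure P]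
    (G : ℝ → Ω → ℝ) (σ2 : ℝ → ℝ) (hG : IsCenteredGaussianWithIncrVar G P σ2)
    (a b : ℝ) (hab : a < b)
    (f : ℝ → ℝ) (hf : MemLp f 2 (gaussianReal 0 1))
    (hsymm : ∀ᵐ x ∂(gaussianReal 0 1), f (-x) = f x)
    (k₀ : ℕ) (hk₀ : IsLeast {m : ℕ | 1 ≤ m ∧ hermiteCoeff f (2 * m) ≠ 0} k₀)
    (r : ℝ) (hr : 0 < r) (hr' : r ≤ 2 - 1 / (2 * (k₀ : ℝ)))
    (hσ : ∀ h : ℝ, 0 ≤ h → σ2 h = h ^ r) :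
    (∀ h : ℝ, 0 < h →
      (∀ᵐ ω ∂P, IntervalIntegrable (fun x => f (normIncr G σ2 h x ω)) volume a b) ∧
      MemLp (incrFunctional G σ2 f a b h) 2 P ∧
      0 < Var[incrFunctional G σ2 f a b h; P]) ∧
    TendstoInDistribution
      (fun (h : ℝ) (ω : Ω) =>
        (incrFunctional G σ2 f a b h ω - (b - a) * ∫ x, f x ∂(gaussianReal 0 1)) /
          √(Var[incrFunctional G σ2 f a b h; P]))
      (𝓝[>] (0 : ℝ)) (id : ℝ → ℝ) (fun _ => P) (gaussianReal 0 1) := by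
  obtain ⟨⟨hk1, hk2⟩, hmin⟩ := hk₀
  have hY : ∀ h : ℝ, 0 < h → IsStationaryGaussian (normIncr G σ2 h)
      (fun t => fracKernel r (t / h)) P :=
    fun h hh => hG.isStationaryGaussian_normIncr hr hσ hh.ne'
  have hd : Even (2 * k₀) := even_two_mul k₀
  refine ⟨fun h hh => ⟨(hY h hh).ae_intervalIntegrable hf hab.le,
    (hY h hh).memLp_integral hf hab.le,
    (hY h hh).variance_integral_pos hf hab hd (by lia) hk2⟩, ?_⟩
  have hmeas : ∀ h, AEMeasurable (fun ω =>
      (incrFunctional G σ2 f a b h ω - (b - a) * ∫ x, f x ∂(gaussianReal 0 1)) /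
          √(Var[incrFunctional G σ2 f a b h; P])) P := fun h =>
    ((aemeasurable_incrFunctional hG hr hσ hf hab.le h).sub_const _).div_const _
  obtain ⟨c, -, hc⟩ := abs_fracKernel_pow_le hr (d := 2 * k₀) (by lia) (by push_cast; exact hr')
  -- Degree `0` is removed by centring, odd degrees vanish by symmetry, and the remaining even
  -- degrees vanish by minimality of `k₀`.
  have hlow : ∀ m < 2 * k₀, hermiteBasis.repr (memLp_sub_integral hf).toLp m = 0 := by
    intro m hm
    rcases eq_or_ne m 0 with rfl | hm0
    · exact repr_toLp_sub_integral_zero hf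
    rw [repr_toLp_sub_integral_of_ne_zero hf hm0]
    rcases Nat.even_or_odd m with he | ho
    · obtain ⟨j, rfl⟩ := he.two_dvd
      by_contra hne
      have := hmin ⟨show 1 ≤ j by lia, hne⟩
      lia
    · exact hermiteCoeff_odd_eq_zero hsymm ho
  have hchar : ∀ t : ℝ, Tendsto (fun h => charFun (P.map fun ω =>
      (incrFunctional G σ2 f a b h ω - (b - a) * ∫ x, f x ∂(gaussianReal 0 1)) /
        √(Var[incrFunctional G σ2 f a b h; P])) t) (𝓝[>] 0)
      (𝓝 (Complex.exp (-(t ^ 2 : ℝ) / 2))) := by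
    intro t
    rw [tendsto_iff_norm_sub_tendsto_zero, Metric.tendsto_nhds]
    intro ε hε
    have h1 := eventually_norm_integral_exp_normalize_sub_le (P := P) (continuous_fracKernel hr)
      (fracKernel_zero hr) (by lia) hd hc a (sub_pos.2 hab) hlow
      (by rwa [repr_toLp_sub_integral_of_ne_zero hf (by lia)]) t (half_pos hε)
    filter_upwards [h1, self_mem_nhdsWithin] with h h2 hh
    have h3 := h2 _ (hY h hh)
    rw [add_sub_cancel] at h3
    rw [dist_zero_right, norm_norm, charFun_apply_real, integral_map (hmeas h)
      (Continuous.aestronglyMeasurable (by fun_prop))]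
    refine lt_of_le_of_lt (le_of_eq_of_le ?_ h3) (half_lt_self hε)
    congr 2
    refine integral_congr_ae ?_
    filter_upwards [(hY h hh).coeFn_normalize_integralLp hf hab] with ω hω
    rw [hω]
    rfl
  refine ⟨hmeas, aemeasurable_id, ?_⟩
  -- Lévy's continuity theorem is applied along sequences, which suffices because `𝓝[>] 0` is
  -- countably generated.
  refine tendsto_of_seq_tendsto fun u hu => ?_
  refine ProbabilityMeasure.tendsto_iff_tendsto_charFun.2 fun t => ?_
  have h1 := (hchar t).comp hu
  have h2 : charFun ((gaussianReal 0 1).map id) t = Complex.exp (-(t ^ 2 : ℝ) / 2) := by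
    rw [Measure.map_id, charFun_gaussianReal]
    push_cast
    ring_nf
  rw [← h2] at h1
  exact h1
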